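/- **Setting.** Let $\mathbf k$ be an ordinary differential field of characteristic $0$ with derivation $\delta$, let $\mathbf k\{Y\}=\mathbf k\{y_1,\dots,y_n\}$ be the ring of differential polynomials, and fix a ranking, i.e. a total order on the derivatives $y_i^{(j)}$ with $\delta^j u\ge u$, and $u\ge v\Rightarrow\delta^j u\ge\delta^j v$. For $f\notin\mathbf k$ let $\mathrm{ld}\,f$ be its leader (highest derivative occurring in it), $\mathrm{lv}\,f\in Y$ the indeterminate of which $\mathrm{ld}\,f$ is a derivative, $\mathrm{rk}\,f=(\mathrm{ld}\,f)^d$ its rank, where $d=\deg_{\mathrm{ld} f}f$, $\mathbf i_f$ the coefficient of $(\mathrm{ld}\,f)^d$ (initial) and $\mathbf s_f=\partial f/\partial(\mathrm{ld}\,f)$ (separant). Ranks are compared first by leader, then by degree; elements of $\mathbf k$ have lower rank than all others. For a finite set $F$, $H_F$ is the set of initials and separants of its elements and $\mathrm{lv}\,F$ the set of its leading variables. $[F]$ and $\{F\}$ are the differential and the radical differential ideal generated by $F$, and $I:S^\infty=\{a\mid sa\in I\text{ for some product }s\text{ of elements of }S\}$ (with the empty product $1$ allowed). A polynomial $f$ is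 *partially reduced* w.r.t. $g$ if no proper derivative of $\mathrm{ld}\,g$ occurs in $f$, *algebraically reduced* if $\deg_{\mathrm{ld}\, g}f<\deg_{\mathrm{ld}\, g}g$, and *reduced* if both hold. A system $(\mathbb A,H)$ of finite sets is *regular* if $\mathbb A\subset\mathbf k\{Y\}\setminus\mathbf k$ is autoreduced (each element is reduced w.r.t. every other one), all elements of $H$ are partially reduced w.r.t. all elements of $\mathbb A$, and $H\supseteq H_{\mathbb A}$. $\mathsf{algrem}(f,\mathbb B)$ denotes a polynomial that is algebraically reduced w.r.t. all elements of $\mathbb B$ and is obtained from $f$ by finitely many pseudo-divisions by elements of $\mathbb B$, where a pseudo-division by $g$ replaces a polynomial $p$ with $\deg_{\mathrm{ld}\,g}p\ge\deg_{\mathrm{ld}\,g}g$ by a polynomial $r$ with $\mathbf i_g^e\,p=qg+r$ for some $e\ge0$ and $q$, and $\deg_{\mathrm{ld}\,g}r<\deg_{\mathrm{ld}\,g}g$; for a set $G$, $\mathsf{algrem}(G,\mathbb B)=\{\mathsf{algrem}(g,\mathbb B)\mid g\in G\}$. Let $\mathbb B^0$ (resp. $\mathbb B^*$) be the set of elements of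 $\mathbb B$ that have minimal (resp. maximal) rank among the elements of $\mathbb B$ with the same leading variable. For a finite set $F$ let $m_y(F)$ be the maximal order of a derivative of $y$ occurring in $F$ ($0$ if there is none), $M(F)=\sum_{y\in Y}m_y(F)$, and, for $Z\subsetneq Y$, $M_Z(F)=(n-|Z|)\sum_{y\in Z}m_y(F)+\sum_{y\notin Z}m_y(F)$. **Algorithm Differentiate&Autoreduce**$(\mathbb C,(m_y)_y)$. Start with $\mathbb D:=\mathbb C$, $\mathbb B:=\varnothing$. Let $(\delta\mathbb B^*)_{m}$ be the set of those $f\in\delta\mathbb B^*$ whose leader $y^{(j)}$ satisfies $j\le m_y$. While $\mathbb D\cup(\delta\mathbb B^*)_{m}\ne\varnothing$: let $f$ be an element of least rank of this set; if $f\in\mathbb D$, put $\bar f:=\mathsf{algrem}(f,\mathbb B)$ and remove $f$ from $\mathbb D$, otherwise put $\bar f:=\mathsf{algrem}(f,\mathbb B\cup(\delta\mathbb B^0\setminus\{f\}))$; if $\mathrm{rk}\,\bar f\ne\mathrm{rk}\,f$ return $\{1\}$; add $\bar f$ to $\mathbb B$. At the end return $\mathbb B$. **Algorithm RGBound**$(F_0,H_0)$.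 Start with $T:=\varnothing$, $U:=\{(F_0,\varnothing,H_0)\}$. While $U\neq\varnothing$: take and remove any $(F,\mathbb C,H)\in U$; let $f$ be an element of $F$ of least rank, $D:=\{C\in\mathbb C\mid\mathrm{lv}\,C=\mathrm{lv}\,f\}$, $G:=(F\cup D)\setminus\{f\}$, $\bar{\mathbb C}:=(\mathbb C\setminus D)\cup\{f\}$, and let $\mathbb B$ be the result of Differentiate&Autoreduce$(\bar{\mathbb C},(m_y(G\cup\bar{\mathbb C}\cup H))_y)$. If $\mathbb B\ne\{1\}$, put $\bar F:=\mathsf{algrem}(G,\mathbb B)\setminus\{0\}$ and $\bar H:=\mathsf{algrem}(H,\mathbb B)\cup H_{\mathbb B}$, and if $\bar F\cap\mathbf k=\varnothing$ and $0\notin\bar H$, then add $(\mathbb B^0,\bar H)$ to $T$ if $\bar F=\varnothing$, and add $(\bar F,\mathbb B^0,\bar H)$ to $U$ otherwise. Finally, if $\mathbf s_f\notin\mathbf k$, add $(F\cup\{\mathbf s_f\},\mathbb C,H)$ to $U$ and, if moreover $\mathbf i_f\notin\mathbf k$, also $(F\cup\{\mathbf i_f\},\mathbb C,H)$. Return $T$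 when $U=\varnothing$. **Proposition.** Let $F_0,H_0\subset\mathbf k\{Y\}$ be finite sets with $F_0\ne\varnothing$ and $F_0\cap\mathbf k=\varnothing$. Whatever choices are made where the algorithms leave a choice (including the choice of the pseudo-divisions in $\mathsf{algrem}$): 1. RGBound$(F_0,H_0)$ terminates: every sequence of successive pseudo-divisions by elements of a finite set is finite, every run of RGBound (with the loops of the calls of Differentiate&Autoreduce included) is finite, and every instruction that is reached can be carried out, so that a run ends only with $U=\varnothing$. 2. Every triple $(F,\mathbb C,H)$ that is ever in $U$ satisfies $M(F\cup\mathbb C\cup H)\le(n-1)!\cdot M(F_0\cup H_0)$; moreover, if $l=|\mathrm{lv}\,\mathbb C|<n$, then $M_{\mathrm{lv}\,\mathbb C}(F\cup\mathbb C\cup H)\le(n-1)(n-2)\cdots(n-l)\cdot M(F_0\cup H_0)$. 3. The returned set $T$ is a finite set of regular systems with $\{F_0\}:H_0^\infty=\bigcap_{(\mathbb A,H)\in T}[\mathbb A]:H^\infty$ (the empty intersection being $\mathbf k\{Y\}$), and $M(\mathbb A\cup H)\le(n-1)!\cdot M(F_0\cup H_0)$ for all $(\mathbb A,H)\in T$.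 -/

import Mathlib

/-! ## Ordinary differential polynomials -/

/-- The derivative `y_var^(ord)` of one of the differential indeterminates `y_1, …, y_n`. -/
@[ext]
structure DVar (n : ℕ) where
  var : Fin n
  ord : ℕ

/-- `δ^j u`. -/
def DVar.shift {n : ℕ} (j : ℕ) (u : DVar n) : DVar n := ⟨u.var, u.ord + j⟩

/-- A total order on the derivatives is a ranking: `θ u ≥ u`, and `u ≥ v` implies `θ u ≥ θ v`,
for all derivative operators `θ = δ^j`. -/
structure IsRanking (n : ℕ) [LinearOrder (DVar n)] : Prop where
  le_shift : ∀ (j : ℕ) (u : DVar n), u ≤ u.shift j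
  shift_le_shift : ∀ (j : ℕ) (u v : DVar n), v ≤ u → v.shift j ≤ u.shift j

/-- The ring `k{y_1, …, y_n}`. -/
abbrev DPoly (k : Type*) [Field k] (n : ℕ) := MvPolynomial (DVar n) k

noncomputable section

namespace RG

open MvPolynomial
open scoped Differential Classical

instance instDecEqDPoly {k : Type*} [Field k] {n : ℕ} : DecidableEq (DPoly k n) :=
  Classical.decEq _

section Ring

variable {k : Type*} [Field k] {n : ℕ}

/-- The differential polynomials that lie in the base field. -/
def constants (k : Type*) [Field k] (n : ℕ) : Set (DPoly k n) := Set.range C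

section Derivation

variable [Differential k]

/-- Differentiation of the coefficients. -/
def coeffDerivFun (f : DPoly k n) : DPoly k n :=
  ∑ m ∈ f.support, monomial m ((coeff m f)′)

lemma coeff_coeffDerivFun (f : DPoly k n) (m : DVar n →₀ ℕ) :
    coeff m (coeffDerivFun f) = (coeff m f)′ := by
  rw [coeffDerivFun, coeff_sum]
  simp only [coeff_monomial]
  rw [Finset.sum_ite_eq' f.support m]
  split_ifs with h
  · rfl
  · rw [notMem_support_iff.mp h, map_zero]

/-- Differentiation of the coefficients, as a derivation. -/
def coeffDeriv (k : Type*) [Field k] [Differential k] (n : ℕ) :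
    Derivation ℤ (DPoly k n) (DPoly k n) :=
  Derivation.mk'
    (AddMonoidHom.toIntLinearMap
      { toFun := coeffDerivFun
        map_zero' := by
          ext m; rw [coeff_coeffDerivFun]; simp
        map_add' := fun f g => by
          ext m; simp only [coeff_coeffDerivFun, coeff_add, map_add] })
    (fun f g => by
      ext m
      simp only [AddMonoidHom.coe_toIntLinearMap, AddMonoidHom.coe_mk, ZeroHom.coe_mk,
        smul_eq_mul, coeff_add]
      rw [mul_comm g, coeff_coeffDerivFun, coeff_mul, coeff_mul, coeff_mul, map_sum,
        ← Finset.sum_add_distrib]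
      refine Finset.sum_congr rfl fun x _ => ?_
      rw [Derivation.leibniz, coeff_coeffDerivFun, coeff_coeffDerivFun, smul_eq_mul, smul_eq_mul,
        mul_comm (coeff x.2 g)])

/-- The derivation `δ` of `k{y_1, …, y_n}`: it extends the derivation of `k` and maps
`y_i^(j)` to `y_i^(j+1)`. -/
def delta (k : Type*) [Field k] [Differential k] (n : ℕ) :
    Derivation ℤ (DPoly k n) (DPoly k n) :=
  coeffDeriv k n + (mkDerivation k fun u : DVar n => (X (u.shift 1) : DPoly k n)).restrictScalars ℤ

lemma delta_C (a : k) : delta k n (C a) = C (a′) := by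
  have h : coeffDeriv k n (C a) = C (a′) := by
    ext m
    change coeff m (coeffDerivFun (C a)) = _
    rw [coeff_coeffDerivFun, coeff_C, coeff_C]
    split_ifs <;> simp
  simp [delta, h]

lemma delta_X (u : DVar n) : delta k n (X u) = X (u.shift 1) := by
  have h : coeffDeriv k n (X u) = 0 := by
    ext m
    change coeff m (coeffDerivFun (X u)) = _
    rw [coeff_coeffDerivFun, coeff_X]
    split_ifs <;> simp
  simp [delta, h]

/-- An ideal closed under `δ`. -/
def IsDiffIdeal (I : Ideal (DPoly k n)) : Prop := ∀ f ∈ I, delta k n f ∈ I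

/-- `[F]`, the differential ideal generated by `F`. -/
def diffIdeal (F : Set (DPoly k n)) : Ideal (DPoly k n) :=
  sInf {I | F ⊆ I ∧ IsDiffIdeal I}

/-- `{F}`, the radical differential ideal generated by `F`. -/
def radDiffIdeal (F : Set (DPoly k n)) : Ideal (DPoly k n) :=
  sInf {I | F ⊆ I ∧ IsDiffIdeal I ∧ I.IsRadical}

end Derivation

/-- The saturated ideal `I : S^∞`. -/
def saturation (I : Ideal (DPoly k n)) (S : Set (DPoly k n)) : Ideal (DPoly k n) where
  carrier := {a | ∃ s ∈ Submonoid.closure S, s * a ∈ I}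
  zero_mem' := ⟨1, one_mem _, by simp⟩
  add_mem' := by
    rintro a b ⟨s, hs, ha⟩ ⟨t, ht, hb⟩
    refine ⟨s * t, mul_mem hs ht, ?_⟩
    have : s * t * (a + b) = t * (s * a) + s * (t * b) := by ring
    rw [this]
    exact I.add_mem (I.mul_mem_left _ ha) (I.mul_mem_left _ hb)
  smul_mem' := by
    rintro c a ⟨s, hs, ha⟩
    refine ⟨s, hs, ?_⟩
    have : s * (c • a) = c * (s * a) := by rw [smul_eq_mul]; ring
    rw [this]
    exact I.mul_mem_left _ ha

/-! ## Orders -/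

/-- `m_y(F)`: the maximal order of a derivative of `y` occurring in `F` (zero if there is none). -/
def maxOrd (F : Finset (DPoly k n)) (y : Fin n) : ℕ :=
  F.sup fun f => (f.vars.filter fun u => u.var = y).sup DVar.ord

/-- `M(F) = ∑_y m_y(F)`. -/
def sumOrd (F : Finset (DPoly k n)) : ℕ := ∑ y, maxOrd F y

/-- `M_Z(F) = (n - |Z|) ∑_{y ∈ Z} m_y(F) + ∑_{y ∉ Z} m_y(F)`. -/
def weightedOrd (Z : Finset (Fin n)) (F : Finset (DPoly k n)) : ℕ :=
  (n - Z.card) * ∑ y ∈ Z, maxOrd F y + ∑ y ∈ Zᶜ, maxOrd F y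

/-- The coefficient of `u^d` in `f`, viewed as a univariate polynomial in `u`. -/
def coeffIn (u : DVar n) (d : ℕ) (f : DPoly k n) : DPoly k n :=
  ∑ m ∈ f.support with m u = d, monomial (m.erase u) (coeff m f)

end Ring

/-! ## Leaders, ranks, reduction -/

section Ranking

variable {k : Type*} [Field k] {n : ℕ} [LinearOrder (DVar n)]

/-- The leader of `f`; it is `⊥` exactly when `f` lies in `k`. -/
def leader (f : DPoly k n) : WithBot (DVar n) := f.vars.max

/-- The leading variable of `f`; it is `⊥` exactly when `f` lies in `k`. -/
def lv (f : DPoly k n) : WithBot (Fin n) := (leader f).map DVar.var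

/-- The set of the leading variables of the elements of `F`. -/
def lvSet (F : Finset (DPoly k n)) : Finset (Fin n) :=
  Finset.univ.filter fun y => ∃ f ∈ F, lv f = (y : WithBot (Fin n))

/-- The rank `u_f^d` of `f`, ranks being compared first by the leader, then by the degree;
it is `⊥` exactly when `f` lies in `k`. -/
def rank (f : DPoly k n) : WithBot (DVar n ×ₗ ℕ) :=
  (leader f).map fun u => toLex (u, degreeOf u f)

/-- The initial of `f` (of no significance for `f` in `k`). -/
def initial (f : DPoly k n) : DPoly k n :=
  if h : f.vars.Nonempty then coeffIn (f.vars.max' h) (degreeOf (f.vars.max' h) f) f else f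

/-- The separant of `f`, which is the partial derivative of `f` by its leader
(of no significance for `f` in `k`). -/
def separant (f : DPoly k n) : DPoly k n :=
  if h : f.vars.Nonempty then pderiv (f.vars.max' h) f else 0

/-- `H_F`, the set of initials and separants of the elements of `F`. -/
def inisep (F : Finset (DPoly k n)) : Finset (DPoly k n) :=
  F.image initial ∪ F.image separant

/-- No proper derivative of the leader of `g` appears in `f`. -/
def PartiallyReduced (f g : DPoly k n) : Prop :=
  ∀ u : DVar n, leader g = u → ∀ v ∈ f.vars, ¬ (v.var = u.var ∧ u.ord < v.ord)

/-- The degree of `f` in the leader of `g` is less than that of `g`. -/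
def AlgReduced (f g : DPoly k n) : Prop :=
  ∀ u : DVar n, leader g = u → degreeOf u f < degreeOf u g

/-- `f` is reduced w.r.t. `g`. -/
def Reduced (f g : DPoly k n) : Prop := PartiallyReduced f g ∧ AlgReduced f g

/-- Autoreduced sets of nonconstant differential polynomials. -/
def Autoreduced (A : Finset (DPoly k n)) : Prop :=
  (∀ f ∈ A, f ∉ constants k n) ∧ ∀ f ∈ A, ∀ g ∈ A, f ≠ g → Reduced f g

/-- The system `A = 0, H ≠ 0` is regular. -/
def IsRegularSystem (A H : Finset (DPoly k n)) : Prop :=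
  Autoreduced A ∧ (∀ h ∈ H, ∀ a ∈ A, PartiallyReduced h a) ∧ inisep A ⊆ H

/-- One algebraic pseudo-division: `f` is not algebraically reduced w.r.t. `g ∈ B`, and `r` is a
pseudo-remainder of `f` by `g`, both viewed as univariate polynomials in the leader `u` of `g`. -/
def PseudoStep (B : Finset (DPoly k n)) (f r : DPoly k n) : Prop :=
  ∃ g ∈ B, ∃ u : DVar n, leader g = u ∧ degreeOf u g ≤ degreeOf u f ∧
    degreeOf u r < degreeOf u g ∧ ∃ (e : ℕ) (q : DPoly k n), initial g ^ e * f = q * g + r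

/-- `r` is a possible value of `algrem(f, B)`: it arises from `f` by finitely many
pseudo-divisions by elements of `B`, and it is algebraically reduced w.r.t. all of `B`. -/
def AlgRem (B : Finset (DPoly k n)) (f r : DPoly k n) : Prop :=
  Relation.ReflTransGen (PseudoStep B) f r ∧ ∀ g ∈ B, AlgReduced r g

/-- `R` is a possible value of `algrem(G, B) = {algrem(g, B) | g ∈ G}`. -/
def AlgRemSet (B G R : Finset (DPoly k n)) : Prop :=
  ∃ ρ : DPoly k n → DPoly k n, (∀ g ∈ G, AlgRem B g (ρ g)) ∧ R = G.image ρ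

/-- `B^0 = {min B_v | v ∈ lv B}`. -/
def lowest (B : Finset (DPoly k n)) : Finset (DPoly k n) :=
  B.filter fun f => ∀ g ∈ B, lv g = lv f → rank f ≤ rank g

/-- `B^* = {max B_v | v ∈ lv B}`. -/
def highest (B : Finset (DPoly k n)) : Finset (DPoly k n) :=
  B.filter fun f => ∀ g ∈ B, lv g = lv f → rank g ≤ rank f

/-- The elements of `F` whose leader `y^(j)` satisfies `j ≤ m_y`. -/
def bounded (m : Fin n → ℕ) (F : Finset (DPoly k n)) : Finset (DPoly k n) :=
  F.filter fun f => ∀ u : DVar n, leader f = u → u.ord ≤ m u.var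

end Ranking

/-! ## The algorithm

The loops are given by a nondeterministic transition relation: every choice that the pseudo-code
leaves open (the triple to be treated, an element of least rank, the order in which
pseudo-divisions are carried out) is left open. -/

section Algorithm

variable {k : Type*} [Field k] [Differential k] {n : ℕ} [LinearOrder (DVar n)]

/-- `D ∪ (δ B^*)_{m_i}`, the set that controls the loop of Differentiate&Autoreduce. -/
def candidates (m : Fin n → ℕ) (D B : Finset (DPoly k n)) : Finset (DPoly k n) :=
  D ∪ bounded m ((highest B).image (delta k n))

/-- `f` is an element of least rank of `F`. -/
def IsLeastRank (F : Finset (DPoly k n)) (f : DPoly k n) : Prop :=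
  f ∈ F ∧ ∀ g ∈ F, rank f ≤ rank g

/-- The set w.r.t. which `f` is reduced in the loop of Differentiate&Autoreduce. -/
def divisors (D B : Finset (DPoly k n)) (f : DPoly k n) : Finset (DPoly k n) :=
  if f ∈ D then B else B ∪ ((lowest B).image (delta k n)).erase f

end Algorithm

/-- A system `(F, C, H)` in the list `U`. -/
@[ext]
structure Triple (k : Type*) [Field k] (n : ℕ) where
  F : Finset (DPoly k n)
  C : Finset (DPoly k n)
  H : Finset (DPoly k n)

/-- An output system `(A, H)`. -/
@[ext]
structure Sys (k : Type*) [Field k] (n : ℕ) where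
  A : Finset (DPoly k n)
  H : Finset (DPoly k n)

instance instDecEqTriple {k : Type*} [Field k] {n : ℕ} : DecidableEq (Triple k n) :=
  Classical.decEq _

instance instDecEqSys {k : Type*} [Field k] {n : ℕ} : DecidableEq (Sys k n) :=
  Classical.decEq _

section Algorithm

variable {k : Type*} [Field k] {n : ℕ} [LinearOrder (DVar n)]

/-- `{C ∈ 𝐂 | lv C = lv f}`. -/
def conflict (t : Triple k n) (f : DPoly k n) : Finset (DPoly k n) :=
  t.C.filter fun c => lv c = lv f

/-- `G = F ∪ D \ {f}`, where `D` is the set `conflict t f`. -/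
def newG (t : Triple k n) (f : DPoly k n) : Finset (DPoly k n) :=
  (t.F ∪ conflict t f).erase f

/-- The set `𝐂 \ D ∪ {f}`, where `D` is the set `conflict t f`. -/
def newC (t : Triple k n) (f : DPoly k n) : Finset (DPoly k n) :=
  insert f (t.C \ conflict t f)

/-- The numbers that are passed to Differentiate&Autoreduce. -/
def callOrd (t : Triple k n) (f : DPoly k n) (y : Fin n) : ℕ :=
  maxOrd (newG t f ∪ newC t f ∪ t.H) y

/-- The systems with the separant, respectively the initial, of `f` added. -/
def splits (t : Triple k n) (f : DPoly k n) : Finset (Triple k n) :=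
  if separant f ∈ constants k n then ∅
  else insert ⟨insert (separant f) t.F, t.C, t.H⟩
    (if initial f ∈ constants k n then ∅ else {⟨insert (initial f) t.F, t.C, t.H⟩})

end Algorithm

/-- The configurations of RGBound: either at the head of the main loop, with the sets `U` and `T`,
or at the head of the loop of a call of Differentiate&Autoreduce, made for the triple `t` (already
removed from `U`) and its element `f`, with the current sets `D` and `B` of that loop. -/
inductive Config (k : Type*) [Field k] (n : ℕ)
  | main (U : Finset (Triple k n)) (T : Finset (Sys k n))
  | auto (U : Finset (Triple k n)) (T : Finset (Sys k n)) (t : Triple k n) (f : DPoly k n)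
      (D B : Finset (DPoly k n))

/-- The transitions of RGBound. -/
inductive Step {k : Type*} [Field k] [Differential k] {n : ℕ} [LinearOrder (DVar n)] :
    Config k n → Config k n → Prop
  /-- A triple is taken and removed from `U`, an element `f` of least rank of its first component
  is chosen, and Differentiate&Autoreduce is called. -/
  | call (U : Finset (Triple k n)) (T : Finset (Sys k n)) (t : Triple k n) (f : DPoly k n)
      (ht : t ∈ U) (hf : IsLeastRank t.F f) :
      Step (.main U T) (.auto (U.erase t) T t f (newC t f) ∅)
  /-- The loop of Differentiate&Autoreduce: the remainder `gbar` of `g` has the rank of `g`.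
  (If `g` is not in `D`, then `D` does not change.) -/
  | loop (U : Finset (Triple k n)) (T : Finset (Sys k n)) (t : Triple k n) (f : DPoly k n)
      (D B : Finset (DPoly k n)) (g gbar : DPoly k n)
      (hg : IsLeastRank (candidates (callOrd t f) D B) g)
      (hrem : AlgRem (divisors D B g) g gbar) (hrank : rank gbar = rank g) :
      Step (.auto U T t f D B) (.auto U T t f (D.erase g) (insert gbar B))
  /-- Differentiate&Autoreduce returns `{1}`. -/
  | unit (U : Finset (Triple k n)) (T : Finset (Sys k n)) (t : Triple k n) (f : DPoly k n)
      (D B : Finset (DPoly k n)) (g gbar : DPoly k n)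
      (hg : IsLeastRank (candidates (callOrd t f) D B) g)
      (hrem : AlgRem (divisors D B g) g gbar) (hrank : rank gbar ≠ rank g) :
      Step (.auto U T t f D B) (.main (U ∪ splits t f) T)
  /-- Differentiate&Autoreduce returns `B`; the remainders show that the system is inconsistent. -/
  | discard (U : Finset (Triple k n)) (T : Finset (Sys k n)) (t : Triple k n) (f : DPoly k n)
      (D B : Finset (DPoly k n)) (RF RH : Finset (DPoly k n))
      (hdone : candidates (callOrd t f) D B = ∅)
      (hG : AlgRemSet B (newG t f) RF) (hH : AlgRemSet B t.H RH)
      (hbad : (∃ r ∈ RF.erase 0, r ∈ constants k n) ∨ (0 : DPoly k n) ∈ RH ∪ inisep B) :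
      Step (.auto U T t f D B) (.main (U ∪ splits t f) T)
  /-- Differentiate&Autoreduce returns `B`; a system is added to the output. -/
  | output (U : Finset (Triple k n)) (T : Finset (Sys k n)) (t : Triple k n) (f : DPoly k n)
      (D B : Finset (DPoly k n)) (RF RH : Finset (DPoly k n))
      (hdone : candidates (callOrd t f) D B = ∅)
      (hG : AlgRemSet B (newG t f) RF) (hH : AlgRemSet B t.H RH)
      (hH0 : (0 : DPoly k n) ∉ RH ∪ inisep B) (hempty : RF.erase 0 = ∅) :
      Step (.auto U T t f D B)
        (.main (U ∪ splits t f) (insert ⟨lowest B, RH ∪ inisep B⟩ T))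
  /-- Differentiate&Autoreduce returns `B`; a new triple is added to `U`. -/
  | push (U : Finset (Triple k n)) (T : Finset (Sys k n)) (t : Triple k n) (f : DPoly k n)
      (D B : Finset (DPoly k n)) (RF RH : Finset (DPoly k n))
      (hdone : candidates (callOrd t f) D B = ∅)
      (hG : AlgRemSet B (newG t f) RF) (hH : AlgRemSet B t.H RH)
      (hconst : ∀ r ∈ RF.erase 0, r ∉ constants k n)
      (hH0 : (0 : DPoly k n) ∉ RH ∪ inisep B) (hne : (RF.erase 0).Nonempty) :
      Step (.auto U T t f D B)
        (.main (insert ⟨RF.erase 0, lowest B, RH ∪ inisep B⟩ U ∪ splits t f) T)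

/-- The initial configuration `U = {(F₀, ∅, H₀)}`, `T = ∅`. -/
def start {k : Type*} [Field k] {n : ℕ} (F₀ H₀ : Finset (DPoly k n)) : Config k n :=
  .main {⟨F₀, ∅, H₀⟩} ∅

/-- The configurations that occur in some run of RGBound on the input `(F₀, H₀)`. -/
def Reachable {k : Type*} [Field k] [Differential k] {n : ℕ} [LinearOrder (DVar n)]
    (F₀ H₀ : Finset (DPoly k n)) (c : Config k n) : Prop :=
  Relation.ReflTransGen Step (start F₀ H₀) c

end RG

end

open RG

/-!
RGBound terminates because everything put into `U` in place of a triple is smaller than that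
triple: adding the separant or the initial of `f` lowers the least rank of `F`, while replacing the
element of `C` with the leading variable of `f`, if there is one, by `f` lowers the rank of that
element, and Differentiate&Autoreduce does not raise it again. The derivatives are well ordered by
Dickson's lemma.

For the ideals, split `{F ∪ C} : H^∞` according to whether the initial and the separant of `f`
vanish. Where they do not, they are regular modulo the ideal `Q` in question. A pseudo-remainder `r`
of `g` by elements of `Q` with regular initials lies in `Q` if and only if `g` does, and if it has
the rank of `g`, its initial and separant are those of `g` up to regular factors and modulo `Q`.
Hence the rounds of Differentiate&Autoreduce preserve `Q`, and a loss of rank puts the initial of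
`g`, which is regular, into `Q`, so that `Q` is the whole ring. For an output system,
`{A} : H^∞ = [A] : H^∞` because `[A] : H^∞` is radical: an element of `[A]` involves finitely many
derivatives of elements of `A`, which form a triangular set with initials and separants in `H`, and
Lazard's lemma applies to it.

For the bounds, let `Z` be the set of the leading variables of the set `𝐂̄` of a call. The
derivatives of `y ∈ Z` that survive in the result have at most the order of the leader of the
element of `𝐂̄` with the leading variable `y`. Every other variable gains at most the number of
differentiations, which is the sum of the orders that the variables in `Z` lose. The weight
`n - |Z|` of the variables in `Z` is the number of the other variables and pays for this growth, so
that `M_Z` increases only when a variable enters `Z`, and then at most by the factor `n - |Z|` for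
the new `Z`.
-/

lemma DVar.shift_injective {n : ℕ} (j : ℕ) :
    Function.Injective (DVar.shift j : DVar n → DVar n) := fun u v h => by
  rw [DVar.shift, DVar.shift, DVar.mk.injEq] at h
  exact DVar.ext h.1 (Nat.add_right_cancel h.2)

lemma IsRanking.lt_shift {n : ℕ} [LinearOrder (DVar n)] (hrk : IsRanking n) (u : DVar n) :
    u < u.shift 1 :=
  (hrk.le_shift 1 u).lt_of_ne fun h => Nat.succ_ne_self _ (congrArg DVar.ord h).symm

lemma IsRanking.le_iff_ord_le {n : ℕ} [LinearOrder (DVar n)] (hrk : IsRanking n) {u v : DVar n}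
    (h : u.var = v.var) : u ≤ v ↔ u.ord ≤ v.ord := by
  have le_of_ord_le : ∀ {u v : DVar n}, u.var = v.var → u.ord ≤ v.ord → u ≤ v := by
    intro u v h hord
    have hv : v = u.shift (v.ord - u.ord) := DVar.ext h.symm (Nat.add_sub_of_le hord).symm
    rw [hv]
    exact hrk.le_shift _ _
  refine ⟨fun hle => ?_, le_of_ord_le h⟩
  by_contra hlt
  have heq : u = v := hle.antisymm (le_of_ord_le h.symm (not_le.mp hlt).le)
  exact hlt (heq ▸ le_rfl)

lemma IsRanking.wellFoundedLT {n : ℕ} [LinearOrder (DVar n)] (hrk : IsRanking n) :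
    WellFoundedLT (DVar n) := by
  have : WellQuasiOrderedLE (DVar n) := by
    refine ⟨fun u => ?_⟩
    obtain ⟨i, j, hij, hvar, hord⟩ :=
      ((Finite.wellQuasiOrdered (Eq : Fin n → Fin n → Prop)).prod
        (wellQuasiOrdered_le (α := ℕ))) fun i => ((u i).var, (u i).ord)
    exact ⟨i, j, hij, (hrk.le_iff_ord_le hvar).mpr hord⟩
  infer_instance

noncomputable section

namespace RG

open MvPolynomial
open scoped Differential

/-! ## Polynomials in one of their variables -/

section Univariate

variable {σ R : Type*} [CommSemiring R]

open Classical in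
/-- A multivariate polynomial, viewed as a univariate polynomial in the variable `u`. The
coefficients stay in the same ring, where they do not involve `u`. -/
def toUnivariate (u : σ) : MvPolynomial σ R →ₐ[R] Polynomial (MvPolynomial σ R) :=
  aeval fun v => if v = u then Polynomial.X else Polynomial.C (X v)

lemma toUnivariate_X_self (u : σ) :
    toUnivariate u (X u : MvPolynomial σ R) = Polynomial.X := by
  simp [toUnivariate]

lemma toUnivariate_X_of_ne {u v : σ} (h : v ≠ u) :
    toUnivariate u (X v : MvPolynomial σ R) = Polynomial.C (X v) := by
  simp [toUnivariate, h]

lemma toUnivariate_C (u : σ) (a : R) : toUnivariate u (C a) = Polynomial.C (C a) := by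
  rw [toUnivariate, aeval_C]
  rfl

lemma toUnivariate_monomial (u : σ) (m : σ →₀ ℕ) (a : R) :
    toUnivariate u (monomial m a) =
      Polynomial.C (monomial (m.erase u) a) * Polynomial.X ^ m u := by
  have herase : toUnivariate u (monomial (m.erase u) a) =
      Polynomial.C (monomial (m.erase u) a) := by
    rw [monomial_eq, map_mul, toUnivariate_C, map_mul, Finsupp.prod, map_prod, map_prod]
    refine congrArg _ (Finset.prod_congr rfl fun v hv => ?_)
    have hvu : v ≠ u := by
      rintro rfl
      simp at hv
    rw [map_pow, map_pow, toUnivariate_X_of_ne hvu]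
  conv_lhs => rw [← Finsupp.erase_add_single u m]
  rw [monomial_add_single, map_mul, map_pow, toUnivariate_X_self, herase]

lemma coeff_toUnivariate (u : σ) (d : ℕ) (f : MvPolynomial σ R) :
    (toUnivariate u f).coeff d =
      ∑ m ∈ f.support with m u = d, monomial (m.erase u) (coeff m f) := by
  conv_lhs => rw [f.as_sum]
  rw [map_sum, Polynomial.finsetSum_coeff, Finset.sum_filter]
  refine Finset.sum_congr rfl fun m _ => ?_
  rw [toUnivariate_monomial, Polynomial.coeff_C_mul_X_pow]
  simp only [eq_comm]

lemma eval_toUnivariate (u : σ) (f : MvPolynomial σ R) : (toUnivariate u f).eval (X u) = f := by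
  have hcomp : ((Polynomial.aeval (X u : MvPolynomial σ R)).restrictScalars R).comp
      (toUnivariate u) = AlgHom.id R (MvPolynomial σ R) := by
    refine MvPolynomial.algHom_ext fun v => ?_
    by_cases h : v = u
    · simp [h, toUnivariate_X_self]
    · simp [toUnivariate_X_of_ne h]
  simpa [Polynomial.aeval_def] using DFunLike.congr_fun hcomp f

lemma toUnivariate_injective (u : σ) :
    Function.Injective (toUnivariate u : MvPolynomial σ R → Polynomial (MvPolynomial σ R)) :=
  Function.LeftInverse.injective (eval_toUnivariate u)

lemma degreeOf_monomial_le (u : σ) (m : σ →₀ ℕ) (a : R) : degreeOf u (monomial m a) ≤ m u := by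
  rw [degreeOf_le_iff]
  intro m' hm'
  rw [Finset.mem_singleton.mp (support_monomial_subset hm')]

lemma degreeOf_coeff_toUnivariate_le (u v : σ) (d : ℕ) (f : MvPolynomial σ R) :
    degreeOf v ((toUnivariate u f).coeff d) ≤ degreeOf v f := by
  rw [coeff_toUnivariate]
  refine (degreeOf_sum_le v _ _).trans (Finset.sup_le fun m hm => ?_)
  have hmono : m.erase u v ≤ m v := by classical rw [Finsupp.erase_apply]; split_ifs <;> simp
  exact (degreeOf_monomial_le _ _ _).trans
    (hmono.trans (monomial_le_degreeOf v (Finset.mem_filter.mp hm).1))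

lemma degreeOf_coeff_toUnivariate_self (u : σ) (d : ℕ) (f : MvPolynomial σ R) :
    degreeOf u ((toUnivariate u f).coeff d) = 0 := by
  rw [coeff_toUnivariate, ← Nat.le_zero]
  refine (degreeOf_sum_le u _ _).trans (Finset.sup_le fun m _ => ?_)
  exact (degreeOf_monomial_le _ _ _).trans Finsupp.erase_same.le

lemma notMem_vars_iff_degreeOf_eq_zero {u : σ} {f : MvPolynomial σ R} :
    u ∉ f.vars ↔ degreeOf u f = 0 := by
  rw [mem_vars_iff_degreeOf_ne_zero, not_not]

lemma notMem_vars_coeff_toUnivariate (u : σ) (d : ℕ) (f : MvPolynomial σ R) :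
    u ∉ ((toUnivariate u f).coeff d).vars :=
  notMem_vars_iff_degreeOf_eq_zero.mpr (degreeOf_coeff_toUnivariate_self u d f)

lemma natDegree_toUnivariate (u : σ) (f : MvPolynomial σ R) :
    (toUnivariate u f).natDegree = degreeOf u f := by
  apply le_antisymm
  · rw [Polynomial.natDegree_le_iff_coeff_eq_zero]
    intro N hN
    rw [coeff_toUnivariate, Finset.filter_eq_empty_iff.mpr, Finset.sum_empty]
    exact fun m hm => ((monomial_le_degreeOf u hm).trans_lt hN).ne
  · conv_lhs => rw [← eval_toUnivariate u f, Polynomial.eval_eq_sum_range]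
    refine (degreeOf_sum_le u _ _).trans (Finset.sup_le fun i hi => ?_)
    refine (degreeOf_mul_le _ _ _).trans ?_
    rw [degreeOf_coeff_toUnivariate_self, zero_add, X_pow_eq_monomial]
    refine (degreeOf_monomial_le _ _ _).trans ?_
    rw [Finsupp.single_eq_same]
    exact Finset.mem_range_succ_iff.mp hi

lemma toUnivariate_of_notMem_vars {u : σ} {f : MvPolynomial σ R} (h : u ∉ f.vars) :
    toUnivariate u f = Polynomial.C f := by
  have hdeg : (toUnivariate u f).natDegree = 0 := by
    rw [natDegree_toUnivariate, notMem_vars_iff_degreeOf_eq_zero.mp h]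
  obtain ⟨c, hc⟩ := Polynomial.natDegree_eq_zero.mp hdeg
  have heval := eval_toUnivariate u f
  rw [← hc, Polynomial.eval_C] at heval
  rw [← hc, heval]

lemma derivative_toUnivariate (u : σ) (f : MvPolynomial σ R) :
    (toUnivariate u f).derivative = toUnivariate u (pderiv u f) := by
  induction f using MvPolynomial.induction_on with
  | C a => simp
  | add p q hp hq => simp [hp, hq]
  | mul_X p v hp =>
    rw [map_mul, Polynomial.derivative_mul, hp, Derivation.leibniz, map_add, smul_eq_mul,
      smul_eq_mul, map_mul, map_mul]
    by_cases h : v = u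
    · subst h; simp [toUnivariate_X_self]; ring
    · simp [toUnivariate_X_of_ne h, pderiv_X_of_ne h]; ring

lemma degreeOf_pderiv_le (u v : σ) (f : MvPolynomial σ R) :
    degreeOf v (pderiv u f) ≤ degreeOf v f := by
  rw [degreeOf_le_iff]
  intro m hm
  rw [mem_support_iff, coeff_pderiv] at hm
  have hle := monomial_le_degreeOf v (mem_support_iff.mpr (left_ne_zero_of_mul hm))
  rw [Finsupp.add_apply] at hle
  omega

lemma degreeOf_pderiv_self_lt {u : σ} {f : MvPolynomial σ R} (h : degreeOf u f ≠ 0) :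
    degreeOf u (pderiv u f) < degreeOf u f := by
  rw [← natDegree_toUnivariate, ← natDegree_toUnivariate, ← derivative_toUnivariate]
  exact Polynomial.natDegree_derivative_lt (by rwa [natDegree_toUnivariate])

lemma vars_subset_of_degreeOf_le {f g : MvPolynomial σ R}
    (h : ∀ v, degreeOf v f ≤ degreeOf v g) : f.vars ⊆ g.vars := fun v hv => by
  rw [mem_vars_iff_degreeOf_ne_zero] at hv ⊢
  exact fun h0 => hv (Nat.le_zero.mp (h0 ▸ h v))

end Univariate

/-! ## Leaders and ranks -/

section Leader

variable {k : Type*} [Field k] {n : ℕ}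

lemma mem_constants_iff_vars_eq_empty {f : DPoly k n} : f ∈ constants k n ↔ f.vars = ∅ := by
  constructor
  · rintro ⟨a, rfl⟩
    exact vars_C
  · exact fun h => ⟨_, (vars_eq_empty_iff_eq_C.mp h).symm⟩

variable [LinearOrder (DVar n)]

lemma leader_eq_coe_iff {f : DPoly k n} {u : DVar n} :
    leader f = u ↔ u ∈ f.vars ∧ ∀ v ∈ f.vars, v ≤ u :=
  ⟨fun h => ⟨Finset.mem_of_max h, fun _ hv => Finset.le_max_of_eq hv h⟩,
    fun ⟨hu, hle⟩ => le_antisymm (Finset.max_le fun v hv => WithBot.coe_le_coe.mpr (hle v hv))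
      (Finset.le_max hu)⟩

lemma mem_vars_of_leader {f : DPoly k n} {u : DVar n} (h : leader f = u) : u ∈ f.vars :=
  (leader_eq_coe_iff.mp h).1

lemma le_of_leader {f : DPoly k n} {u v : DVar n} (h : leader f = u) (hv : v ∈ f.vars) : v ≤ u :=
  (leader_eq_coe_iff.mp h).2 v hv

lemma leader_eq_bot_iff {f : DPoly k n} : leader f = ⊥ ↔ f ∈ constants k n := by
  rw [leader, Finset.max_eq_bot, mem_constants_iff_vars_eq_empty]

lemma exists_leader_eq_coe {f : DPoly k n} (h : f ∉ constants k n) :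
    ∃ u : DVar n, leader f = u := by
  obtain ⟨u, hu⟩ := WithBot.ne_bot_iff_exists.mp (mt leader_eq_bot_iff.mp h)
  exact ⟨u, hu.symm⟩

lemma notMem_constants_of_leader {f : DPoly k n} {u : DVar n} (h : leader f = u) :
    f ∉ constants k n := by
  rw [← leader_eq_bot_iff, h]
  exact WithBot.coe_ne_bot

lemma ne_zero_of_leader {f : DPoly k n} {u : DVar n} (h : leader f = u) : f ≠ 0 := by
  rintro rfl
  exact notMem_constants_of_leader h ⟨0, map_zero _⟩

lemma degreeOf_leader_ne_zero {f : DPoly k n} {u : DVar n} (h : leader f = u) :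
    degreeOf u f ≠ 0 :=
  mem_vars_iff_degreeOf_ne_zero.mp (mem_vars_of_leader h)

lemma leader_mono {f g : DPoly k n} (h : f.vars ⊆ g.vars) : leader f ≤ leader g :=
  Finset.max_mono h

lemma lv_of_leader {f : DPoly k n} {u : DVar n} (h : leader f = u) : lv f = u.var := by
  rw [lv, h, WithBot.map_coe]

lemma lv_eq_coe_iff {f : DPoly k n} {y : Fin n} :
    lv f = y ↔ ∃ u : DVar n, leader f = u ∧ u.var = y :=
  WithBot.map_eq_some_iff

lemma rank_of_leader {f : DPoly k n} {u : DVar n} (h : leader f = u) :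
    rank f = (toLex (u, degreeOf u f) : DVar n ×ₗ ℕ) := by
  rw [rank, h, WithBot.map_coe]

lemma leader_eq_of_rank_eq {f g : DPoly k n} (h : rank f = rank g) : leader f = leader g := by
  have leader_eq (f : DPoly k n) : leader f = (rank f).map fun p => (ofLex p).1 := by
    rw [rank, WithBot.map_map]
    exact (congrFun WithBot.map_id _).symm
  rw [leader_eq, leader_eq, h]

lemma rank_eq_iff_of_leader {f g : DPoly k n} {u : DVar n} (h : leader g = u) :
    rank f = rank g ↔ leader f = u ∧ degreeOf u f = degreeOf u g := by
  rw [rank_of_leader h, rank, WithBot.map_eq_some_iff]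
  constructor
  · rintro ⟨v, hv, heq⟩
    obtain ⟨rfl, hdeg⟩ := Prod.mk.inj (toLex.injective heq)
    exact ⟨hv, hdeg⟩
  · rintro ⟨hf, hdeg⟩
    exact ⟨u, hf, by rw [hdeg]⟩

lemma leader_le_of_rank_le {f g : DPoly k n} (h : rank f ≤ rank g) : leader f ≤ leader g := by
  by_cases hf : f ∈ constants k n
  · rw [leader_eq_bot_iff.mpr hf]
    exact bot_le
  obtain ⟨u, hu⟩ := exists_leader_eq_coe hf
  by_cases hg : g ∈ constants k n
  · rw [rank_of_leader hu, rank, leader_eq_bot_iff.mpr hg] at h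
    exact absurd h (WithBot.not_coe_le_bot _)
  obtain ⟨v, hv⟩ := exists_leader_eq_coe hg
  rw [rank_of_leader hu, rank_of_leader hv, WithBot.coe_le_coe] at h
  rw [hu, hv, WithBot.coe_le_coe]
  exact Prod.Lex.monotone_fst _ _ h

lemma rank_lt_of_leader_lt {f g : DPoly k n} (h : leader f < leader g) : rank f < rank g :=
  lt_of_not_ge fun hle => (leader_le_of_rank_le hle).not_gt h

lemma rank_lt_of_degreeOf_lt {f g : DPoly k n} {u : DVar n} (hu : leader g = u)
    (hvars : f.vars ⊆ g.vars) (hdeg : degreeOf u f < degreeOf u g) : rank f < rank g := by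
  rcases (leader_mono hvars).lt_or_eq with h | h
  · exact rank_lt_of_leader_lt h
  · rw [hu] at h
    rw [rank_of_leader h, rank_of_leader hu, WithBot.coe_lt_coe, Prod.Lex.toLex_lt_toLex]
    exact Or.inr ⟨rfl, hdeg⟩

lemma max'_vars_of_leader {f : DPoly k n} {u : DVar n} (h : leader f = u)
    (hne : f.vars.Nonempty) : f.vars.max' hne = u :=
  WithBot.coe_injective ((Finset.coe_max' hne).trans h)

lemma initial_of_leader {f : DPoly k n} {u : DVar n} (h : leader f = u) :
    initial f = (toUnivariate u f).leadingCoeff := by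
  have hne : f.vars.Nonempty := ⟨u, mem_vars_of_leader h⟩
  rw [initial, dif_pos hne, max'_vars_of_leader h, Polynomial.leadingCoeff,
    natDegree_toUnivariate, coeff_toUnivariate, coeffIn]

lemma separant_of_leader {f : DPoly k n} {u : DVar n} (h : leader f = u) :
    separant f = pderiv u f := by
  have hne : f.vars.Nonempty := ⟨u, mem_vars_of_leader h⟩
  rw [separant, dif_pos hne, max'_vars_of_leader h]

lemma notMem_vars_initial {f : DPoly k n} {u : DVar n} (h : leader f = u) :
    u ∉ (initial f).vars := by
  rw [initial_of_leader h]
  exact notMem_vars_coeff_toUnivariate _ _ _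

lemma initial_ne_zero {f : DPoly k n} {u : DVar n} (h : leader f = u) : initial f ≠ 0 := by
  rw [initial_of_leader h, Polynomial.leadingCoeff_ne_zero]
  exact (map_ne_zero_iff _ (toUnivariate_injective u)).mpr (ne_zero_of_leader h)

lemma degreeOf_initial_le (f : DPoly k n) (v : DVar n) :
    degreeOf v (initial f) ≤ degreeOf v f := by
  by_cases hf : f ∈ constants k n
  · rw [initial, dif_neg (by simp [mem_constants_iff_vars_eq_empty.mp hf])]
  · obtain ⟨u, hu⟩ := exists_leader_eq_coe hf
    rw [initial_of_leader hu]
    exact degreeOf_coeff_toUnivariate_le _ _ _ _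

lemma degreeOf_separant_le (f : DPoly k n) (v : DVar n) :
    degreeOf v (separant f) ≤ degreeOf v f := by
  by_cases hf : f ∈ constants k n
  · rw [separant, dif_neg (by simp [mem_constants_iff_vars_eq_empty.mp hf]), degreeOf_zero]
    exact Nat.zero_le _
  · obtain ⟨u, hu⟩ := exists_leader_eq_coe hf
    rw [separant_of_leader hu]
    exact degreeOf_pderiv_le _ _ _

lemma vars_initial_subset (f : DPoly k n) : (initial f).vars ⊆ f.vars :=
  vars_subset_of_degreeOf_le (degreeOf_initial_le f)

lemma vars_separant_subset (f : DPoly k n) : (separant f).vars ⊆ f.vars :=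
  vars_subset_of_degreeOf_le (degreeOf_separant_le f)

lemma degreeOf_initial_lt {f : DPoly k n} {u : DVar n} (h : leader f = u) :
    degreeOf u (initial f) < degreeOf u f := by
  rw [notMem_vars_iff_degreeOf_eq_zero.mp (notMem_vars_initial h)]
  exact Nat.pos_of_ne_zero (degreeOf_leader_ne_zero h)

lemma degreeOf_separant_lt {f : DPoly k n} {u : DVar n} (h : leader f = u) :
    degreeOf u (separant f) < degreeOf u f := by
  rw [separant_of_leader h]
  exact degreeOf_pderiv_self_lt (degreeOf_leader_ne_zero h)

lemma rank_initial_lt {f : DPoly k n} (h : f ∉ constants k n) : rank (initial f) < rank f := by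
  obtain ⟨u, hu⟩ := exists_leader_eq_coe h
  exact rank_lt_of_degreeOf_lt hu (vars_initial_subset f) (degreeOf_initial_lt hu)

lemma rank_separant_lt {f : DPoly k n} (h : f ∉ constants k n) : rank (separant f) < rank f := by
  obtain ⟨u, hu⟩ := exists_leader_eq_coe h
  exact rank_lt_of_degreeOf_lt hu (vars_separant_subset f) (degreeOf_separant_lt hu)

lemma separant_ne_zero [CharZero k] {f : DPoly k n} {u : DVar n} (h : leader f = u) :
    separant f ≠ 0 := by
  rw [separant_of_leader h, ← map_ne_zero_iff _ (toUnivariate_injective u),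
    ← derivative_toUnivariate, Ne, Polynomial.derivative_eq_zero, natDegree_toUnivariate]
  exact degreeOf_leader_ne_zero h

lemma initial_eq_separant_of_separant_mem_constants [CharZero k] {f : DPoly k n} {u : DVar n}
    (h : leader f = u) (hs : separant f ∈ constants k n) : initial f = separant f := by
  have hderiv : (toUnivariate u f).derivative = Polynomial.C (separant f) := by
    rw [derivative_toUnivariate, ← separant_of_leader h, toUnivariate_of_notMem_vars]
    simp [mem_constants_iff_vars_eq_empty.mp hs]
  have hdeg : (toUnivariate u f).natDegree = 1 := by
    have hpred := Polynomial.natDegree_derivative (toUnivariate u f)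
    have hpos := degreeOf_leader_ne_zero h
    rw [hderiv, Polynomial.natDegree_C] at hpred
    rw [← natDegree_toUnivariate] at hpos
    omega
  have hcoeff := congrArg (Polynomial.coeff · 0) hderiv
  simp only [Polynomial.coeff_derivative, Polynomial.coeff_C_zero] at hcoeff
  rw [initial_of_leader h, Polynomial.leadingCoeff, hdeg, ← hcoeff]
  simp

lemma shift_notMem_vars {f : DPoly k n} {u : DVar n} (hrk : IsRanking n) (h : leader f = u) :
    u.shift 1 ∉ f.vars :=
  fun hmem => (le_of_leader h hmem).not_gt (hrk.lt_shift u)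

lemma shift_notMem_vars_separant {f : DPoly k n} {u : DVar n} (hrk : IsRanking n)
    (h : leader f = u) : u.shift 1 ∉ (separant f).vars :=
  fun hmem => shift_notMem_vars hrk h (vars_separant_subset f hmem)

end Leader

section Derivation

variable {k : Type*} [Field k] [Differential k] {n : ℕ}

lemma mem_vars_delta {f : DPoly k n} {v : DVar n} (hv : v ∈ (delta k n f).vars) :
    v ∈ f.vars ∨ ∃ w ∈ f.vars, v = w.shift 1 := by
  let W : Set (DVar n) := {v | v ∈ f.vars ∨ ∃ w ∈ f.vars, v = w.shift 1}
  have hle : supported k (f.vars : Set (DVar n)) ≤ supported k W :=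
    supported_mono fun w hw => Or.inl hw
  have hdelta : ∀ g ∈ supported k (f.vars : Set (DVar n)), delta k n g ∈ supported k W := by
    intro g hg
    rw [supported_eq_adjoin_X] at hg
    induction hg using Algebra.adjoin_induction with
    | mem x hx =>
      obtain ⟨w, hw, rfl⟩ := hx
      rw [delta_X]
      exact X_mem_supported.mpr (Or.inr ⟨w, hw, rfl⟩)
    | algebraMap r =>
      rw [MvPolynomial.algebraMap_eq, delta_C]
      exact Subalgebra.algebraMap_mem _ _
    | add x y _ _ hx' hy' =>
      rw [map_add]
      exact add_mem hx' hy'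
    | mul x y hx hy hx' hy' =>
      rw [supported_eq_adjoin_X] at hle
      rw [Derivation.leibniz, smul_eq_mul, smul_eq_mul]
      exact add_mem (mul_mem (hle hx) hy') (mul_mem (hle hy) hx')
  exact mem_supported.mp (hdelta f (mem_supported_vars f)) hv

lemma pderiv_shift_delta (u : DVar n) (f : DPoly k n) :
    pderiv (u.shift 1) (delta k n f) = delta k n (pderiv (u.shift 1) f) + pderiv u f := by
  induction f using MvPolynomial.induction_on with
  | C a => simp [delta_C]
  | add p q hp hq =>
    simp only [map_add, hp, hq]
    ring
  | mul_X p v hp =>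
    have hX : pderiv (u.shift 1) (X (v.shift 1) : DPoly k n) = pderiv u (X v) := by
      by_cases h : v = u
      · simp [h]
      · rw [pderiv_X_of_ne h, pderiv_X_of_ne ((DVar.shift_injective 1).ne h)]
    have hdelta : delta k n (pderiv (u.shift 1) (X v : DPoly k n)) = 0 := by
      by_cases h : v = u.shift 1
      · simp [h]
      · simp [pderiv_X_of_ne h]
    simp only [Derivation.leibniz, smul_eq_mul, map_add, hp, delta_X, hX, hdelta]
    ring

variable [LinearOrder (DVar n)] {f : DPoly k n} {u : DVar n}

lemma pderiv_delta_of_leader (hrk : IsRanking n) (h : leader f = u) :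
    pderiv (u.shift 1) (delta k n f) = separant f := by
  rw [pderiv_shift_delta, pderiv_eq_zero_of_notMem_vars (shift_notMem_vars hrk h), map_zero,
    zero_add, separant_of_leader h]

variable [CharZero k]

lemma degreeOf_delta (hrk : IsRanking n) (h : leader f = u) :
    degreeOf (u.shift 1) (delta k n f) = 1 := by
  have hpred := Polynomial.natDegree_derivative (toUnivariate (u.shift 1) (delta k n f))
  rw [derivative_toUnivariate, pderiv_delta_of_leader hrk h, natDegree_toUnivariate,
    natDegree_toUnivariate, notMem_vars_iff_degreeOf_eq_zero.mp
      (shift_notMem_vars_separant hrk h)] at hpred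
  have hne : degreeOf (u.shift 1) (delta k n f) ≠ 0 := fun h0 => by
    apply separant_ne_zero h
    rw [← pderiv_delta_of_leader hrk h, pderiv_eq_zero_of_notMem_vars]
    exact notMem_vars_iff_degreeOf_eq_zero.mpr h0
  omega

lemma leader_delta (hrk : IsRanking n) (h : leader f = u) :
    leader (delta k n f) = (u.shift 1 : DVar n) := by
  rw [leader_eq_coe_iff, mem_vars_iff_degreeOf_ne_zero, degreeOf_delta hrk h]
  refine ⟨one_ne_zero, fun v hv => ?_⟩
  rcases mem_vars_delta hv with hv | ⟨w, hw, rfl⟩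
  · exact (le_of_leader h hv).trans (hrk.lt_shift u).le
  · exact hrk.shift_le_shift 1 u w (le_of_leader h hw)

lemma separant_delta (hrk : IsRanking n) (h : leader f = u) :
    separant (delta k n f) = separant f := by
  rw [separant_of_leader (leader_delta hrk h), pderiv_delta_of_leader hrk h]

lemma initial_delta (hrk : IsRanking n) (h : leader f = u) :
    initial (delta k n f) = separant f := by
  have hcoeff := congrArg (Polynomial.coeff · 0)
    (derivative_toUnivariate (u.shift 1) (delta k n f))
  rw [pderiv_delta_of_leader hrk h, toUnivariate_of_notMem_vars (shift_notMem_vars_separant hrk h)]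
    at hcoeff
  simp only [Polynomial.coeff_derivative, Polynomial.coeff_C_zero] at hcoeff
  rw [initial_of_leader (leader_delta hrk h), Polynomial.leadingCoeff, natDegree_toUnivariate,
    degreeOf_delta hrk h, ← hcoeff]
  simp

end Derivation

/-! ## Pseudo-division -/

section RegularMod

variable {R : Type*} [CommRing R]

/-- The elements whose class in `R ⧸ Q` is not a zero divisor, i.e. those that can be cancelled in
congruences modulo `Q`. -/
def regularMod (Q : Ideal R) : Submonoid R := (nonZeroDivisors (R ⧸ Q)).comap (Ideal.Quotient.mk Q)

variable {Q : Ideal R}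

lemma mem_regularMod_iff {a : R} : a ∈ regularMod Q ↔ ∀ x, a * x ∈ Q → x ∈ Q := by
  rw [regularMod, Submonoid.mem_comap, mem_nonZeroDivisors_iff_left,
    Ideal.Quotient.mk_surjective.forall]
  simp only [← map_mul, Ideal.Quotient.eq_zero_iff_mem]

lemma mem_regularMod_congr {a b : R} (h : a - b ∈ Q) : a ∈ regularMod Q ↔ b ∈ regularMod Q := by
  rw [regularMod, Submonoid.mem_comap, Submonoid.mem_comap, Ideal.Quotient.eq.mpr h]

lemma mem_regularMod_of_mul {a b : R} (h : a * b ∈ regularMod Q) : b ∈ regularMod Q := by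
  rw [mem_regularMod_iff] at h ⊢
  exact fun x hx => h x (by rw [mul_assoc]; exact Q.mul_mem_left _ hx)

lemma mem_iff_of_mul_sub_mem {P a b : R} (hP : P ∈ regularMod Q) (h : P * a - b ∈ Q) :
    a ∈ Q ↔ b ∈ Q := by
  have hmul : P * a ∈ Q ↔ b ∈ Q := by
    rw [← sub_add_cancel (P * a) b]
    exact Q.add_mem_iff_right h
  exact ⟨fun ha => hmul.mp (Q.mul_mem_left _ ha),
    fun hb => mem_regularMod_iff.mp hP a (hmul.mpr hb)⟩

lemma mem_regularMod_iff_of_mul_sub_mem {P a b : R} (hP : P ∈ regularMod Q)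
    (h : P * a - b ∈ Q) : a ∈ regularMod Q ↔ b ∈ regularMod Q :=
  ⟨fun ha => (mem_regularMod_congr h).mp (mul_mem hP ha),
    fun hb => mem_regularMod_of_mul ((mem_regularMod_congr h).mpr hb)⟩

lemma mul_sub_mem_trans {P P' a b c : R} (h : P * a - b ∈ Q) (h' : P' * b - c ∈ Q) :
    P' * P * a - c ∈ Q := by
  have hsplit : P' * P * a - c = P' * (P * a - b) + (P' * b - c) := by ring
  rw [hsplit]
  exact Q.add_mem (Q.mul_mem_left _ h) h'

end RegularMod

section PseudoDivision

lemma exists_pseudoDiv {R : Type*} [CommRing R] {a : Polynomial R} (ha : a.natDegree ≠ 0)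
    (f : Polynomial R) : ∃ (e : ℕ) (q r : Polynomial R),
      Polynomial.C a.leadingCoeff ^ e * f = q * a + r ∧ r.natDegree < a.natDegree := by
  induction hN : f.natDegree using Nat.strong_induction_on generalizing f with
  | _ N ih =>
    rcases lt_or_ge f.natDegree a.natDegree with hlt | hle
    · exact ⟨0, 0, f, by simp, hlt⟩
    · obtain ⟨e, q, r, heq, hr⟩ := ih _
        ((Polynomial.natDegree_cancelLeads_lt_of_natDegree_le_natDegree hle
          (by omega)).trans_eq hN) _ rfl
      refine ⟨e + 1, q + Polynomial.C a.leadingCoeff ^ e * (Polynomial.C f.leadingCoeff *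
        Polynomial.X ^ (f.natDegree - a.natDegree)), r, ?_, hr⟩
      rw [Polynomial.cancelLeads, Nat.sub_eq_zero_of_le hle] at heq
      linear_combination heq

section MvPolynomial

variable {σ R : Type*} [CommRing R]

lemma mul_sub_mem_of_coeff {Q : Ideal (MvPolynomial σ R)} {P f r : MvPolynomial σ R} {u : σ}
    (h : ∀ d, P * (toUnivariate u f).coeff d - (toUnivariate u r).coeff d ∈ Q) :
    P * f - r ∈ Q := by
  have heval : P * f - r =
      (Polynomial.C P * toUnivariate u f - toUnivariate u r).eval (X u) := by
    simp [eval_toUnivariate]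
  rw [heval, Polynomial.eval_eq_sum]
  refine Q.sum_mem fun d _ => Q.mul_mem_right _ ?_
  rw [Polynomial.coeff_sub, Polynomial.coeff_C_mul]
  exact h d

lemma mul_pderiv_sub_mem_of_coeff {Q : Ideal (MvPolynomial σ R)} {P f r : MvPolynomial σ R}
    {u : σ} (h : ∀ d, P * (toUnivariate u f).coeff d - (toUnivariate u r).coeff d ∈ Q) :
    P * pderiv u f - pderiv u r ∈ Q := by
  refine mul_sub_mem_of_coeff (u := u) fun d => ?_
  rw [← derivative_toUnivariate, ← derivative_toUnivariate, Polynomial.coeff_derivative,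
    Polynomial.coeff_derivative, ← mul_assoc, ← sub_mul]
  exact Q.mul_mem_right _ (h (d + 1))

lemma degreeOf_le_of_mul_eq_mul_add [IsDomain R] {f g h q r : MvPolynomial σ R} {u v : σ}
    (heq : h * f = q * g + r) (hr : degreeOf u r < degreeOf u g) (hvh : v ∉ h.vars)
    (hvg : v ∉ g.vars) : degreeOf v r ≤ degreeOf v f := by
  rw [← natDegree_toUnivariate, ← natDegree_toUnivariate, Polynomial.natDegree_le_iff_coeff_eq_zero]
  intro N hN
  have hcoeff := congrArg (fun p => (toUnivariate v p).coeff N) heq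
  simp only [map_mul, map_add, toUnivariate_of_notMem_vars hvh, toUnivariate_of_notMem_vars hvg,
    Polynomial.coeff_C_mul, Polynomial.coeff_add, Polynomial.coeff_mul_C,
    Polynomial.coeff_eq_zero_of_natDegree_lt hN, mul_zero] at hcoeff
  by_cases hq : (toUnivariate v q).coeff N = 0
  · rw [hq, zero_mul, zero_add] at hcoeff
    exact hcoeff.symm
  · have hg : g ≠ 0 := by
      rintro rfl
      simp at hr
    have hle := degreeOf_coeff_toUnivariate_le v u N r
    rw [eq_neg_of_add_eq_zero_right hcoeff.symm, ← neg_mul, degreeOf_mul_eq (neg_ne_zero.mpr hq) hg]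
      at hle
    omega

end MvPolynomial

variable {k : Type*} [Field k] {n : ℕ} [LinearOrder (DVar n)]

lemma exists_pseudoRem {g : DPoly k n} {u : DVar n} (hu : leader g = u) (f : DPoly k n) :
    ∃ (e : ℕ) (q r : DPoly k n), initial g ^ e * f = q * g + r ∧
      degreeOf u r < degreeOf u g := by
  have hpos := degreeOf_leader_ne_zero hu
  induction hN : degreeOf u f using Nat.strong_induction_on generalizing f with
  | _ N ih =>
    rcases lt_or_ge (degreeOf u f) (degreeOf u g) with hlt | hle
    · exact ⟨0, 0, f, by simp, hlt⟩
    · set c := (toUnivariate u f).leadingCoeff with hc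
      set d := degreeOf u f - degreeOf u g with hd
      have hcancel : toUnivariate u (initial g * f - c * X u ^ d * g) =
          (toUnivariate u g).cancelLeads (toUnivariate u f) := by
        simp only [Polynomial.cancelLeads, natDegree_toUnivariate, Nat.sub_eq_zero_of_le hle,
          pow_zero, mul_one, map_sub, map_mul, map_pow, toUnivariate_X_self,
          toUnivariate_of_notMem_vars (notMem_vars_coeff_toUnivariate u _ f), hc, hd,
          toUnivariate_of_notMem_vars (notMem_vars_coeff_toUnivariate u _ g),
          Polynomial.leadingCoeff, initial_of_leader hu]
      have hdeg : degreeOf u (initial g * f - c * X u ^ d * g) < N := by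
        rw [← natDegree_toUnivariate, hcancel, ← hN, ← natDegree_toUnivariate]
        apply Polynomial.natDegree_cancelLeads_lt_of_natDegree_le_natDegree <;>
          rw [natDegree_toUnivariate]
        · rwa [natDegree_toUnivariate]
        · omega
      obtain ⟨e, q, r, heq, hr⟩ := ih _ hdeg _ rfl
      exact ⟨e + 1, q + initial g ^ e * (c * X u ^ d), r, by linear_combination heq, hr⟩

lemma degreeOf_pseudoRem_le {f g q r : DPoly k n} {u v : DVar n} {e : ℕ}
    (hr : degreeOf u r < degreeOf u g) (heq : initial g ^ e * f = q * g + r) (hv : v ∉ g.vars) :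
    degreeOf v r ≤ degreeOf v f :=
  degreeOf_le_of_mul_eq_mul_add heq hr
    (fun h => hv (vars_initial_subset g (vars_pow _ _ h))) hv

lemma PseudoStep.mem_vars {B : Finset (DPoly k n)} {f r : DPoly k n} (h : PseudoStep B f r)
    {v : DVar n} (hv : v ∈ r.vars) : v ∈ f.vars ∨ ∃ g ∈ B, v ∈ g.vars := by
  obtain ⟨g, hg, u, -, -, hdr, e, q, heq⟩ := h
  refine or_iff_not_imp_right.mpr fun hvB => ?_
  have hle := degreeOf_pseudoRem_le hdr heq fun hvg => hvB ⟨g, hg, hvg⟩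
  rw [mem_vars_iff_degreeOf_ne_zero] at hv ⊢
  omega

/-- The degrees in the leaders of `B`, listed from the highest leader downwards, decrease
lexicographically: a division by `g` can raise only the degrees in variables of `g`. -/
theorem wellFounded_pseudoStep (B : Finset (DPoly k n)) :
    WellFounded fun r f : DPoly k n => PseudoStep B f r := by
  let L : Set (DVar n) := {u | ∃ g ∈ B, leader g = u}
  have : Finite L := by
    refine Set.Finite.subset (B.finite_toSet.biUnion fun g _ => g.vars.finite_toSet) ?_
    exact fun u ⟨g, hg, hu⟩ => Set.mem_biUnion hg (mem_vars_of_leader hu)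
  have hwf : WellFounded (Pi.Lex (fun a b : L => b < a) fun {_} (a b : ℕ) => a < b) :=
    Pi.Lex.wellFounded (r := fun a b : L => b < a) (s := fun _ (a b : ℕ) => a < b)
      fun _ => wellFounded_lt
  refine Subrelation.wf ?_ (InvImage.wf (fun (f : DPoly k n) (u : L) => degreeOf u.1 f) hwf)
  rintro r f ⟨g, hg, u, hu, hdf, hdr, e, q, heq⟩
  let changed : Set L := {v | degreeOf v.1 r ≠ degreeOf v.1 f}
  have hu_changed : (⟨u, g, hg, hu⟩ : L) ∈ changed := (hdr.trans_le hdf).ne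
  obtain ⟨w, hw⟩ := changed.toFinite.exists_maximal ⟨_, hu_changed⟩
  have hdecr : degreeOf w.1 r < degreeOf w.1 f := by
    rcases eq_or_ne u w.1 with h | h
    · exact h ▸ hdr.trans_le hdf
    · have huw : u < w.1 := lt_of_le_of_ne
        (not_lt.mp fun hlt => hlt.not_ge (hw.le_of_ge hu_changed hlt.le)) h
      exact lt_of_le_of_ne (degreeOf_pseudoRem_le hdr heq
        fun hwg => huw.not_ge (le_of_leader hu hwg)) hw.prop
  refine ⟨w, fun v hwv => ?_, hdecr⟩
  by_contra hv_changed
  exact hwv.not_ge (hw.le_of_ge (y := v) hv_changed hwv.le)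

lemma exists_algRem (B : Finset (DPoly k n)) (f : DPoly k n) : ∃ r, AlgRem B f r := by
  induction f using (wellFounded_pseudoStep B).induction with
  | _ f ih =>
    by_cases hred : ∀ g ∈ B, AlgReduced f g
    · exact ⟨f, .refl, hred⟩
    · simp only [AlgReduced, not_forall, not_lt] at hred
      obtain ⟨g, hg, u, hu, hle⟩ := hred
      obtain ⟨e, q, r, heq, hlt⟩ := exists_pseudoRem hu f
      have hstep : PseudoStep B f r := ⟨g, hg, u, hu, hle, hlt, e, q, heq⟩
      obtain ⟨r', hr', hred'⟩ := ih r hstep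
      exact ⟨r', .head hstep hr', hred'⟩

lemma exists_algRemSet (B G : Finset (DPoly k n)) : ∃ R, AlgRemSet B G R :=
  ⟨_, fun g => (exists_algRem B g).choose, fun g _ => (exists_algRem B g).choose_spec, rfl⟩

variable {B : Finset (DPoly k n)} {f r : DPoly k n}

lemma AlgRem.mem_vars (h : AlgRem B f r) {v : DVar n} (hv : v ∈ r.vars) :
    v ∈ f.vars ∨ ∃ g ∈ B, v ∈ g.vars := by
  obtain ⟨hsteps, -⟩ := h
  induction hsteps with
  | refl => exact Or.inl hv
  | tail _ hstep ih => exact (hstep.mem_vars hv).elim ih Or.inr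

lemma AlgRem.degreeOf_le (h : AlgRem B f r) {v : DVar n} (hv : ∀ g ∈ B, v ∉ g.vars) :
    degreeOf v r ≤ degreeOf v f := by
  obtain ⟨hsteps, -⟩ := h
  induction hsteps with
  | refl => exact le_rfl
  | tail _ hstep ih =>
    obtain ⟨g, hg, u, -, -, hdr, e, q, heq⟩ := hstep
    exact (degreeOf_pseudoRem_le hdr heq (hv g hg)).trans ih

lemma AlgRem.exists_mul_sub_mem {Q : Ideal (DPoly k n)} (h : AlgRem B f r)
    (hB : ∀ g ∈ B, g ∈ Q ∧ initial g ∈ regularMod Q) :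
    ∃ P ∈ regularMod Q, P * f - r ∈ Q := by
  obtain ⟨hsteps, -⟩ := h
  induction hsteps with
  | refl => exact ⟨1, one_mem _, by simp⟩
  | tail _ hstep ih =>
    obtain ⟨P, hP, hPf⟩ := ih
    obtain ⟨g, hg, u, -, -, -, e, q, heq⟩ := hstep
    refine ⟨initial g ^ e * P, mul_mem (pow_mem (hB g hg).2 e) hP, mul_sub_mem_trans hPf ?_⟩
    rw [heq, add_sub_cancel_right]
    exact Q.mul_mem_left _ (hB g hg).1

lemma AlgRem.exists_mul_coeff_sub_mem {Q : Ideal (DPoly k n)} {u : DVar n} (h : AlgRem B f r)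
    (hB : ∀ g ∈ B, g ∈ Q ∧ initial g ∈ regularMod Q) (hu : ∀ g ∈ B, u ∉ g.vars) :
    ∃ P ∈ regularMod Q,
      ∀ d, P * (toUnivariate u f).coeff d - (toUnivariate u r).coeff d ∈ Q := by
  obtain ⟨hsteps, -⟩ := h
  induction hsteps with
  | refl => exact ⟨1, one_mem _, by simp⟩
  | tail _ hstep ih =>
    obtain ⟨P, hP, hPf⟩ := ih
    obtain ⟨g, hg, w, -, -, -, e, q, heq⟩ := hstep
    refine ⟨initial g ^ e * P, mul_mem (pow_mem (hB g hg).2 e) hP,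
      fun d => mul_sub_mem_trans (hPf d) ?_⟩
    have hinit : u ∉ (initial g ^ e).vars := fun h =>
      hu g hg (vars_initial_subset g (vars_pow _ _ h))
    have hcoeff := congrArg (fun p => (toUnivariate u p).coeff d) heq
    simp only [map_mul, map_add, toUnivariate_of_notMem_vars hinit,
      toUnivariate_of_notMem_vars (hu g hg), Polynomial.coeff_C_mul, Polynomial.coeff_add,
      Polynomial.coeff_mul_C] at hcoeff
    rw [hcoeff, add_sub_cancel_right]
    exact Q.mul_mem_left _ (hB g hg).1

lemma AlgRem.filter_leader_lt {u : DVar n} (h : AlgRem B f r) (hf : ∀ v ∈ f.vars, v ≤ u)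
    (hne : ∀ g ∈ B, leader g ≠ u) : AlgRem (B.filter fun g => leader g < u) f r := by
  obtain ⟨hsteps, hred⟩ := h
  refine ⟨?_, fun g hg => hred g (Finset.mem_filter.mp hg).1⟩
  suffices hle : Relation.ReflTransGen (PseudoStep (B.filter fun g => leader g < u)) f r ∧
      ∀ v ∈ r.vars, v ≤ u from hle.1
  clear hred
  induction hsteps with
  | refl => exact ⟨.refl, hf⟩
  | @tail b c _ hstep ih =>
    obtain ⟨hb, hbu⟩ := ih
    obtain ⟨g, hg, w, hw, hdb, hdc, hdiv⟩ := hstep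
    have hwb : w ∈ b.vars := mem_vars_iff_degreeOf_ne_zero.mpr (by omega)
    have hgu : leader g < u := by
      rw [hw, WithBot.coe_lt_coe]
      exact lt_of_le_of_ne (hbu w hwb) fun h => hne g hg (h ▸ hw)
    have hstep' : PseudoStep (B.filter fun g => leader g < u) b c :=
      ⟨g, Finset.mem_filter.mpr ⟨hg, hgu⟩, w, hw, hdb, hdc, hdiv⟩
    refine ⟨hb.tail hstep', fun v hv => (hstep'.mem_vars hv).elim (hbu v) ?_⟩
    rintro ⟨g', hg', hvg'⟩
    exact WithBot.coe_le_coe.mp ((Finset.le_max hvg').trans (Finset.mem_filter.mp hg').2.le)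

end PseudoDivision

/-! ## Saturations and differential ideals -/

section Radicality

open scoped Polynomial
open UniqueFactorizationMonoid (radical exists_dvd_pow_iff_radical_dvd)

lemma dvd_derivative_sq_mul {K : Type*} [Field K] {a f : K[X]} (ha : a ≠ 0) {M : ℕ}
    (h : a ∣ a.derivative ^ M * f ^ 2) : a ∣ a.derivative ^ 2 * f := by
  classical
  have hradical : radical a ∣ a.derivative * f := by
    rw [← exists_dvd_pow_iff_radical_dvd ha]
    refine ⟨M + 2, h.trans ?_⟩
    rw [mul_pow]
    exact mul_dvd_mul (pow_dvd_pow _ (by omega)) (pow_dvd_pow _ (by omega))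
  calc a = radical a * EuclideanDomain.divRadical a := EuclideanDomain.radical_mul_divRadical.symm
    _ ∣ a.derivative * f * a.derivative := mul_dvd_mul hradical (divRadical_dvd_derivative a)
    _ = a.derivative ^ 2 * f := by ring

variable {R : Type*} [CommRing R] {I : Ideal R}

lemma map_dvd_map_of_mem_map_C_sup_span {S : Type*} [CommRing S] {φ : R →+* S}
    (hφ : I ≤ RingHom.ker φ) {a p : R[X]} (hp : p ∈ I.map Polynomial.C ⊔ Ideal.span {a}) :
    a.map φ ∣ p.map φ := by
  have hle : I.map Polynomial.C ⊔ Ideal.span {a} ≤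
      (Ideal.span {a.map φ}).comap (Polynomial.mapRingHom φ) := by
    refine sup_le (Ideal.map_le_iff_le_comap.mpr fun x hx => ?_)
      ((Ideal.span_singleton_le_iff_mem _).mpr (Ideal.mem_span_singleton_self _))
    rw [Ideal.mem_comap, Ideal.mem_comap, Polynomial.coe_mapRingHom, Polynomial.map_C, hφ hx,
      Polynomial.C_0]
    exact zero_mem _
  exact Ideal.mem_span_singleton.mp (hle hp)

lemma dvd_map_derivative_sq_mul {K : Type*} [Field K] {φ : R →+* K} (hφ : I ≤ RingHom.ker φ)
    {a f : R[X]} (hlead : φ a.leadingCoeff ≠ 0) {N M : ℕ}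
    (h : Polynomial.C a.leadingCoeff ^ N * a.derivative ^ M * f ^ 2 ∈
      I.map Polynomial.C ⊔ Ideal.span {a}) :
    a.map φ ∣ (a.derivative ^ 2 * f).map φ := by
  have ha : a.map φ ≠ 0 := fun h0 => hlead (by
    rw [← Polynomial.coeff_natDegree, ← Polynomial.coeff_map, h0, Polynomial.coeff_zero])
  have hunit : IsUnit (Polynomial.C (φ a.leadingCoeff) ^ N) :=
    (Polynomial.isUnit_C.mpr (isUnit_iff_ne_zero.mpr hlead)).pow N
  have hdvd := map_dvd_map_of_mem_map_C_sup_span hφ h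
  simp only [Polynomial.map_mul, Polynomial.map_pow, Polynomial.map_C,
    ← Polynomial.derivative_map, mul_assoc, hunit.dvd_mul_left] at hdvd ⊢
  exact dvd_derivative_sq_mul ha hdvd

/-- Modulo a prime ideal that contains `I` but not the leading coefficient of `a`, the
pseudo-remainder of `(a')² f` by `a` is a multiple of `a` in the polynomial ring over the residue
field, so it vanishes there; hence its multiple by the leading coefficient vanishes modulo `I`. -/
lemma exists_leadingCoeff_pow_mul_derivative_sq_mul_mem (hI : I.IsRadical) {a f : R[X]}
    (ha : a.natDegree ≠ 0) {N M : ℕ}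
    (h : Polynomial.C a.leadingCoeff ^ N * a.derivative ^ M * f ^ 2 ∈
      I.map Polynomial.C ⊔ Ideal.span {a}) :
    ∃ e, Polynomial.C a.leadingCoeff ^ e * a.derivative ^ 2 * f ∈
      I.map Polynomial.C ⊔ Ideal.span {a} := by
  obtain ⟨e, q, r, hdiv, hr⟩ := exists_pseudoDiv ha (a.derivative ^ 2 * f)
  have hmap : ∀ P : Ideal R, I ≤ P → ∀ [P.IsPrime], a.leadingCoeff ∉ P →
      r.map (algebraMap R P.ResidueField) = 0 := by
    intro P hIP _ hlead
    set φ := algebraMap R P.ResidueField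
    have hker : RingHom.ker φ = P := P.ker_algebraMap_residueField
    have hlead' : φ a.leadingCoeff ≠ 0 := by rwa [← hker, RingHom.mem_ker] at hlead
    have hdvd : a.map φ ∣ r.map φ := by
      have hmul := (dvd_map_derivative_sq_mul (hIP.trans_eq hker.symm) hlead' h).mul_left
        ((Polynomial.C a.leadingCoeff ^ e).map φ)
      rwa [← Polynomial.map_mul, hdiv, Polynomial.map_add, Polynomial.map_mul,
        dvd_add_right (dvd_mul_left _ _)] at hmul
    refine Polynomial.eq_zero_of_dvd_of_natDegree_lt hdvd ?_
    rw [Polynomial.natDegree_map_of_leadingCoeff_ne_zero φ hlead']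
    exact Polynomial.natDegree_map_le.trans_lt hr
  have hmem : Polynomial.C a.leadingCoeff * r ∈ I.map Polynomial.C := by
    refine Ideal.mem_map_C_iff.mpr fun j => hI ?_
    rw [Polynomial.coeff_C_mul, Ideal.radical_eq_sInf, Ideal.mem_sInf]
    rintro P ⟨hIP, hprime⟩
    by_cases hlead : a.leadingCoeff ∈ P
    · exact P.mul_mem_right _ hlead
    · apply P.mul_mem_left
      rw [← P.algebraMap_residueField_eq_zero, ← Polynomial.coeff_map, hmap P hIP hlead,
        Polynomial.coeff_zero]
  refine ⟨e + 1, ?_⟩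
  have hsplit : Polynomial.C a.leadingCoeff ^ (e + 1) * a.derivative ^ 2 * f =
      Polynomial.C a.leadingCoeff * r + Polynomial.C a.leadingCoeff * q * a := by
    linear_combination Polynomial.C a.leadingCoeff * hdiv
  rw [hsplit]
  exact Submodule.add_mem_sup hmem (Ideal.mul_mem_left _ _ (Ideal.mem_span_singleton_self a))

end Radicality

section Ideals

variable {R : Type*} [CommRing R] {I : Ideal R}

lemma isRadical_iff_sq : I.IsRadical ↔ ∀ x, x ^ 2 ∈ I → x ∈ I :=
  Ideal.isRadical_iff_pow_one_lt 2 one_lt_two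

lemma isRadical_colon (hI : I.IsRadical) (S : Set R) : (Submodule.colon I S).IsRadical := by
  rw [isRadical_iff_sq] at hI ⊢
  intro x hx
  rw [Submodule.mem_colon] at hx ⊢
  refine fun s hs => hI _ ?_
  have hsq : (x • s) ^ 2 = s * (x ^ 2 • s) := by rw [smul_eq_mul, smul_eq_mul]; ring
  rw [hsq]
  exact I.mul_mem_left _ (hx s hs)

lemma regularMod_le_regularMod_colon (I : Ideal R) (S : Set R) :
    regularMod I ≤ regularMod (Submodule.colon I S) := by
  intro a ha
  refine mem_regularMod_iff.mpr fun x hx => ?_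
  rw [Submodule.mem_colon] at hx ⊢
  exact fun s hs =>
    mem_regularMod_iff.mp ha _ (by simpa only [smul_eq_mul, mul_assoc] using hx s hs)

end Ideals

section Saturation

variable {k : Type*} [Field k] {n : ℕ} {I J : Ideal (DPoly k n)} {S T : Set (DPoly k n)}

lemma le_saturation (I : Ideal (DPoly k n)) (S : Set (DPoly k n)) : I ≤ saturation I S :=
  fun x hx => ⟨1, one_mem _, by rwa [one_mul]⟩

lemma subset_regularMod_saturation (I : Ideal (DPoly k n)) (S : Set (DPoly k n)) :
    S ⊆ regularMod (saturation I S) := by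
  refine fun a ha => mem_regularMod_iff.mpr ?_
  rintro x ⟨s, hs, hx⟩
  exact ⟨s * a, mul_mem hs (Submonoid.subset_closure ha), by rwa [mul_assoc]⟩

lemma regularMod_le_regularMod_saturation (I : Ideal (DPoly k n)) (S : Set (DPoly k n)) :
    regularMod I ≤ regularMod (saturation I S) := by
  refine fun a ha => mem_regularMod_iff.mpr ?_
  rintro x ⟨s, hs, hx⟩
  exact ⟨s, hs, mem_regularMod_iff.mp ha _ (by rwa [mul_left_comm])⟩

lemma saturation_le (hIJ : I ≤ J) (hS : S ⊆ regularMod J) : saturation I S ≤ J := by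
  rintro x ⟨s, hs, hx⟩
  exact mem_regularMod_iff.mp (Submonoid.closure_le.mpr hS hs) x (hIJ hx)

lemma saturation_mono (hIJ : I ≤ J) (hST : S ⊆ T) : saturation I S ≤ saturation J T := by
  rintro x ⟨s, hs, hx⟩
  exact ⟨s, Submonoid.closure_mono hST hs, hIJ hx⟩

lemma isRadical_saturation (hI : I.IsRadical) (S : Set (DPoly k n)) :
    (saturation I S).IsRadical := by
  rw [isRadical_iff_sq] at hI ⊢
  rintro x ⟨s, hs, hx⟩
  refine ⟨s, hs, hI _ ?_⟩
  have hsq : (s * x) ^ 2 = s * (s * x ^ 2) := by ring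
  rw [hsq]
  exact I.mul_mem_left _ hx

end Saturation

section DiffIdeal

variable {k : Type*} [Field k] [Differential k] {n : ℕ} {I J : Ideal (DPoly k n)}
  {F H : Set (DPoly k n)}

lemma isDiffIdeal_saturation (hI : IsDiffIdeal I) (S : Set (DPoly k n)) :
    IsDiffIdeal (saturation I S) := by
  rintro x ⟨s, hs, hx⟩
  refine ⟨s * s, mul_mem hs hs, ?_⟩
  have hdelta := hI _ hx
  rw [Derivation.leibniz, smul_eq_mul, smul_eq_mul] at hdelta
  have hsplit : s * s * delta k n x =
      s * (s * delta k n x + x * delta k n s) - delta k n s * (s * x) := by ring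
  rw [hsplit]
  exact I.sub_mem (I.mul_mem_left _ hdelta) (I.mul_mem_left _ hx)

lemma isDiffIdeal_colon (hI : IsDiffIdeal I) (hrad : I.IsRadical) (S : Set (DPoly k n)) :
    IsDiffIdeal (Submodule.colon I S) := by
  intro y hy
  rw [Submodule.mem_colon] at hy ⊢
  refine fun s hs => isRadical_iff_sq.mp hrad _ ?_
  have hdelta := hI _ (hy s hs)
  simp only [smul_eq_mul, Derivation.leibniz] at hdelta ⊢
  have hsplit : (delta k n y * s) ^ 2 = s * delta k n y * (y * delta k n s + s * delta k n y) -
      delta k n y * delta k n s * (y * s) := by ring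
  rw [hsplit]
  exact I.sub_mem (I.mul_mem_left _ hdelta) (I.mul_mem_left _ (hy s hs))

lemma iterate_delta_mem (hI : IsDiffIdeal I) {a : DPoly k n} (ha : a ∈ I) (j : ℕ) :
    (delta k n)^[j] a ∈ I := by
  induction j with
  | zero => exact ha
  | succ j ih => rw [Function.iterate_succ_apply']; exact hI _ ih

lemma subset_diffIdeal (F : Set (DPoly k n)) : F ⊆ diffIdeal F := fun _ hx =>
  Ideal.mem_sInf.mpr fun _ hI => hI.1 hx

lemma isDiffIdeal_diffIdeal (F : Set (DPoly k n)) : IsDiffIdeal (diffIdeal F) := fun _ hx =>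
  Ideal.mem_sInf.mpr fun _ hI => hI.2 _ (Ideal.mem_sInf.mp hx hI)

lemma diffIdeal_le (hF : F ⊆ I) (hI : IsDiffIdeal I) : diffIdeal F ≤ I := sInf_le ⟨hF, hI⟩

lemma diffIdeal_le_span_iterate_delta (F : Set (DPoly k n)) :
    diffIdeal F ≤ Ideal.span {g | ∃ a ∈ F, ∃ j : ℕ, g = (delta k n)^[j] a} := by
  refine diffIdeal_le (fun a ha => Ideal.subset_span ⟨a, ha, 0, rfl⟩) fun x hx => ?_
  induction hx using Submodule.span_induction with
  | mem x hx =>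
    obtain ⟨a, ha, j, rfl⟩ := hx
    rw [← Function.iterate_succ_apply' (delta k n)]
    exact Ideal.subset_span ⟨a, ha, j + 1, rfl⟩
  | zero => rw [map_zero]; exact zero_mem _
  | add x y _ _ hx hy => rw [map_add]; exact add_mem hx hy
  | smul c x hx hdelta =>
    rw [smul_eq_mul, Derivation.leibniz]
    exact add_mem (Ideal.mul_mem_left _ _ hdelta) (Ideal.mul_mem_right _ _ hx)

lemma subset_radDiffIdeal (F : Set (DPoly k n)) : F ⊆ radDiffIdeal F := fun _ hx =>
  Ideal.mem_sInf.mpr fun _ hI => hI.1 hx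

lemma isDiffIdeal_radDiffIdeal (F : Set (DPoly k n)) : IsDiffIdeal (radDiffIdeal F) :=
  fun _ hx => Ideal.mem_sInf.mpr fun _ hI => hI.2.1 _ (Ideal.mem_sInf.mp hx hI)

lemma isRadical_radDiffIdeal (F : Set (DPoly k n)) : (radDiffIdeal F).IsRadical :=
  isRadical_iff_sq.mpr fun _ hx => Ideal.mem_sInf.mpr fun _ hI =>
    isRadical_iff_sq.mp hI.2.2 _ (Ideal.mem_sInf.mp hx hI)

lemma radDiffIdeal_le (hF : F ⊆ I) (hI : IsDiffIdeal I) (hrad : I.IsRadical) :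
    radDiffIdeal F ≤ I := sInf_le ⟨hF, hI, hrad⟩

lemma radDiffIdeal_mono {G : Set (DPoly k n)} (h : F ⊆ G) : radDiffIdeal F ≤ radDiffIdeal G :=
  radDiffIdeal_le (h.trans (subset_radDiffIdeal G)) (isDiffIdeal_radDiffIdeal G)
    (isRadical_radDiffIdeal G)

lemma diffIdeal_le_radDiffIdeal (F : Set (DPoly k n)) : diffIdeal F ≤ radDiffIdeal F :=
  diffIdeal_le (subset_radDiffIdeal F) (isDiffIdeal_radDiffIdeal F)

/-- `{F} : H^∞`, the radical differential ideal of the system `F = 0`, `H ≠ 0`. -/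
def sysIdeal (F H : Set (DPoly k n)) : Ideal (DPoly k n) := saturation (radDiffIdeal F) H

lemma subset_sysIdeal (F H : Set (DPoly k n)) : F ⊆ sysIdeal F H :=
  (subset_radDiffIdeal F).trans (le_saturation _ _)

lemma isDiffIdeal_sysIdeal (F H : Set (DPoly k n)) : IsDiffIdeal (sysIdeal F H) :=
  isDiffIdeal_saturation (isDiffIdeal_radDiffIdeal F) H

lemma isRadical_sysIdeal (F H : Set (DPoly k n)) : (sysIdeal F H).IsRadical :=
  isRadical_saturation (isRadical_radDiffIdeal F) H

lemma subset_regularMod_sysIdeal (F H : Set (DPoly k n)) : H ⊆ regularMod (sysIdeal F H) :=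
  subset_regularMod_saturation _ H

lemma sysIdeal_le (hF : F ⊆ J) (hJ : IsDiffIdeal J) (hrad : J.IsRadical)
    (hH : H ⊆ regularMod J) : sysIdeal F H ≤ J :=
  saturation_le (radDiffIdeal_le hF hJ hrad) hH

lemma sysIdeal_mono {F' H' : Set (DPoly k n)} (hF : F ⊆ F') (hH : H ⊆ H') :
    sysIdeal F H ≤ sysIdeal F' H' := saturation_mono (radDiffIdeal_mono hF) hH

lemma sysIdeal_insert_right_le (F H : Set (DPoly k n)) (s : DPoly k n) :
    sysIdeal F (insert s H) ≤ Submodule.colon (sysIdeal F H) {s} := by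
  have hrad := isRadical_sysIdeal F H
  have hle : sysIdeal F (insert s H) ≤ saturation (sysIdeal F H) {s} :=
    sysIdeal_le ((subset_sysIdeal F H).trans (le_saturation _ _))
      (isDiffIdeal_saturation (isDiffIdeal_sysIdeal F H) _) (isRadical_saturation hrad _)
      (Set.insert_subset (subset_regularMod_saturation _ _ rfl)
        ((subset_regularMod_sysIdeal F H).trans (regularMod_le_regularMod_saturation _ _)))
  intro x hx
  obtain ⟨t, ht, htx⟩ := hle hx
  obtain ⟨j, rfl⟩ := Submonoid.mem_closure_singleton.mp ht
  refine Submodule.mem_colon_singleton.mpr (hrad ⟨j + 1, ?_⟩)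
  have hpow : (x • s) ^ (j + 1) = x ^ j * s * (s ^ j * x) := by rw [smul_eq_mul]; ring
  rw [hpow]
  exact Ideal.mul_mem_left _ _ htx

lemma sysIdeal_insert_left_le {F H : Set (DPoly k n)} {s x : DPoly k n}
    (h : s * x ∈ sysIdeal F H) :
    sysIdeal (insert s F) H ≤ Submodule.colon (sysIdeal F H) {x} := by
  refine sysIdeal_le (Set.insert_subset (Submodule.mem_colon_singleton.mpr h)
      ((subset_sysIdeal F H).trans Ideal.le_colon))
    (isDiffIdeal_colon (isDiffIdeal_sysIdeal F H) (isRadical_sysIdeal F H) _)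
    (isRadical_colon (isRadical_sysIdeal F H) _)
    ((subset_regularMod_sysIdeal F H).trans (regularMod_le_regularMod_colon _ _))

lemma sysIdeal_eq_inf_insert (F H : Set (DPoly k n)) (s : DPoly k n) :
    sysIdeal F H = sysIdeal F (insert s H) ⊓ sysIdeal (insert s F) H := by
  refine le_antisymm (le_inf (sysIdeal_mono subset_rfl (Set.subset_insert _ _))
    (sysIdeal_mono (Set.subset_insert _ _) subset_rfl)) ?_
  rintro x ⟨hright, hleft⟩
  have hxs : x * s ∈ sysIdeal F H :=
    Submodule.mem_colon_singleton.mp (sysIdeal_insert_right_le F H s hright)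
  refine isRadical_iff_sq.mp (isRadical_sysIdeal F H) x ?_
  rw [pow_two]
  exact Submodule.mem_colon_singleton.mp (sysIdeal_insert_left_le (mul_comm x s ▸ hxs) hleft)

lemma sysIdeal_eq_inf_insert_insert (F H : Set (DPoly k n)) (s i : DPoly k n) :
    sysIdeal F H = sysIdeal F (insert i (insert s H)) ⊓
      (sysIdeal (insert s F) H ⊓ sysIdeal (insert i F) H) := by
  refine le_antisymm (le_inf (sysIdeal_mono subset_rfl ?_)
    (le_inf (sysIdeal_mono (Set.subset_insert _ _) subset_rfl)
      (sysIdeal_mono (Set.subset_insert _ _) subset_rfl))) ?_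
  · exact (Set.subset_insert _ _).trans (Set.subset_insert _ _)
  · rintro x ⟨hboth, hs, hi⟩
    rw [sysIdeal_eq_inf_insert F H s, sysIdeal_eq_inf_insert F (insert s H) i]
    exact ⟨⟨hboth, sysIdeal_mono subset_rfl (Set.subset_insert _ _) hi⟩, hs⟩

end DiffIdeal

/-! ## Triangular sets and autoreduced sets -/

section Triangular

variable {k : Type*} [Field k] {n : ℕ} {F S : Set (DPoly k n)} {I : Ideal (DPoly k n)}
  {u : DVar n}

lemma toUnivariate_eq_C_of_mem_closure (hS : ∀ s ∈ S, u ∉ s.vars) {s : DPoly k n}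
    (hs : s ∈ Submonoid.closure S) : toUnivariate u s = Polynomial.C s := by
  induction hs using Submonoid.closure_induction with
  | mem s hs => exact toUnivariate_of_notMem_vars (hS s hs)
  | one => rw [map_one, map_one]
  | mul s t _ _ hs ht => rw [map_mul, map_mul, hs, ht]

lemma toUnivariate_mem_map_C_span (hF : ∀ f ∈ F, u ∉ f.vars) {x : DPoly k n}
    (hx : x ∈ Ideal.span F) : toUnivariate u x ∈ (Ideal.span F).map Polynomial.C := by
  have hle : Ideal.span F ≤ ((Ideal.span F).map Polynomial.C).comap (toUnivariate u) := by
    refine Ideal.span_le.mpr fun f hf => ?_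
    rw [SetLike.mem_coe, Ideal.mem_comap, toUnivariate_of_notMem_vars (hF f hf)]
    exact Ideal.mem_map_of_mem _ (Ideal.subset_span hf)
  exact hle hx

lemma toUnivariate_mem_map_C_saturation_span (hF : ∀ f ∈ F, u ∉ f.vars)
    (hS : ∀ s ∈ S, u ∉ s.vars) {x : DPoly k n} (hx : x ∈ saturation (Ideal.span F) S) :
    toUnivariate u x ∈ (saturation (Ideal.span F) S).map Polynomial.C := by
  obtain ⟨s, hs, hsx⟩ := hx
  have hmem := toUnivariate_mem_map_C_span hF hsx
  rw [map_mul, toUnivariate_eq_C_of_mem_closure hS hs, Ideal.mem_map_C_iff] at hmem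
  refine Ideal.mem_map_C_iff.mpr fun d => ⟨s, hs, ?_⟩
  rw [← Polynomial.coeff_C_mul]
  exact hmem d

lemma toUnivariate_mem_sup_span (hI : ∀ x ∈ I, toUnivariate u x ∈ I.map Polynomial.C)
    {a x : DPoly k n} (hx : x ∈ I ⊔ Ideal.span {a}) :
    toUnivariate u x ∈ I.map Polynomial.C ⊔ Ideal.span {toUnivariate u a} := by
  obtain ⟨y, hy, z, hz, rfl⟩ := Submodule.mem_sup.mp hx
  obtain ⟨c, rfl⟩ := Ideal.mem_span_singleton'.mp hz
  rw [map_add, map_mul]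
  exact Submodule.add_mem_sup (hI y hy)
    (Ideal.mul_mem_left _ _ (Ideal.mem_span_singleton_self _))

lemma mem_sup_span_of_toUnivariate_mem {a x : DPoly k n}
    (hx : toUnivariate u x ∈ I.map Polynomial.C ⊔ Ideal.span {toUnivariate u a}) :
    x ∈ I ⊔ Ideal.span {a} := by
  have hle : I.map Polynomial.C ⊔ Ideal.span {toUnivariate u a} ≤
      (I ⊔ Ideal.span {a}).comap (Polynomial.evalRingHom (X u)) := by
    refine sup_le (Ideal.map_le_iff_le_comap.mpr fun y hy => ?_)
      ((Ideal.span_singleton_le_iff_mem _).mpr ?_)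
    · rw [Ideal.mem_comap, Ideal.mem_comap, Polynomial.coe_evalRingHom, Polynomial.eval_C]
      exact Ideal.mem_sup_left hy
    · rw [Ideal.mem_comap, Polynomial.coe_evalRingHom, eval_toUnivariate]
      exact Ideal.mem_sup_right (Ideal.mem_span_singleton_self a)
  have hmem := hle hx
  rwa [Ideal.mem_comap, Polynomial.coe_evalRingHom, eval_toUnivariate] at hmem

variable [LinearOrder (DVar n)] {a : DPoly k n}

lemma exists_initial_pow_mul_separant_sq_mul_mem (hrad : I.IsRadical)
    (hI : ∀ x ∈ I, toUnivariate u x ∈ I.map Polynomial.C) (hu : leader a = u)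
    {f : DPoly k n} {N M : ℕ}
    (h : initial a ^ N * separant a ^ M * f ^ 2 ∈ I ⊔ Ideal.span {a}) :
    ∃ e, initial a ^ e * separant a ^ 2 * f ∈ I ⊔ Ideal.span {a} := by
  have hini : toUnivariate u (initial a) = Polynomial.C (toUnivariate u a).leadingCoeff := by
    rw [toUnivariate_of_notMem_vars (notMem_vars_initial hu), initial_of_leader hu]
  have hsep : toUnivariate u (separant a) = (toUnivariate u a).derivative := by
    rw [derivative_toUnivariate, separant_of_leader hu]
  have hdeg : (toUnivariate u a).natDegree ≠ 0 := by
    rw [natDegree_toUnivariate]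
    exact degreeOf_leader_ne_zero hu
  have hmem := toUnivariate_mem_sup_span hI h
  simp only [map_mul, map_pow, hini, hsep] at hmem
  obtain ⟨e, he⟩ := exists_leadingCoeff_pow_mul_derivative_sq_mul_mem hrad hdeg hmem
  refine ⟨e, mem_sup_span_of_toUnivariate_mem (u := u) ?_⟩
  simpa only [map_mul, map_pow, hini, hsep] using he

lemma isRadical_saturation_span_insert (hF : ∀ f ∈ F, u ∉ f.vars) (hS : ∀ s ∈ S, u ∉ s.vars)
    (hrad : (saturation (Ideal.span F) S).IsRadical) (hu : leader a = u) :
    (saturation (Ideal.span (insert a F)) ({initial a, separant a} ∪ S)).IsRadical := by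
  set I := saturation (Ideal.span F) S
  set S' := ({initial a, separant a} : Set (DPoly k n)) ∪ S
  set J := saturation (Ideal.span (insert a F)) S'
  have hspan : Ideal.span (insert a F) ≤ I ⊔ Ideal.span {a} := by
    rw [Ideal.span_insert, sup_comm]
    exact sup_le_sup_right (le_saturation _ _) _
  have hJ : I ⊔ Ideal.span {a} ≤ J :=
    sup_le (saturation_mono (Ideal.span_mono (Set.subset_insert _ _)) Set.subset_union_right)
      ((Ideal.span_singleton_le_iff_mem _).mpr
        (le_saturation _ _ (Ideal.subset_span (Set.mem_insert _ _))))
  have hregular : S' ⊆ regularMod J := subset_regularMod_saturation _ _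
  have hini : initial a ∈ regularMod J := hregular (Or.inl (Or.inl rfl))
  have hsep : separant a ∈ regularMod J := hregular (Or.inl (Or.inr rfl))
  rw [isRadical_iff_sq]
  rintro x ⟨s, hs, hx⟩
  rw [Submonoid.closure_union, Submonoid.mem_sup] at hs
  obtain ⟨p, hp, t, ht, rfl⟩ := hs
  obtain ⟨N, M, rfl⟩ := (Submonoid.mem_closure_pair _ _ _).mp hp
  have hsq : initial a ^ N * separant a ^ M * (t * x) ^ 2 ∈ I ⊔ Ideal.span {a} := by
    have hsplit : initial a ^ N * separant a ^ M * (t * x) ^ 2 =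
        t * (initial a ^ N * separant a ^ M * t * x ^ 2) := by ring
    rw [hsplit]
    exact Ideal.mul_mem_left _ _ (hspan hx)
  obtain ⟨e, he⟩ := exists_initial_pow_mul_separant_sq_mul_mem hrad
    (fun y hy => toUnivariate_mem_map_C_saturation_span hF hS hy) hu hsq
  have htreg : t ∈ regularMod J :=
    Submonoid.closure_le.mpr (Set.subset_union_right.trans hregular) ht
  rw [← mul_assoc] at he
  exact mem_regularMod_iff.mp (mul_mem (mul_mem (pow_mem hini e) (pow_mem hsep 2)) htreg) x
    (hJ he)

end Triangular

section Regular

variable {k : Type*} [Field k] {n : ℕ} [LinearOrder (DVar n)]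

lemma mem_inisep {F : Finset (DPoly k n)} {h : DPoly k n} :
    h ∈ inisep F ↔ ∃ f ∈ F, h = initial f ∨ h = separant f := by
  simp only [inisep, Finset.mem_union, Finset.mem_image, eq_comm (a := h), and_or_left, exists_or]

lemma inisep_mono {F G : Finset (DPoly k n)} (h : F ⊆ G) : inisep F ⊆ inisep G :=
  Finset.union_subset_union (Finset.image_subset_image h) (Finset.image_subset_image h)

lemma initial_mem_inisep {F : Finset (DPoly k n)} {f : DPoly k n} (h : f ∈ F) :
    initial f ∈ inisep F := mem_inisep.mpr ⟨f, h, Or.inl rfl⟩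

lemma separant_mem_inisep {F : Finset (DPoly k n)} {f : DPoly k n} (h : f ∈ F) :
    separant f ∈ inisep F := mem_inisep.mpr ⟨f, h, Or.inr rfl⟩

lemma coe_inisep_insert (a : DPoly k n) (F : Finset (DPoly k n)) :
    (inisep (insert a F) : Set (DPoly k n)) = {initial a, separant a} ∪ ↑(inisep F) := by
  ext h
  simp only [Set.mem_union, Finset.mem_coe, mem_inisep, Finset.exists_mem_insert,
    Set.mem_insert_iff, Set.mem_singleton_iff]

lemma exists_vars_subset_of_mem_inisep {F : Finset (DPoly k n)} {h : DPoly k n}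
    (hh : h ∈ inisep F) : ∃ f ∈ F, h.vars ⊆ f.vars := by
  obtain ⟨f, hf, rfl | rfl⟩ := mem_inisep.mp hh
  · exact ⟨f, hf, vars_initial_subset f⟩
  · exact ⟨f, hf, vars_separant_subset f⟩

theorem isRadical_saturation_span_inisep {F : Finset (DPoly k n)}
    (hF : ∀ f ∈ F, f ∉ constants k n) (hinj : Set.InjOn (leader : DPoly k n → _) F) :
    (saturation (Ideal.span (F : Set (DPoly k n))) (inisep F)).IsRadical := by
  induction F using Finset.induction_on_max_value (leader : DPoly k n → _) with
  | empty =>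
    rw [Finset.coe_empty, Ideal.span_empty]
    exact isRadical_saturation (isRadical_iff_sq.mpr fun _ => eq_zero_of_pow_eq_zero) _
  | insert a F haF hmax ih =>
    obtain ⟨u, hu⟩ := exists_leader_eq_coe (hF a (Finset.mem_insert_self a F))
    have huF : ∀ g ∈ F, u ∉ g.vars := by
      intro g hg hug
      have hleader : leader g = leader a := le_antisymm (hmax g hg) (hu ▸ Finset.le_max hug)
      exact haF (hinj (Finset.mem_insert_of_mem hg) (Finset.mem_insert_self a F) hleader ▸ hg)
    have hrad := ih (fun f hf => hF f (Finset.mem_insert_of_mem hf))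
      (hinj.mono (Finset.coe_subset.mpr (Finset.subset_insert a F)))
    rw [coe_inisep_insert, Finset.coe_insert]
    refine isRadical_saturation_span_insert huF (fun s hs hus => ?_) hrad hu
    obtain ⟨f, hf, hsub⟩ := exists_vars_subset_of_mem_inisep hs
    exact huF f hf (hsub hus)

variable [Differential k] [CharZero k] {a : DPoly k n} {u : DVar n}

lemma leader_iterate_delta (hrk : IsRanking n) (hu : leader a = u) (j : ℕ) :
    leader ((delta k n)^[j] a) = (u.shift j : DVar n) := by
  induction j with
  | zero => exact hu
  | succ j ih => rw [Function.iterate_succ_apply', leader_delta hrk ih]; rfl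

lemma separant_iterate_delta (hrk : IsRanking n) (hu : leader a = u) (j : ℕ) :
    separant ((delta k n)^[j] a) = separant a := by
  induction j with
  | zero => rfl
  | succ j ih =>
    rw [Function.iterate_succ_apply', separant_delta hrk (leader_iterate_delta hrk hu j), ih]

lemma initial_iterate_delta_succ (hrk : IsRanking n) (hu : leader a = u) (j : ℕ) :
    initial ((delta k n)^[j + 1] a) = separant a := by
  rw [Function.iterate_succ_apply', initial_delta hrk (leader_iterate_delta hrk hu j),
    separant_iterate_delta hrk hu]

lemma leader_injOn_iterate_delta (hrk : IsRanking n) {A : Finset (DPoly k n)}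
    (hA : ∀ f ∈ A, f ∉ constants k n) (hlv : Set.InjOn (lv : DPoly k n → _) A) :
    Set.InjOn (leader : DPoly k n → _) {g | ∃ a ∈ A, ∃ j : ℕ, g = (delta k n)^[j] a} := by
  rintro _ ⟨a, ha, i, rfl⟩ _ ⟨b, hb, j, rfl⟩ heq
  obtain ⟨u, hu⟩ := exists_leader_eq_coe (hA a ha)
  obtain ⟨v, hv⟩ := exists_leader_eq_coe (hA b hb)
  rw [leader_iterate_delta hrk hu, leader_iterate_delta hrk hv, WithBot.coe_inj, DVar.shift,
    DVar.shift, DVar.mk.injEq] at heq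
  obtain rfl : a = b := hlv ha hb (by rw [lv_of_leader hu, lv_of_leader hv, heq.1])
  obtain rfl : u = v := WithBot.coe_injective (hu.symm.trans hv)
  rw [Nat.add_left_cancel heq.2]

lemma inisep_subset_of_iterate_delta (hrk : IsRanking n) {A T : Finset (DPoly k n)}
    (hA : ∀ f ∈ A, f ∉ constants k n)
    (hT : (T : Set (DPoly k n)) ⊆ {g | ∃ a ∈ A, ∃ j : ℕ, g = (delta k n)^[j] a}) :
    inisep T ⊆ inisep A := by
  intro h hh
  obtain ⟨g, hg, hh⟩ := mem_inisep.mp hh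
  obtain ⟨a, ha, j, rfl⟩ := hT hg
  obtain ⟨u, hu⟩ := exists_leader_eq_coe (hA a ha)
  rw [separant_iterate_delta hrk hu] at hh
  rcases hh with rfl | rfl
  · cases j with
    | zero => exact initial_mem_inisep ha
    | succ j => rw [initial_iterate_delta_succ hrk hu]; exact separant_mem_inisep ha
  · exact separant_mem_inisep ha

theorem isRadical_saturation_diffIdeal (hrk : IsRanking n) {A H : Finset (DPoly k n)}
    (hA : ∀ f ∈ A, f ∉ constants k n) (hlv : Set.InjOn (lv : DPoly k n → _) A)
    (hH : inisep A ⊆ H) : (saturation (diffIdeal (A : Set (DPoly k n))) H).IsRadical := by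
  rw [isRadical_iff_sq]
  rintro x ⟨s, hs, hx⟩
  -- Only finitely many derivatives of elements of `A` are involved; they form a triangular set.
  obtain ⟨T, hT, hxT⟩ :=
    Submodule.mem_span_finite_of_mem_span (diffIdeal_le_span_iterate_delta _ hx)
  have hTconst : ∀ g ∈ T, g ∉ constants k n := by
    intro g hg
    obtain ⟨a, ha, j, rfl⟩ := hT hg
    obtain ⟨u, hu⟩ := exists_leader_eq_coe (hA a ha)
    exact notMem_constants_of_leader (leader_iterate_delta hrk hu j)
  have hrad := isRadical_saturation_span_inisep hTconst
    ((leader_injOn_iterate_delta hrk hA hlv).mono hT)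
  have hle : saturation (Ideal.span (T : Set (DPoly k n))) (inisep T) ≤
      saturation (diffIdeal (A : Set (DPoly k n))) H := by
    refine saturation_mono (Ideal.span_le.mpr fun g hg => ?_)
      (Finset.coe_subset.mpr ((inisep_subset_of_iterate_delta hrk hA hT).trans hH))
    obtain ⟨a, ha, j, rfl⟩ := hT hg
    exact iterate_delta_mem (isDiffIdeal_diffIdeal _) (subset_diffIdeal _ ha) j
  have hsx : s * x ∈ saturation (Ideal.span (T : Set (DPoly k n))) (inisep T) := by
    refine isRadical_iff_sq.mp hrad _ (le_saturation _ _ ?_)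
    have hsq : (s * x) ^ 2 = s * (s * x ^ 2) := by ring
    rw [hsq]
    exact Ideal.mul_mem_left _ _ hxT
  obtain ⟨t, ht, htx⟩ := hle hsx
  exact ⟨t * s, mul_mem ht hs, by rwa [mul_assoc]⟩

theorem sysIdeal_eq_saturation_diffIdeal (hrk : IsRanking n) {A H : Finset (DPoly k n)}
    (hA : ∀ f ∈ A, f ∉ constants k n) (hlv : Set.InjOn (lv : DPoly k n → _) A)
    (hH : inisep A ⊆ H) :
    sysIdeal (A : Set (DPoly k n)) H = saturation (diffIdeal (A : Set (DPoly k n))) H :=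
  le_antisymm
    (sysIdeal_le ((subset_diffIdeal _).trans (le_saturation _ _))
      (isDiffIdeal_saturation (isDiffIdeal_diffIdeal _) _)
      (isRadical_saturation_diffIdeal hrk hA hlv hH) (subset_regularMod_saturation _ _))
    (saturation_mono (diffIdeal_le_radDiffIdeal _) subset_rfl)

end Regular

/-! ## The ordering of triples -/

section Termination

variable {k : Type*} [Field k] {n : ℕ} [LinearOrder (DVar n)]

/-- The least rank of the elements of `F`, which is `⊤` for empty `F`. -/
def minRank (F : Finset (DPoly k n)) : WithTop (WithBot (DVar n ×ₗ ℕ)) :=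
  F.inf fun f => (rank f : WithTop (WithBot (DVar n ×ₗ ℕ)))

/-- The least ranks of the elements of `A`, one for each leading variable; the value `⊤` marks
the indeterminates that do not lead an element of `A`. -/
def rankFamily (A : Finset (DPoly k n)) (y : Fin n) : WithTop (WithBot (DVar n ×ₗ ℕ)) :=
  minRank (A.filter fun a => lv a = y)

/-- The ordering in which all systems produced from a triple are smaller than the triple:
the component `C` counts first, the least rank of `F` second. -/
def TripleLT (t' t : Triple k n) : Prop :=
  Prod.Lex (· < ·) (· < ·) (rankFamily t'.C, minRank t'.F) (rankFamily t.C, minRank t.F)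

lemma wellFounded_tripleLT (hrk : IsRanking n) :
    WellFounded (TripleLT : Triple k n → Triple k n → Prop) := by
  have := hrk.wellFoundedLT
  exact InvImage.wf (fun t : Triple k n => (rankFamily t.C, minRank t.F))
    (WellFounded.prod_lex wellFounded_lt wellFounded_lt)

lemma minRank_le {F : Finset (DPoly k n)} {f : DPoly k n} (hf : f ∈ F) :
    minRank F ≤ (rank f : WithTop (WithBot (DVar n ×ₗ ℕ))) :=
  Finset.inf_le hf

lemma IsLeastRank.minRank_eq {F : Finset (DPoly k n)} {f : DPoly k n} (hf : IsLeastRank F f) :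
    minRank F = (rank f : WithTop (WithBot (DVar n ×ₗ ℕ))) :=
  le_antisymm (minRank_le hf.1) (Finset.le_inf fun g hg => WithTop.coe_le_coe.mpr (hf.2 g hg))

lemma exists_isLeastRank {F : Finset (DPoly k n)} (hF : F.Nonempty) : ∃ f, IsLeastRank F f :=
  Finset.exists_min_image F rank hF

lemma mem_splits {t t' : Triple k n} {f : DPoly k n} (ht : t' ∈ splits t f) :
    ∃ s, (s = separant f ∨ s = initial f) ∧ s ∉ constants k n ∧
      t' = ⟨insert s t.F, t.C, t.H⟩ := by
  rw [splits] at ht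
  split_ifs at ht with hsep hini
  · simp at ht
  · obtain rfl : t' = _ := by simpa using ht
    exact ⟨_, Or.inl rfl, hsep, rfl⟩
  · rw [Finset.mem_insert, Finset.mem_singleton] at ht
    rcases ht with rfl | rfl
    · exact ⟨_, Or.inl rfl, hsep, rfl⟩
    · exact ⟨_, Or.inr rfl, hini, rfl⟩

lemma tripleLT_of_mem_splits {t t' : Triple k n} {f : DPoly k n} (hf : IsLeastRank t.F f)
    (hc : f ∉ constants k n) (ht : t' ∈ splits t f) : TripleLT t' t := by
  obtain ⟨s, hs, -, rfl⟩ := mem_splits ht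
  have hrank : rank s < rank f := by
    rcases hs with rfl | rfl
    · exact rank_separant_lt hc
    · exact rank_initial_lt hc
  refine Prod.Lex.right _ ?_
  rw [hf.minRank_eq]
  exact (minRank_le (Finset.mem_insert_self s t.F)).trans_lt (WithTop.coe_lt_coe.mpr hrank)

end Termination

lemma cutExpand_union {α : Type*} [DecidableEq α] {r : α → α → Prop} {U S : Finset α}
    {a : α} (h : ∀ b ∈ S, r b a) :
    Relation.CutExpand r (U ∪ S).val (a ::ₘ U.val) := by
  refine ⟨(S \ U).val, a, fun b hb => h b (Finset.mem_sdiff.mp hb).1, ?_⟩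
  have hunion : U ∪ S = U.disjUnion (S \ U) Finset.disjoint_sdiff := by
    rw [Finset.disjUnion_eq_union, Finset.union_sdiff_self_eq_union]
  rw [hunion, Finset.disjUnion_val, ← Multiset.singleton_add]
  abel

/-! ## The loop of Differentiate&Autoreduce -/

section LeadingVariables

variable {k : Type*} [Field k] {n : ℕ} [LinearOrder (DVar n)]

lemma mem_lvSet {F : Finset (DPoly k n)} {y : Fin n} :
    y ∈ lvSet F ↔ ∃ f ∈ F, ∃ u : DVar n, leader f = u ∧ u.var = y := by
  simp only [lvSet, Finset.mem_filter, Finset.mem_univ, true_and, lv_eq_coe_iff]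

lemma mem_lowest {B : Finset (DPoly k n)} {b : DPoly k n} :
    b ∈ lowest B ↔ b ∈ B ∧ ∀ g ∈ B, lv g = lv b → rank b ≤ rank g := by
  simp only [lowest, Finset.mem_filter]

lemma mem_highest {B : Finset (DPoly k n)} {b : DPoly k n} :
    b ∈ highest B ↔ b ∈ B ∧ ∀ g ∈ B, lv g = lv b → rank g ≤ rank b := by
  simp only [highest, Finset.mem_filter]

lemma lowest_subset (B : Finset (DPoly k n)) : lowest B ⊆ B := Finset.filter_subset _ _

lemma exists_mem_highest {B : Finset (DPoly k n)} {b : DPoly k n} (hb : b ∈ B) :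
    ∃ b' ∈ highest B, lv b' = lv b := by
  obtain ⟨b', hb', hmax⟩ := Finset.exists_max_image (B.filter fun g => lv g = lv b) rank
    ⟨b, Finset.mem_filter.mpr ⟨hb, rfl⟩⟩
  obtain ⟨hb'B, hlv⟩ := Finset.mem_filter.mp hb'
  exact ⟨b', mem_highest.mpr ⟨hb'B, fun g hg hg' =>
    hmax g (Finset.mem_filter.mpr ⟨hg, hg'.trans hlv⟩)⟩, hlv⟩

variable [Differential k]

lemma mem_candidates {m : Fin n → ℕ} {D B : Finset (DPoly k n)} {g : DPoly k n} :
    g ∈ candidates m D B ↔ g ∈ D ∨ ((∃ b ∈ highest B, delta k n b = g) ∧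
      ∀ u : DVar n, leader g = u → u.ord ≤ m u.var) := by
  simp only [candidates, bounded, Finset.mem_union, Finset.mem_filter, Finset.mem_image]

lemma mem_divisors {D B : Finset (DPoly k n)} {g d : DPoly k n} :
    d ∈ divisors D B g ↔ d ∈ B ∨ (g ∉ D ∧ d ≠ g ∧ ∃ c ∈ lowest B, delta k n c = d) := by
  rw [divisors]
  split_ifs with h
  · simp [h]
  · simp [h, Finset.mem_union, Finset.mem_erase, Finset.mem_image]

end LeadingVariables

section Remainder

variable {k : Type*} [Field k] {n : ℕ} [LinearOrder (DVar n)] {B : Finset (DPoly k n)}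
  {f r : DPoly k n} {u : DVar n} {Q : Ideal (DPoly k n)}

lemma leader_le_of_algRem (hf : leader f = u) (hne : ∀ d ∈ B, leader d ≠ u)
    (hrem : AlgRem B f r) : leader r ≤ u := by
  refine Finset.max_le fun v hv => WithBot.coe_le_coe.mpr ?_
  rcases (hrem.filter_leader_lt (fun _ => le_of_leader hf) hne).mem_vars hv with hvf | ⟨d, hd, hvd⟩
  · exact le_of_leader hf hvf
  · exact WithBot.coe_le_coe.mp
      ((Finset.le_max hvd).trans (Finset.mem_filter.mp hd).2.le)

lemma leader_lt_notMem_vars {d : DPoly k n} (hd : leader d < u) : u ∉ d.vars :=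
  fun hud => (Finset.le_max hud).not_gt hd

lemma degreeOf_lt_of_rank_ne (hf : leader f = u) (hne : ∀ d ∈ B, leader d ≠ u)
    (hrem : AlgRem B f r) (hrank : rank r ≠ rank f) : degreeOf u r < degreeOf u f := by
  have hdeg : degreeOf u r ≤ degreeOf u f :=
    (hrem.filter_leader_lt (fun _ => le_of_leader hf) hne).degreeOf_le fun d hd =>
      leader_lt_notMem_vars (Finset.mem_filter.mp hd).2
  refine hdeg.lt_of_ne fun heq => hrank ((rank_eq_iff_of_leader hf).mpr ⟨?_, heq⟩)
  refine (leader_le_of_algRem hf hne hrem).antisymm (Finset.le_max ?_)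
  rw [mem_vars_iff_degreeOf_ne_zero, heq]
  exact degreeOf_leader_ne_zero hf

/-- Modulo `Q`, the polynomial `f` vanishes, whereas its initial and its separant are not zero
divisors. -/
def VanishesRegularly (Q : Ideal (DPoly k n)) (f : DPoly k n) : Prop :=
  f ∈ Q ∧ initial f ∈ regularMod Q ∧ separant f ∈ regularMod Q

lemma VanishesRegularly.mem_regularMod_of_mem_inisep {F : Finset (DPoly k n)} {h : DPoly k n}
    (hF : ∀ f ∈ F, VanishesRegularly Q f) (hh : h ∈ inisep F) : h ∈ regularMod Q := by
  obtain ⟨f, hf, rfl | rfl⟩ := mem_inisep.mp hh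
  · exact (hF f hf).2.1
  · exact (hF f hf).2.2

lemma AlgRem.mem_iff (h : AlgRem B f r) (hB : ∀ b ∈ B, VanishesRegularly Q b) :
    f ∈ Q ↔ r ∈ Q := by
  obtain ⟨P, hP, hPf⟩ := h.exists_mul_sub_mem fun b hb => ⟨(hB b hb).1, (hB b hb).2.1⟩
  exact mem_iff_of_mul_sub_mem hP hPf

lemma AlgRem.mem_regularMod_iff (h : AlgRem B f r) (hB : ∀ b ∈ B, VanishesRegularly Q b) :
    f ∈ regularMod Q ↔ r ∈ regularMod Q := by
  obtain ⟨P, hP, hPf⟩ := h.exists_mul_sub_mem fun b hb => ⟨(hB b hb).1, (hB b hb).2.1⟩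
  exact mem_regularMod_iff_of_mul_sub_mem hP hPf

lemma AlgRemSet.subset_iff {G R : Finset (DPoly k n)} (h : AlgRemSet B G R)
    (hB : ∀ b ∈ B, VanishesRegularly Q b) :
    (G : Set (DPoly k n)) ⊆ Q ↔ (R : Set (DPoly k n)) ⊆ Q := by
  obtain ⟨ρ, hρ, rfl⟩ := h
  rw [Finset.coe_image, Set.image_subset_iff]
  exact forall₂_congr fun g hg => (hρ g hg).mem_iff hB

lemma AlgRemSet.subset_regularMod_iff {G R : Finset (DPoly k n)} (h : AlgRemSet B G R)
    (hB : ∀ b ∈ B, VanishesRegularly Q b) :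
    (G : Set (DPoly k n)) ⊆ regularMod Q ↔ (R : Set (DPoly k n)) ⊆ regularMod Q := by
  obtain ⟨ρ, hρ, rfl⟩ := h
  rw [Finset.coe_image, Set.image_subset_iff]
  exact forall₂_congr fun g hg => (hρ g hg).mem_regularMod_iff hB

lemma exists_mul_coeff_sub_mem_of_leader_ne (hf : leader f = u) (hne : ∀ d ∈ B, leader d ≠ u)
    (hrem : AlgRem B f r) (hB : ∀ d ∈ B, VanishesRegularly Q d) :
    ∃ P ∈ regularMod Q, ∀ d, P * (toUnivariate u f).coeff d - (toUnivariate u r).coeff d ∈ Q :=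
  (hrem.filter_leader_lt (fun _ => le_of_leader hf) hne).exists_mul_coeff_sub_mem
    (fun d hd => have hdB := hB d (Finset.mem_filter.mp hd).1; ⟨hdB.1, hdB.2.1⟩)
    fun _ hd => leader_lt_notMem_vars (Finset.mem_filter.mp hd).2

lemma vanishesRegularly_algRem_iff (hf : leader f = u) (hne : ∀ d ∈ B, leader d ≠ u)
    (hrem : AlgRem B f r) (hrank : rank r = rank f) (hB : ∀ d ∈ B, VanishesRegularly Q d) :
    VanishesRegularly Q r ↔ VanishesRegularly Q f := by
  obtain ⟨P, hP, hcoeff⟩ := exists_mul_coeff_sub_mem_of_leader_ne hf hne hrem hB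
  obtain ⟨hr, hdeg⟩ := (rank_eq_iff_of_leader hf).mp hrank
  have hini : P * initial f - initial r ∈ Q := by
    rw [initial_of_leader hf, initial_of_leader hr, Polynomial.leadingCoeff,
      Polynomial.leadingCoeff, natDegree_toUnivariate, natDegree_toUnivariate, hdeg]
    exact hcoeff _
  have hsep : P * separant f - separant r ∈ Q := by
    rw [separant_of_leader hf, separant_of_leader hr]
    exact mul_pderiv_sub_mem_of_coeff hcoeff
  rw [VanishesRegularly, VanishesRegularly,
    mem_iff_of_mul_sub_mem hP (mul_sub_mem_of_coeff hcoeff),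
    mem_regularMod_iff_of_mul_sub_mem hP hini, mem_regularMod_iff_of_mul_sub_mem hP hsep]

lemma eq_top_of_rank_algRem_ne (hf : leader f = u) (hne : ∀ d ∈ B, leader d ≠ u)
    (hrem : AlgRem B f r) (hrank : rank r ≠ rank f) (hB : ∀ d ∈ B, VanishesRegularly Q d)
    (hini : initial f ∈ regularMod Q) : Q = ⊤ := by
  obtain ⟨P, hP, hcoeff⟩ := exists_mul_coeff_sub_mem_of_leader_ne hf hne hrem hB
  have hr : (toUnivariate u r).coeff (degreeOf u f) = 0 := by
    apply Polynomial.coeff_eq_zero_of_natDegree_lt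
    rw [natDegree_toUnivariate]
    exact degreeOf_lt_of_rank_ne hf hne hrem hrank
  have hmem : P * initial f ∈ Q := by
    rw [initial_of_leader hf, Polynomial.leadingCoeff, natDegree_toUnivariate]
    simpa only [hr, sub_zero] using hcoeff (degreeOf u f)
  rw [Ideal.eq_top_iff_one]
  exact mem_regularMod_iff.mp (mul_mem hP hini) 1 (by rwa [mul_one])

lemma VanishesRegularly.delta [Differential k] [CharZero k] (hrk : IsRanking n)
    (hQ : IsDiffIdeal Q) (hf : leader f = u) (h : VanishesRegularly Q f) :
    VanishesRegularly Q (delta k n f) := by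
  rw [VanishesRegularly, initial_delta hrk hf, separant_delta hrk hf]
  exact ⟨hQ f h.1, h.2.2, h.2.2⟩

end Remainder

section Invariant

variable {k : Type*} [Field k] {n : ℕ} [LinearOrder (DVar n)]

/-- The conditions on the arguments of a call of Differentiate&Autoreduce. -/
structure CallSpec (A : Finset (DPoly k n)) (m : Fin n → ℕ) : Prop where
  nonconst : ∀ c ∈ A, c ∉ constants k n
  lvInj : Set.InjOn (lv : DPoly k n → _) A
  ord_le : ∀ c ∈ A, ∀ v ∈ c.vars, v.ord ≤ m v.var

/-- How an element `b` of `B` comes from an element `c` of the input of Differentiate&Autoreduce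
with leader `w`, by `i` derivations, each of them followed by a reduction. -/
structure IsProlongation (B : Finset (DPoly k n)) (c b : DPoly k n) (w : DVar n) (i : ℕ) :
    Prop where
  leader_base : leader c = w
  leader_eq : leader b = w.shift i
  degreeOf_eq : i = 0 → degreeOf w b = degreeOf w c
  degreeOf_eq_one : 0 < i → degreeOf (w.shift i) b = 1
  exists_leader_eq : ∀ j ≤ i, ∃ e ∈ B, leader e = w.shift j

variable [Differential k]

/-- The invariant of the loop of Differentiate&Autoreduce, called with `A` and `m`. Orders of
indeterminates that do not lead an element of `A` can grow, but by no more than the number of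
derivatives that have been added to `B`. -/
structure LoopInv (A : Finset (DPoly k n)) (m : Fin n → ℕ) (D B : Finset (DPoly k n)) :
    Prop where
  subset : D ⊆ A
  inj : Set.InjOn (leader : DPoly k n → _) B
  lt_cand : ∀ b ∈ B, ∀ g ∈ candidates m D B, leader b < leader g
  algRed : ∀ b ∈ B, ∀ b' ∈ B, b ≠ b' → AlgReduced b b'
  origin : ∀ b ∈ B, ∃ c ∈ A \ D, ∃ w i, IsProlongation B c b w i
  done : ∀ c ∈ A \ D, ∃ b ∈ B, leader b = leader c
  ord_le : ∀ b ∈ B, ∀ v ∈ b.vars, v.var ∈ lvSet A → v.ord ≤ m v.var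
  card_le : A.card ≤ B.card + D.card
  ord_add_le : ∀ b ∈ B, ∀ v ∈ b.vars, v.var ∉ lvSet A →
    v.ord + A.card ≤ m v.var + (B.card + D.card)
  forward : ∀ Q : Ideal (DPoly k n), IsDiffIdeal Q → (∀ c ∈ A, VanishesRegularly Q c) →
    ∀ b ∈ B, VanishesRegularly Q b
  backward : ∀ Q : Ideal (DPoly k n), IsDiffIdeal Q → (∀ b ∈ lowest B, b ∈ Q) →
    (∀ h ∈ inisep B, h ∈ regularMod Q) →
    (∀ b ∈ B, b ∈ Q) ∧ ∀ c ∈ A \ D, VanishesRegularly Q c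

lemma loopInv_start (A : Finset (DPoly k n)) (m : Fin n → ℕ) : LoopInv A m A ∅ where
  subset := subset_rfl
  inj := by simp
  lt_cand := by simp
  algRed := by simp
  origin := by simp
  done := by simp
  ord_le := by simp
  card_le := by simp
  ord_add_le := by simp
  forward := by simp
  backward := by simp

namespace LoopInv

variable {A : Finset (DPoly k n)} {m : Fin n → ℕ} {D B : Finset (DPoly k n)}

lemma exists_leader (hI : LoopInv A m D B) {b : DPoly k n} (hb : b ∈ B) :
    ∃ u : DVar n, leader b = u := by
  obtain ⟨c, -, w, i, hbc⟩ := hI.origin b hb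
  exact ⟨_, hbc.leader_eq⟩

lemma exists_isProlongation_of_var_eq (hI : LoopInv A m D B) (hA : CallSpec A m)
    {b c : DPoly k n} {u w : DVar n} (hb : b ∈ B) (hc : c ∈ A) (hu : leader b = u)
    (hw : leader c = w) (hvar : w.var = u.var) :
    c ∉ D ∧ ∃ i, u = w.shift i ∧ IsProlongation B c b w i := by
  obtain ⟨c', hc', w', i, hbc⟩ := hI.origin b hb
  obtain ⟨hc'A, hc'D⟩ := Finset.mem_sdiff.mp hc'
  obtain rfl : u = w'.shift i := WithBot.coe_injective (hu.symm.trans hbc.leader_eq)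
  obtain rfl : c' = c :=
    hA.lvInj hc'A hc (by rw [lv_of_leader hbc.leader_base, lv_of_leader hw, hvar, DVar.shift])
  obtain rfl : w' = w := WithBot.coe_injective (hbc.leader_base.symm.trans hw)
  exact ⟨hc'D, i, rfl, hbc⟩

lemma isProlongation_of_leader_eq (hI : LoopInv A m D B) (hA : CallSpec A m) {b c : DPoly k n}
    {w : DVar n} {i : ℕ} (hb : b ∈ B) (hc : c ∈ A) (hw : leader c = w)
    (hbw : leader b = w.shift i) : IsProlongation B c b w i := by
  obtain ⟨-, j, hij, hbc⟩ := hI.exists_isProlongation_of_var_eq hA hb hc hbw hw rfl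
  obtain rfl : i = j := Nat.add_left_cancel (congrArg DVar.ord hij)
  exact hbc

lemma var_mem_lvSet (hI : LoopInv A m D B) {b : DPoly k n} {u : DVar n} (hb : b ∈ B)
    (hu : leader b = u) : u.var ∈ lvSet A := by
  obtain ⟨c, hc, w, i, hbc⟩ := hI.origin b hb
  obtain rfl : u = w.shift i := WithBot.coe_injective (hu.symm.trans hbc.leader_eq)
  exact mem_lvSet.mpr ⟨c, (Finset.mem_sdiff.mp hc).1, w, hbc.leader_base, rfl⟩

lemma mem_lowest_iff (hrk : IsRanking n) (hI : LoopInv A m D B) (hA : CallSpec A m)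
    {b c : DPoly k n} {w : DVar n} {i : ℕ} (hb : b ∈ B) (hc : c ∈ A)
    (hbc : IsProlongation B c b w i) : b ∈ lowest B ↔ i = 0 := by
  constructor
  · intro hlow
    obtain ⟨e, he, hew⟩ := hbc.exists_leader_eq 0 (Nat.zero_le i)
    have hle : leader b ≤ leader e := leader_le_of_rank_le ((mem_lowest.mp hlow).2 e he (by
      rw [lv_of_leader hew, lv_of_leader hbc.leader_eq, DVar.shift, DVar.shift]))
    rw [hew, hbc.leader_eq, WithBot.coe_le_coe] at hle
    exact Nat.le_zero.mp (Nat.le_of_add_le_add_left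
      ((hrk.le_iff_ord_le (u := w.shift i) (v := w.shift 0) rfl).mp hle))
  · rintro rfl
    refine mem_lowest.mpr ⟨hb, fun e he hlv => ?_⟩
    obtain ⟨u, hu⟩ := hI.exists_leader he
    rw [lv_of_leader hu, lv_of_leader hbc.leader_eq, WithBot.coe_inj] at hlv
    obtain ⟨-, j, rfl, -⟩ :=
      hI.exists_isProlongation_of_var_eq hA he hc hu hbc.leader_base hlv.symm
    have hle : leader b ≤ leader e := by
      rw [hbc.leader_eq, hu, WithBot.coe_le_coe]
      exact hrk.le_shift j w
    rcases hle.eq_or_lt with heq | hlt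
    · rw [hI.inj hb he heq]
    · exact (rank_lt_of_leader_lt hlt).le

variable [CharZero k]

lemma leader_of_mem_candidates (hrk : IsRanking n) (hI : LoopInv A m D B) (hA : CallSpec A m)
    {g : DPoly k n} (hg : g ∈ candidates m D B) : ∃ u : DVar n, leader g = u ∧
      (g ∈ D ∨ ∃ b ∈ highest B, ∃ w : DVar n, leader b = w ∧ g = delta k n b ∧
        u = w.shift 1 ∧ u.ord ≤ m u.var) := by
  rcases mem_candidates.mp hg with hgD | ⟨⟨b, hb, rfl⟩, hord⟩
  · obtain ⟨u, hu⟩ := exists_leader_eq_coe (hA.nonconst g (hI.subset hgD))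
    exact ⟨u, hu, Or.inl hgD⟩
  · obtain ⟨w, hw⟩ := hI.exists_leader (mem_highest.mp hb).1
    have hu := leader_delta hrk hw
    exact ⟨_, hu, Or.inr ⟨b, hb, w, hw, rfl, rfl, hord _ hu⟩⟩

lemma injOn_leader_candidates (hrk : IsRanking n) (hI : LoopInv A m D B) (hA : CallSpec A m) :
    Set.InjOn (leader : DPoly k n → _) (candidates m D B) := by
  have leader_ne_shift : ∀ {c b : DPoly k n} {u w : DVar n}, c ∈ D → b ∈ highest B →
      leader c = u → leader b = w → u ≠ w.shift 1 := by
    intro c b u w hc hb hu hw huw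
    exact (hI.exists_isProlongation_of_var_eq hA (mem_highest.mp hb).1 (hI.subset hc) hw hu
      (by rw [huw, DVar.shift])).1 hc
  intro g hg g' hg' hlead
  obtain ⟨u, hu, hcase⟩ := hI.leader_of_mem_candidates hrk hA hg
  obtain ⟨u', hu', hcase'⟩ := hI.leader_of_mem_candidates hrk hA hg'
  obtain rfl : u = u' := WithBot.coe_injective (hu.symm.trans (hlead.trans hu'))
  rcases hcase with hgD | ⟨b, hb, w, hw, rfl, huw, -⟩ <;>
    rcases hcase' with hgD' | ⟨b', hb', w', hw', rfl, huw', -⟩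
  · exact hA.lvInj (hI.subset hgD) (hI.subset hgD') (by rw [lv_of_leader hu, lv_of_leader hu'])
  · exact absurd huw' (leader_ne_shift hgD hb' hu hw')
  · exact absurd huw (leader_ne_shift hgD' hb hu' hw)
  · obtain rfl : w = w' := DVar.shift_injective 1 (huw.symm.trans huw')
    rw [hI.inj (mem_highest.mp hb).1 (mem_highest.mp hb').1 (hw.trans hw'.symm)]

lemma exists_isProlongation (hrk : IsRanking n) (hI : LoopInv A m D B) (hA : CallSpec A m)
    {c : DPoly k n} {w : DVar n} (hc : c ∈ A) (hw : leader c = w) {j : ℕ}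
    (hjm : w.ord + j ≤ m w.var)
    (hno : ∀ g ∈ candidates m D B, ∀ i ≤ j, leader g ≠ w.shift i) :
    ∃ e ∈ B, IsProlongation B c e w j := by
  have hcD : c ∉ D := fun h => hno c (mem_candidates.mpr (Or.inl h)) 0 (Nat.zero_le j) hw
  obtain ⟨b, hb, hbc⟩ := hI.done c (Finset.mem_sdiff.mpr ⟨hc, hcD⟩)
  obtain ⟨b', hb', hlv⟩ := exists_mem_highest hb
  have hb'B := (mem_highest.mp hb').1
  obtain ⟨u, hu⟩ := hI.exists_leader hb'B
  rw [lv_of_leader hu, lv_of_leader (hbc.trans hw), WithBot.coe_inj] at hlv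
  obtain ⟨-, i, rfl, hb'c⟩ := hI.exists_isProlongation_of_var_eq hA hb'B hc hu hw hlv.symm
  have hji : j ≤ i := by
    by_contra hlt
    have hδ : leader (delta k n b') = w.shift (i + 1) := leader_delta hrk hu
    refine hno (delta k n b') (mem_candidates.mpr (Or.inr ⟨⟨b', hb', rfl⟩, fun v hv => ?_⟩))
      (i + 1) (by omega) hδ
    obtain rfl : w.shift (i + 1) = v := WithBot.coe_injective (hδ.symm.trans hv)
    change w.ord + (i + 1) ≤ m w.var
    omega
  obtain ⟨e, he, hew⟩ := hb'c.exists_leader_eq j hji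
  exact ⟨e, he, hI.isProlongation_of_leader_eq hA he hc hw hew⟩

lemma leader_divisor_ne (hrk : IsRanking n) (hI : LoopInv A m D B) (hA : CallSpec A m)
    {g d : DPoly k n} (hg : g ∈ candidates m D B) (hd : d ∈ divisors D B g) :
    leader d ≠ leader g := by
  rcases mem_divisors.mp hd with hd | ⟨hgD, hdg, c, hc, rfl⟩
  · exact (hI.lt_cand d hd g hg).ne
  · intro heq
    obtain ⟨u, hu, hcase⟩ := hI.leader_of_mem_candidates hrk hA hg
    obtain ⟨b, hb, w, hw, rfl, rfl, -⟩ := hcase.resolve_left hgD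
    obtain ⟨w', hw'⟩ := hI.exists_leader (lowest_subset B hc)
    rw [leader_delta hrk hw', hu, WithBot.coe_inj] at heq
    obtain rfl : w' = w := DVar.shift_injective 1 heq
    exact hdg (by rw [hI.inj (lowest_subset B hc) (mem_highest.mp hb).1 (hw'.trans hw.symm)])

variable {Q : Ideal (DPoly k n)}

lemma vanishesRegularly_divisors (hrk : IsRanking n) (hI : LoopInv A m D B) (hQ : IsDiffIdeal Q)
    (hB : ∀ b ∈ B, VanishesRegularly Q b) {g d : DPoly k n} (hd : d ∈ divisors D B g) :
    VanishesRegularly Q d := by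
  rcases mem_divisors.mp hd with hd | ⟨-, -, c, hc, rfl⟩
  · exact hB d hd
  · obtain ⟨w, hw⟩ := hI.exists_leader (lowest_subset B hc)
    exact (hB c (lowest_subset B hc)).delta hrk hQ hw

lemma vanishesRegularly_candidate (hrk : IsRanking n) (hI : LoopInv A m D B) (hA : CallSpec A m)
    {g : DPoly k n} (hg : g ∈ candidates m D B) (hQ : IsDiffIdeal Q)
    (hAQ : ∀ c ∈ A, VanishesRegularly Q c) : VanishesRegularly Q g := by
  obtain ⟨u, hu, hgD | ⟨b, hb, w, hw, rfl, -, -⟩⟩ := hI.leader_of_mem_candidates hrk hA hg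
  · exact hAQ g (hI.subset hgD)
  · exact (hI.forward Q hQ hAQ b (mem_highest.mp hb).1).delta hrk hQ hw

lemma eq_top_of_rank_ne (hrk : IsRanking n) (hI : LoopInv A m D B) (hA : CallSpec A m)
    {g r : DPoly k n} (hg : g ∈ candidates m D B) (hrem : AlgRem (divisors D B g) g r)
    (hrank : rank r ≠ rank g) (hQ : IsDiffIdeal Q) (hAQ : ∀ c ∈ A, VanishesRegularly Q c) :
    Q = ⊤ := by
  obtain ⟨u, hu, -⟩ := hI.leader_of_mem_candidates hrk hA hg
  exact eq_top_of_rank_algRem_ne hu (fun d hd => hu ▸ hI.leader_divisor_ne hrk hA hg hd) hrem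
    hrank (fun d => hI.vanishesRegularly_divisors hrk hQ (hI.forward Q hQ hAQ))
    (hI.vanishesRegularly_candidate hrk hA hg hQ hAQ).2.1

end LoopInv

end Invariant

section FinsetErase

variable {α : Type*} [DecidableEq α] {s t : Finset α} {a b : α}

lemma card_add_card_le_insert_erase (hb : b ∉ s) :
    s.card + t.card ≤ (insert b s).card + (t.erase a).card := by
  have ht : t.card - 1 ≤ (t.erase a).card := Finset.pred_card_le_card_erase
  rw [Finset.card_insert_of_notMem hb]
  omega

lemma eq_or_mem_sdiff_of_mem_sdiff_erase (hb : b ∈ s \ t.erase a) : b = a ∨ b ∈ s \ t := by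
  grind

end FinsetErase

section Step

variable {k : Type*} [Field k] {n : ℕ} [LinearOrder (DVar n)] {B : Finset (DPoly k n)}
  {r : DPoly k n}

lemma lowest_subset_lowest_insert (hlt : ∀ b ∈ B, leader b < leader r) :
    lowest B ⊆ lowest (insert r B) := by
  intro b hb
  obtain ⟨hbB, hmin⟩ := mem_lowest.mp hb
  refine mem_lowest.mpr ⟨Finset.mem_insert_of_mem hbB, fun f hf hlv => ?_⟩
  rcases Finset.mem_insert.mp hf with rfl | hf
  · exact (rank_lt_of_leader_lt (hlt b hbB)).le
  · exact hmin f hf hlv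

lemma IsProlongation.mono {B' : Finset (DPoly k n)} {b c : DPoly k n} {w : DVar n} {i : ℕ}
    (h : IsProlongation B c b w i) (hB : B ⊆ B') : IsProlongation B' c b w i where
  leader_base := h.leader_base
  leader_eq := h.leader_eq
  degreeOf_eq := h.degreeOf_eq
  degreeOf_eq_one := h.degreeOf_eq_one
  exists_leader_eq j hj := (h.exists_leader_eq j hj).imp fun _ he => ⟨hB he.1, he.2⟩

variable [Differential k]

namespace LoopInv

variable {A : Finset (DPoly k n)} {m : Fin n → ℕ} {D : Finset (DPoly k n)}
  {g : DPoly k n} {u v : DVar n}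

lemma leader_lt (hI : LoopInv A m D B) (hg : g ∈ candidates m D B) (hr : leader r = leader g)
    {b : DPoly k n} (hb : b ∈ B) : leader b < leader r :=
  hr ▸ hI.lt_cand b hb g hg

lemma mem_vars_rem (hI : LoopInv A m D B) (hg : g ∈ candidates m D B)
    (hrem : AlgRem (divisors D B g) g r) (hv : v ∈ r.vars) :
    (∃ f ∈ A ∪ B, v ∈ f.vars) ∨
      g ∉ D ∧ ∃ a ∈ B, (delta k n a = g ∨ a ∈ lowest B) ∧ ∃ s ∈ a.vars, v = s.shift 1 := by
  have of_delta : g ∉ D → ∀ a ∈ B, (delta k n a = g ∨ a ∈ lowest B) → v ∈ (delta k n a).vars →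
      (∃ f ∈ A ∪ B, v ∈ f.vars) ∨
        g ∉ D ∧ ∃ a ∈ B, (delta k n a = g ∨ a ∈ lowest B) ∧ ∃ s ∈ a.vars, v = s.shift 1 :=
    fun hgD a ha hcase hva => (mem_vars_delta hva).imp
      (fun hva => ⟨a, Finset.mem_union_right _ ha, hva⟩) fun hs => ⟨hgD, a, ha, hcase, hs⟩
  rcases hrem.mem_vars hv with hvg | ⟨d, hd, hvd⟩
  · by_cases hgD : g ∈ D
    · exact Or.inl ⟨g, Finset.mem_union_left _ (hI.subset hgD), hvg⟩
    · obtain ⟨⟨a, ha, rfl⟩, -⟩ := (mem_candidates.mp hg).resolve_left hgD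
      exact of_delta hgD a (mem_highest.mp ha).1 (Or.inl rfl) hvg
  · rcases mem_divisors.mp hd with hd | ⟨hgD, -, a, ha, rfl⟩
    · exact Or.inl ⟨d, Finset.mem_union_right _ hd, hvd⟩
    · exact of_delta hgD a (lowest_subset B ha) (Or.inr ha) hvd

lemma ord_add_le_insert (hI : LoopInv A m D B) (hA : CallSpec A m) (hg : g ∈ candidates m D B)
    (hrB : r ∉ B) (hrem : AlgRem (divisors D B g) g r) {b : DPoly k n} (hb : b ∈ insert r B)
    (hv : v ∈ b.vars) (hvA : v.var ∉ lvSet A) :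
    v.ord + A.card ≤ m v.var + ((insert r B).card + (D.erase g).card) := by
  have hcard := card_add_card_le_insert_erase (t := D) (a := g) hrB
  have hB : ∀ d ∈ B, v ∈ d.vars →
      v.ord + A.card ≤ m v.var + ((insert r B).card + (D.erase g).card) := fun d hd hvd =>
    (hI.ord_add_le d hd v hvd hvA).trans (Nat.add_le_add_left hcard _)
  rcases Finset.mem_insert.mp hb with rfl | hb
  · rcases hI.mem_vars_rem hg hrem hv with ⟨f, hf, hvf⟩ | ⟨hgD, a, ha, -, s, hs, rfl⟩
    · rcases Finset.mem_union.mp hf with hf | hf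
      · exact Nat.add_le_add (hA.ord_le f hf v hvf) (hI.card_le.trans hcard)
      · exact hB f hf hvf
    · have hord := hI.ord_add_le a ha s hs hvA
      rw [Finset.card_insert_of_notMem hrB, Finset.erase_eq_of_notMem hgD]
      simp only [DVar.shift]
      omega
  · exact hB b hb hv

lemma exists_origin_insert_of_mem (hI : LoopInv A m D B) {b : DPoly k n} (hb : b ∈ B) :
    ∃ c ∈ A \ D.erase g, ∃ w i, IsProlongation (insert r B) c b w i := by
  obtain ⟨c, hc, w, i, hbc⟩ := hI.origin b hb
  exact ⟨c, Finset.sdiff_subset_sdiff subset_rfl (Finset.erase_subset g D) hc, w, i,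
    hbc.mono (Finset.subset_insert r B)⟩

lemma algReduced_insert (hI : LoopInv A m D B) (hg : g ∈ candidates m D B)
    (hr : leader r = leader g) (hrem : AlgRem (divisors D B g) g r) {b b' : DPoly k n}
    (hb : b ∈ insert r B) (hb' : b' ∈ insert r B) (hne : b ≠ b') : AlgReduced b b' := by
  rcases Finset.mem_insert.mp hb' with rfl | hb'B
  · have hlt := hI.leader_lt hg hr (Finset.mem_of_mem_insert_of_ne hb hne)
    intro v hv
    rw [notMem_vars_iff_degreeOf_eq_zero.mp (leader_lt_notMem_vars (hlt.trans_eq hv))]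
    exact Nat.pos_of_ne_zero (degreeOf_leader_ne_zero hv)
  · rcases Finset.mem_insert.mp hb with rfl | hb
    · exact hrem.2 b' (mem_divisors.mpr (Or.inl hb'B))
    · exact hI.algRed b hb b' hb'B hne

lemma exists_done_insert (hI : LoopInv A m D B) (hr : leader r = leader g) {c : DPoly k n}
    (hc : c ∈ A \ D.erase g) : ∃ b ∈ insert r B, leader b = leader c := by
  rcases eq_or_mem_sdiff_of_mem_sdiff_erase hc with rfl | hc
  · exact ⟨r, Finset.mem_insert_self r B, hr⟩
  · exact (hI.done c hc).imp fun b hb => ⟨Finset.mem_insert_of_mem hb.1, hb.2⟩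

lemma mem_lowest_insert_of_mem (hI : LoopInv A m D B) (hA : CallSpec A m) (hgD : g ∈ D)
    (hu : leader g = u) (hr : leader r = u) : r ∈ lowest (insert r B) := by
  refine mem_lowest.mpr ⟨Finset.mem_insert_self r B, fun b hb hlv => ?_⟩
  rcases Finset.mem_insert.mp hb with rfl | hb
  · exact le_rfl
  · obtain ⟨x, hx⟩ := hI.exists_leader hb
    rw [lv_of_leader hx, lv_of_leader hr, WithBot.coe_inj] at hlv
    exact absurd hgD
      (hI.exists_isProlongation_of_var_eq hA hb (hI.subset hgD) hx hu hlv.symm).1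

lemma rem_notMem (hI : LoopInv A m D B) (hg : g ∈ candidates m D B) (hr : leader r = leader g) :
    r ∉ B := fun hrB => (hI.leader_lt hg hr hrB).false

variable [CharZero k]

lemma leader_lt_of_mem_candidates_insert (hrk : IsRanking n) (hI : LoopInv A m D B)
    (hA : CallSpec A m) (hg : IsLeastRank (candidates m D B) g) (hr : leader r = leader g)
    {h : DPoly k n} (hh : h ∈ candidates m (D.erase g) (insert r B)) : leader r < leader h := by
  have of_ne : h ∈ candidates m D B → h ≠ g → leader r < leader h := fun hc hne =>
    hr ▸ (leader_le_of_rank_le (hg.2 h hc)).lt_of_ne fun heq =>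
      hne (hI.injOn_leader_candidates hrk hA hc hg.1 heq.symm)
  obtain ⟨u, hu, -⟩ := hI.leader_of_mem_candidates hrk hA hg.1
  have hru := hr.trans hu
  rcases mem_candidates.mp hh with hD | ⟨⟨b, hb, rfl⟩, hm⟩
  · obtain ⟨hne, hD⟩ := Finset.mem_erase.mp hD
    exact of_ne (mem_candidates.mpr (Or.inl hD)) hne
  obtain ⟨hb, hmax⟩ := mem_highest.mp hb
  rcases Finset.mem_insert.mp hb with rfl | hb
  · rw [leader_delta hrk hru, hru]
    exact WithBot.coe_lt_coe.mpr (hrk.lt_shift u)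
  refine of_ne (mem_candidates.mpr (Or.inr ⟨⟨b, mem_highest.mpr ⟨hb, fun x hx hlv =>
    hmax x (Finset.mem_insert_of_mem hx) hlv⟩, rfl⟩, hm⟩)) ?_
  rintro rfl
  obtain ⟨w, hw⟩ := hI.exists_leader hb
  have hrw := hr.trans (leader_delta hrk hw)
  have hle := leader_le_of_rank_le (hmax r (Finset.mem_insert_self r B) (by
    rw [lv_of_leader hrw, lv_of_leader hw, DVar.shift]))
  rw [hrw, hw, WithBot.coe_le_coe] at hle
  exact hle.not_gt (hrk.lt_shift w)

lemma degreeOf_shift_lt_one (hrk : IsRanking n) (hI : LoopInv A m D B) (hA : CallSpec A m)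
    (hu : leader g = u) (hrem : AlgRem (divisors D B g) g r) (hgD : g ∉ D) {s : DVar n}
    (hus : u ≠ s.shift 1) {e c : DPoly k n} (he : e ∈ B) (hc : c ∈ A)
    (hec : IsProlongation B c e s 0) : degreeOf (s.shift 1) r < 1 := by
  have hδe := leader_delta hrk hec.leader_eq
  have hne : delta k n e ≠ g := fun heq =>
    hus (WithBot.coe_injective (hu.symm.trans (heq ▸ hδe)))
  have hlow := (mem_lowest_iff hrk hI hA he hc hec).mpr rfl
  have hlt := hrem.2 _ (mem_divisors.mpr (Or.inr ⟨hgD, hne, e, hlow, rfl⟩)) _ hδe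
  rwa [degreeOf_delta hrk hec.leader_eq] at hlt

/- The element `e` of `B` with leader `s` is either linear in `s`, so that `a` does not involve `s`
unless `a = e`, or it belongs to `lowest B`, and then `δ e` is one of the divisors. -/
lemma shift_notMem_vars_rem (hrk : IsRanking n) (hI : LoopInv A m D B) (hA : CallSpec A m)
    (hg : IsLeastRank (candidates m D B) g) (hu : leader g = u) (hr : leader r = u)
    (hrem : AlgRem (divisors D B g) g r) (hgD : g ∉ D) {a : DPoly k n} (ha : a ∈ B)
    (hcase : delta k n a = g ∨ a ∈ lowest B) {s : DVar n} (hs : s ∈ a.vars)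
    (hsA : s.var ∈ lvSet A) (hsm : s.ord = m s.var) : s.shift 1 ∉ r.vars := by
  intro hsr
  have hsu : s < u := (hrk.lt_shift s).trans_le (le_of_leader hr hsr)
  have hus : u ≠ s.shift 1 := by
    rintro rfl
    have hle := ((mem_candidates.mp hg.1).resolve_left hgD).2 _ hu
    exact (Nat.lt_succ_self s.ord).not_ge (hle.trans_eq hsm.symm)
  obtain ⟨c, hc, w, hw, hvar⟩ := mem_lvSet.mp hsA
  have hword : w.ord ≤ s.ord := hsm ▸ hvar ▸ hA.ord_le c hc w (mem_vars_of_leader hw)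
  obtain ⟨i, rfl⟩ : ∃ i, s = w.shift i :=
    ⟨s.ord - w.ord, DVar.ext hvar.symm (Nat.add_sub_of_le hword).symm⟩
  obtain ⟨e, he, hec⟩ := hI.exists_isProlongation hrk hA hc hw hsm.le fun h hh j hj heq => by
    have hle := leader_le_of_rank_le (hg.2 h hh)
    rw [hu, heq, WithBot.coe_le_coe] at hle
    have hjs : w.shift j ≤ w.shift i :=
      (hrk.le_iff_ord_le (u := w.shift j) (v := w.shift i) rfl).mpr (Nat.add_le_add_left hj _)
    exact (hle.trans hjs).not_gt hsu
  rcases i.eq_zero_or_pos with rfl | hi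
  · have hlt := hI.degreeOf_shift_lt_one hrk hA hu hrem hgD hus he hc hec
    rw [mem_vars_iff_degreeOf_ne_zero] at hsr
    exact hsr (Nat.lt_one_iff.mp hlt)
  · have hae : a ≠ e := by
      rintro rfl
      rcases hcase with rfl | hlow
      · exact hus (WithBot.coe_injective (hu.symm.trans (leader_delta hrk hec.leader_eq)))
      · exact hi.ne' ((mem_lowest_iff hrk hI hA he hc hec).mp hlow)
    have hlt := hI.algRed a ha e he hae _ hec.leader_eq
    rw [hec.degreeOf_eq_one hi, Nat.lt_one_iff] at hlt
    exact mem_vars_iff_degreeOf_ne_zero.mp hs hlt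

lemma ord_le_insert (hrk : IsRanking n) (hI : LoopInv A m D B) (hA : CallSpec A m)
    (hg : IsLeastRank (candidates m D B) g) (hu : leader g = u) (hr : leader r = u)
    (hrem : AlgRem (divisors D B g) g r) {b : DPoly k n} (hb : b ∈ insert r B) (hv : v ∈ b.vars)
    (hvA : v.var ∈ lvSet A) : v.ord ≤ m v.var := by
  rcases Finset.mem_insert.mp hb with rfl | hb
  · rcases hI.mem_vars_rem hg.1 hrem hv with ⟨f, hf, hvf⟩ | ⟨hgD, a, ha, hcase, s, hs, rfl⟩
    · rcases Finset.mem_union.mp hf with hf | hf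
      · exact hA.ord_le f hf v hvf
      · exact hI.ord_le f hf v hvf hvA
    · refine Nat.succ_le_of_lt ((hI.ord_le a ha s hs hvA).lt_of_ne fun hsm => ?_)
      exact hI.shift_notMem_vars_rem hrk hA hg hu hr hrem hgD ha hcase hs hvA hsm hv
  · exact hI.ord_le b hb v hv hvA

lemma exists_origin_insert (hrk : IsRanking n) (hI : LoopInv A m D B) (hA : CallSpec A m)
    (hg : g ∈ candidates m D B) (hrank : rank r = rank g) {b : DPoly k n}
    (hb : b ∈ insert r B) :
    ∃ c ∈ A \ D.erase g, ∃ w i, IsProlongation (insert r B) c b w i := by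
  rcases Finset.mem_insert.mp hb with rfl | hb
  swap
  · exact hI.exists_origin_insert_of_mem hb
  obtain ⟨u, hu, hcase⟩ := hI.leader_of_mem_candidates hrk hA hg
  obtain ⟨hr, hdeg⟩ := (rank_eq_iff_of_leader hu).mp hrank
  rcases hcase with hgD | ⟨a, ha, x, hx, rfl, rfl, -⟩
  · refine ⟨g, Finset.mem_sdiff.mpr ⟨hI.subset hgD, Finset.notMem_erase g D⟩, u, 0, hu, hr,
      fun _ => hdeg, fun h => absurd h (lt_irrefl 0), fun j hj => ⟨b, hb, ?_⟩⟩
    rw [Nat.le_zero.mp hj]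
    exact hr
  · obtain ⟨c, hc, w, i, hac⟩ :=
      hI.exists_origin_insert_of_mem (g := delta k n a) (r := b) (mem_highest.mp ha).1
    obtain rfl : w.shift i = x := WithBot.coe_injective (hac.leader_eq.symm.trans hx)
    refine ⟨c, hc, w, i + 1, hac.leader_base, hr, fun h => absurd h i.succ_ne_zero,
      fun _ => hdeg.trans (degreeOf_delta hrk hx), fun j hj => ?_⟩
    rcases Nat.le_succ_iff.mp hj with hj | rfl
    · exact hac.exists_leader_eq j hj
    · exact ⟨b, hb, hr⟩

variable {Q : Ideal (DPoly k n)}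

lemma vanishesRegularly_rem_iff (hrk : IsRanking n) (hI : LoopInv A m D B) (hA : CallSpec A m)
    (hg : g ∈ candidates m D B) (hrem : AlgRem (divisors D B g) g r) (hrank : rank r = rank g)
    (hQ : IsDiffIdeal Q) (hB : ∀ b ∈ B, VanishesRegularly Q b) :
    VanishesRegularly Q r ↔ VanishesRegularly Q g := by
  obtain ⟨u, hu, -⟩ := hI.leader_of_mem_candidates hrk hA hg
  exact vanishesRegularly_algRem_iff hu (fun d hd => hu ▸ hI.leader_divisor_ne hrk hA hg hd) hrem
    hrank fun d => hI.vanishesRegularly_divisors hrk hQ hB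

lemma forward_insert (hrk : IsRanking n) (hI : LoopInv A m D B) (hA : CallSpec A m)
    (hg : g ∈ candidates m D B) (hrem : AlgRem (divisors D B g) g r) (hrank : rank r = rank g)
    (hQ : IsDiffIdeal Q) (hAQ : ∀ c ∈ A, VanishesRegularly Q c) :
    ∀ b ∈ insert r B, VanishesRegularly Q b := by
  have hB := hI.forward Q hQ hAQ
  refine Finset.forall_mem_insert .. |>.mpr ⟨?_, hB⟩
  exact (hI.vanishesRegularly_rem_iff hrk hA hg hrem hrank hQ hB).mpr
    (hI.vanishesRegularly_candidate hrk hA hg hQ hAQ)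

lemma backward_insert (hrk : IsRanking n) (hI : LoopInv A m D B) (hA : CallSpec A m)
    (hg : g ∈ candidates m D B) (hrem : AlgRem (divisors D B g) g r) (hrank : rank r = rank g)
    (hQ : IsDiffIdeal Q) (hlow : ∀ b ∈ lowest (insert r B), b ∈ Q)
    (hH : ∀ h ∈ inisep (insert r B), h ∈ regularMod Q) :
    (∀ b ∈ insert r B, b ∈ Q) ∧ ∀ c ∈ A \ D.erase g, VanishesRegularly Q c := by
  obtain ⟨u, hu, hcase⟩ := hI.leader_of_mem_candidates hrk hA hg
  have hr := leader_eq_of_rank_eq hrank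
  have hlowest := lowest_subset_lowest_insert fun b => hI.leader_lt hg hr (b := b)
  obtain ⟨hBQ, hAQ⟩ := hI.backward Q hQ (fun b hb => hlow b (hlowest hb))
    fun h hh => hH h (inisep_mono (Finset.subset_insert r B) hh)
  have regular : ∀ b ∈ insert r B, b ∈ Q → VanishesRegularly Q b := fun b hb hbQ =>
    ⟨hbQ, hH _ (initial_mem_inisep hb), hH _ (separant_mem_inisep hb)⟩
  have hB : ∀ b ∈ B, VanishesRegularly Q b := fun b hb =>
    regular b (Finset.mem_insert_of_mem hb) (hBQ b hb)
  have hrg := hI.vanishesRegularly_rem_iff hrk hA hg hrem hrank hQ hB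
  have hrQ : r ∈ Q := by
    rcases hcase with hgD | ⟨a, ha, x, hx, rfl, -, -⟩
    · exact hlow r (hI.mem_lowest_insert_of_mem hA hgD hu (hr.trans hu))
    · exact (hrg.mpr ((hB a (mem_highest.mp ha).1).delta hrk hQ hx)).1
  refine ⟨Finset.forall_mem_insert .. |>.mpr ⟨hrQ, hBQ⟩, fun c hc => ?_⟩
  rcases eq_or_mem_sdiff_of_mem_sdiff_erase hc with rfl | hc
  · exact hrg.mp (regular r (Finset.mem_insert_self r B) hrQ)
  · exact hAQ c hc

theorem insert_rem (hrk : IsRanking n) (hI : LoopInv A m D B) (hA : CallSpec A m)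
    (hg : IsLeastRank (candidates m D B) g) (hrem : AlgRem (divisors D B g) g r)
    (hrank : rank r = rank g) : LoopInv A m (D.erase g) (insert r B) := by
  obtain ⟨u, hu, -⟩ := hI.leader_of_mem_candidates hrk hA hg.1
  have hrg := leader_eq_of_rank_eq hrank
  have hrB := hI.rem_notMem hg.1 hrg
  exact {
    subset := (Finset.erase_subset g D).trans hI.subset
    inj := by
      rw [Finset.coe_insert, Set.injOn_insert hrB]
      refine ⟨hI.inj, ?_⟩
      rintro ⟨b, hb, hbr⟩
      exact (hI.leader_lt hg.1 hrg hb).ne hbr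
    lt_cand := fun b hb h hh => by
      have hlt := hI.leader_lt_of_mem_candidates_insert hrk hA hg hrg hh
      rcases Finset.mem_insert.mp hb with rfl | hb
      · exact hlt
      · exact (hI.leader_lt hg.1 hrg hb).trans hlt
    algRed := fun _ hb _ => hI.algReduced_insert hg.1 hrg hrem hb
    origin := fun _ => hI.exists_origin_insert hrk hA hg.1 hrank
    done := fun _ => hI.exists_done_insert hrg
    ord_le := fun _ hb _ => hI.ord_le_insert hrk hA hg hu (hrg.trans hu) hrem hb
    card_le := hI.card_le.trans (card_add_card_le_insert_erase hrB)
    ord_add_le := fun _ hb _ => hI.ord_add_le_insert hA hg.1 hrB hrem hb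
    forward := fun _ => hI.forward_insert hrk hA hg.1 hrem hrank
    backward := fun _ => hI.backward_insert hrk hA hg.1 hrem hrank }

end LoopInv

end Step

/-! ## The result of Differentiate&Autoreduce -/

section MaxOrd

variable {k : Type*} [Field k] {n : ℕ}

lemma maxOrd_le_iff {F : Finset (DPoly k n)} {y : Fin n} {c : ℕ} :
    maxOrd F y ≤ c ↔ ∀ f ∈ F, ∀ v ∈ f.vars, v.var = y → v.ord ≤ c := by
  simp only [maxOrd, Finset.sup_le_iff, Finset.mem_filter, and_imp]

lemma ord_le_maxOrd {F : Finset (DPoly k n)} {f : DPoly k n} (hf : f ∈ F) {v : DVar n}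
    (hv : v ∈ f.vars) : v.ord ≤ maxOrd F v.var :=
  maxOrd_le_iff.mp le_rfl f hf v hv rfl

end MaxOrd

section Result

variable {k : Type*} [Field k] {n : ℕ} [LinearOrder (DVar n)]

lemma card_lvSet_le (A : Finset (DPoly k n)) : (lvSet A).card ≤ A.card := by
  have himage : (lvSet A).image WithBot.some ⊆ A.image lv := by
    intro z hz
    obtain ⟨y, hy, rfl⟩ := Finset.mem_image.mp hz
    obtain ⟨f, hf, u, hu, rfl⟩ := mem_lvSet.mp hy
    exact Finset.mem_image.mpr ⟨f, hf, lv_of_leader hu⟩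
  rw [← Finset.card_image_of_injective (lvSet A) WithBot.coe_injective]
  exact (Finset.card_le_card himage).trans Finset.card_image_le

lemma algReduced_of_mem_inisep {B : Finset (DPoly k n)}
    (hB : ∀ b ∈ B, ∀ b' ∈ B, b ≠ b' → AlgReduced b b') {e h : DPoly k n} (he : e ∈ B)
    (hh : h ∈ inisep B) : AlgReduced h e := by
  intro u hu
  obtain ⟨b, hb, hhb⟩ := mem_inisep.mp hh
  by_cases hbe : b = e
  · subst hbe
    rcases hhb with rfl | rfl
    · exact degreeOf_initial_lt hu
    · exact degreeOf_separant_lt hu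
  · refine lt_of_le_of_lt ?_ (hB b hb e he hbe u hu)
    rcases hhb with rfl | rfl
    · exact degreeOf_initial_le b u
    · exact degreeOf_separant_le b u

lemma CallSpec.exists_leader_ord {A : Finset (DPoly k n)} {m : Fin n → ℕ} (hA : CallSpec A m) :
    ∃ a : Fin n → ℕ, ∀ c ∈ A, ∀ w : DVar n, leader c = w → a w.var = w.ord := by
  have exists_ord : ∀ y : Fin n, ∃ j : ℕ,
      ∀ c ∈ A, ∀ w : DVar n, leader c = w → w.var = y → j = w.ord := by
    intro y
    by_cases hy : ∃ c ∈ A, ∃ w : DVar n, leader c = w ∧ w.var = y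
    · obtain ⟨c, hc, w, hw, rfl⟩ := hy
      refine ⟨w.ord, fun c' hc' w' hw' hvar => ?_⟩
      obtain rfl : c' = c :=
        hA.lvInj hc' hc (by rw [lv_of_leader hw, lv_of_leader hw', hvar])
      rw [WithBot.coe_injective (hw.symm.trans hw')]
    · exact ⟨0, fun c hc w hw hvar => absurd ⟨c, hc, w, hw, hvar⟩ hy⟩
  choose a ha using exists_ord
  exact ⟨a, fun c hc w hw => ha _ c hc w hw rfl⟩

/-- The polynomials that occur in a system formed by RGBound from the result `B` of
Differentiate&Autoreduce: remainders of polynomials `g` whose orders obey the bounds `m`, elements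
of `B⁰`, and initials and separants of elements of `B`. -/
inductive IsResultPoly (m : Fin n → ℕ) (B : Finset (DPoly k n)) (x : DPoly k n) : Prop
  | ofRem (g : DPoly k n) (hg : ∀ v ∈ g.vars, v.ord ≤ m v.var) (hrem : AlgRem B g x)
  | ofLowest (hx : x ∈ lowest B)
  | ofInisep (hx : x ∈ inisep B)

lemma IsResultPoly.ord_le_or_exists_mem_vars {m : Fin n → ℕ} {B : Finset (DPoly k n)}
    {x : DPoly k n} (hx : IsResultPoly m B x) {v : DVar n} (hv : v ∈ x.vars) :
    v.ord ≤ m v.var ∨ ∃ b ∈ B, v ∈ b.vars := by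
  cases hx with
  | ofRem g hg hrem => exact (hrem.mem_vars hv).imp_left (hg v)
  | ofLowest hx => exact Or.inr ⟨x, lowest_subset B hx, hv⟩
  | ofInisep hx =>
    obtain ⟨b, hb, hxb⟩ := exists_vars_subset_of_mem_inisep hx
    exact Or.inr ⟨b, hb, hxb hv⟩

lemma IsResultPoly.algReduced {m : Fin n → ℕ} {B : Finset (DPoly k n)} {x e : DPoly k n}
    (hx : IsResultPoly m B x) (hB : ∀ b ∈ B, ∀ b' ∈ B, b ≠ b' → AlgReduced b b') (he : e ∈ B)
    (hlow : e ∉ lowest B) : AlgReduced x e := by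
  cases hx with
  | ofRem g hg hrem => exact hrem.2 e he
  | ofLowest hx => exact hB x (lowest_subset B hx) e he fun hxe => hlow (hxe ▸ hx)
  | ofInisep hx => exact algReduced_of_mem_inisep hB he hx

variable [Differential k]

lemma eq_empty_of_candidates_eq_empty {m : Fin n → ℕ} {D B : Finset (DPoly k n)}
    (hdone : candidates m D B = ∅) : D = ∅ :=
  Finset.subset_empty.mp (hdone ▸ Finset.subset_union_left)

namespace LoopInv

variable {A : Finset (DPoly k n)} {m : Fin n → ℕ} {D B : Finset (DPoly k n)}

lemma exists_lowest (hrk : IsRanking n) (hI : LoopInv A m D B) (hA : CallSpec A m)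
    {c : DPoly k n} (hc : c ∈ A \ D) : ∃ b ∈ lowest B, rank b = rank c := by
  have hcA := (Finset.mem_sdiff.mp hc).1
  obtain ⟨w, hw⟩ := exists_leader_eq_coe (hA.nonconst c hcA)
  obtain ⟨b, hb, hbc⟩ := hI.done c hc
  have hbase := hI.isProlongation_of_leader_eq (i := 0) hA hb hcA hw (hbc.trans hw)
  exact ⟨b, (hI.mem_lowest_iff hrk hA hb hcA hbase).mpr rfl,
    (rank_eq_iff_of_leader hw).mpr ⟨hbc.trans hw, hbase.degreeOf_eq rfl⟩⟩

lemma exists_leader_eq_of_mem_lowest (hrk : IsRanking n) (hI : LoopInv A m D B)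
    (hA : CallSpec A m) {b : DPoly k n} (hb : b ∈ lowest B) : ∃ c ∈ A \ D, leader b = leader c := by
  have hbB := lowest_subset B hb
  obtain ⟨c, hc, w, i, hbc⟩ := hI.origin b hbB
  obtain rfl := (hI.mem_lowest_iff hrk hA hbB (Finset.mem_sdiff.mp hc).1 hbc).mp hb
  exact ⟨c, hc, hbc.leader_eq.trans hbc.leader_base.symm⟩

lemma notMem_constants (hI : LoopInv A m D B) {b : DPoly k n} (hb : b ∈ B) :
    b ∉ constants k n := by
  obtain ⟨u, hu⟩ := hI.exists_leader hb
  exact notMem_constants_of_leader hu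

lemma injOn_lv_lowest (hI : LoopInv A m D B) :
    Set.InjOn (lv : DPoly k n → WithBot (Fin n)) (lowest B) := by
  intro b hb b' hb' hlv
  obtain ⟨hbB, hbmin⟩ := mem_lowest.mp hb
  obtain ⟨hbB', hbmin'⟩ := mem_lowest.mp hb'
  exact hI.inj hbB hbB' ((leader_le_of_rank_le (hbmin b' hbB' hlv.symm)).antisymm
    (leader_le_of_rank_le (hbmin' b hbB hlv)))

lemma lvSet_lowest (hrk : IsRanking n) (hI : LoopInv A m ∅ B) (hA : CallSpec A m) :
    lvSet (lowest B) = lvSet A := by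
  ext y
  rw [mem_lvSet, mem_lvSet]
  constructor
  · rintro ⟨b, hb, u, hu, rfl⟩
    obtain ⟨c, hc, hbc⟩ := hI.exists_leader_eq_of_mem_lowest hrk hA hb
    exact ⟨c, (Finset.mem_sdiff.mp hc).1, u, hbc.symm.trans hu, rfl⟩
  · rintro ⟨c, hc, w, hw, rfl⟩
    obtain ⟨b, hb, hbc⟩ := hI.exists_lowest hrk hA (by rwa [Finset.sdiff_empty])
    exact ⟨b, hb, w, ((rank_eq_iff_of_leader hw).mp hbc).1, rfl⟩

lemma rankFamily_lowest_le (hrk : IsRanking n) (hI : LoopInv A m D B) (hA : CallSpec A m)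
    {c : DPoly k n} (hc : c ∈ A \ D) {y : Fin n} (hy : lv c = y) :
    rankFamily (lowest B) y ≤ (rank c : WithTop (WithBot (DVar n ×ₗ ℕ))) := by
  obtain ⟨b, hb, hbc⟩ := hI.exists_lowest hrk hA hc
  obtain ⟨w, hw, rfl⟩ := lv_eq_coe_iff.mp hy
  rw [← hbc]
  exact minRank_le (Finset.mem_filter.mpr
    ⟨hb, lv_of_leader ((rank_eq_iff_of_leader hw).mp hbc).1⟩)

lemma card_le_sum (hI : LoopInv A m D B) (hA : CallSpec A m) {a : Fin n → ℕ}
    (ha : ∀ c ∈ A, ∀ w : DVar n, leader c = w → a w.var = w.ord) :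
    B.card ≤ ∑ y ∈ lvSet A, (m y + 1 - a y) := by
  choose φ hφ using fun b : B => hI.exists_leader b.2
  have hcard : B.attach.card ≤ ((lvSet A).sigma fun y => Finset.Icc (a y) (m y)).card := by
    refine Finset.card_le_card_of_injOn (fun b => ⟨(φ b).var, (φ b).ord⟩) ?_ ?_
    · intro b _
      have hmem := hI.var_mem_lvSet b.2 (hφ b)
      obtain ⟨c, hc, w, hw, hvar⟩ := mem_lvSet.mp hmem
      obtain ⟨-, i, hi, -⟩ := hI.exists_isProlongation_of_var_eq hA b.2 hc (hφ b) hw hvar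
      rw [Finset.mem_coe, Finset.mem_sigma, Finset.mem_Icc]
      refine ⟨hmem, ?_, hI.ord_le b.1 b.2 _ (mem_vars_of_leader (hφ b)) hmem⟩
      calc a (φ b).var = w.ord := by rw [← hvar, ha c hc w hw]
        _ ≤ (φ b).ord := by rw [hi, DVar.shift]; exact Nat.le_add_right _ _
    · intro b _ b' _ heq
      simp only [Sigma.mk.injEq] at heq
      refine Subtype.ext (hI.inj b.2 b'.2 ?_)
      rw [hφ b, hφ b', DVar.ext heq.1 (eq_of_heq heq.2)]
  simpa only [Finset.card_attach, Finset.card_sigma, Nat.card_Icc] using hcard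

lemma card_le_sum_succ (hI : LoopInv A m D B) (hA : CallSpec A m) :
    B.card ≤ ∑ y, (m y + 1) := by
  obtain ⟨a, ha⟩ := hA.exists_leader_ord
  calc B.card ≤ ∑ y ∈ lvSet A, (m y + 1 - a y) := hI.card_le_sum hA ha
    _ ≤ ∑ y ∈ lvSet A, (m y + 1) := Finset.sum_le_sum fun _ _ => Nat.sub_le _ _
    _ ≤ ∑ y, (m y + 1) := Finset.sum_le_sum_of_subset (Finset.subset_univ _)

lemma ord_add_card_le_of_isResultPoly (hI : LoopInv A m ∅ B) {x : DPoly k n}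
    (hx : IsResultPoly m B x) {v : DVar n} (hv : v ∈ x.vars) (hvA : v.var ∉ lvSet A) :
    v.ord + A.card ≤ m v.var + B.card := by
  rcases hx.ord_le_or_exists_mem_vars hv with hvm | ⟨b, hb, hvb⟩
  · exact add_le_add hvm hI.card_le
  · exact hI.ord_add_le b hb v hvb hvA

variable [CharZero k]

-- If `v` were a proper derivative of the leader of `c`, then `B` would contain an element which is
-- linear in `v`, so `v` could not occur in an algebraically reduced polynomial.
lemma ord_le_of_algReduced (hrk : IsRanking n) (hI : LoopInv A m D B) (hA : CallSpec A m)
    (hdone : candidates m D B = ∅) {x : DPoly k n}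
    (hred : ∀ e ∈ B, e ∉ lowest B → AlgReduced x e) {c : DPoly k n} (hc : c ∈ A) {w v : DVar n}
    (hw : leader c = w) (hv : v ∈ x.vars) (hvm : v.ord ≤ m v.var) (hvar : v.var = w.var) :
    v.ord ≤ w.ord := by
  by_contra! hlt
  obtain ⟨i, hi⟩ := Nat.exists_eq_add_of_lt hlt
  obtain rfl : v = w.shift (i + 1) := DVar.ext hvar hi
  obtain ⟨e, he, hce⟩ := hI.exists_isProlongation hrk hA hc hw hvm (by simp [hdone])
  have hlow : e ∉ lowest B :=
    fun h => Nat.succ_ne_zero i ((hI.mem_lowest_iff hrk hA he hc hce).mp h)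
  have hdeg := hred e he hlow _ hce.leader_eq
  rw [hce.degreeOf_eq_one (Nat.succ_pos i), Nat.lt_one_iff] at hdeg
  exact notMem_vars_iff_degreeOf_eq_zero.mpr hdeg hv

lemma ord_le_of_isResultPoly (hrk : IsRanking n) (hI : LoopInv A m D B) (hA : CallSpec A m)
    (hdone : candidates m D B = ∅) {x c : DPoly k n} (hx : IsResultPoly m B x) (hc : c ∈ A)
    {w v : DVar n} (hw : leader c = w) (hv : v ∈ x.vars) (hvar : v.var = w.var) :
    v.ord ≤ w.ord := by
  refine hI.ord_le_of_algReduced hrk hA hdone (fun e => hx.algReduced hI.algRed) hc hw hv ?_ hvar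
  rcases hx.ord_le_or_exists_mem_vars hv with hvm | ⟨b, hb, hvb⟩
  · exact hvm
  · exact hI.ord_le b hb v hvb (mem_lvSet.mpr ⟨c, hc, w, hw, hvar.symm⟩)

lemma partiallyReduced_of_isResultPoly (hrk : IsRanking n) (hI : LoopInv A m D B)
    (hA : CallSpec A m) (hdone : candidates m D B = ∅) {x b : DPoly k n}
    (hx : IsResultPoly m B x) (hb : b ∈ lowest B) : PartiallyReduced x b := by
  rintro u hu v hv ⟨hvar, hlt⟩
  obtain ⟨c, hc, hbc⟩ := hI.exists_leader_eq_of_mem_lowest hrk hA hb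
  exact hlt.not_ge (hI.ord_le_of_isResultPoly hrk hA hdone hx (Finset.mem_sdiff.mp hc).1
    (hbc.symm.trans hu) hv hvar)

lemma maxOrd_le_of_isResultPoly (hrk : IsRanking n) (hI : LoopInv A m D B) (hA : CallSpec A m)
    (hdone : candidates m D B = ∅) {X : Finset (DPoly k n)} (hX : ∀ x ∈ X, IsResultPoly m B x) :
    ∃ a : Fin n → ℕ, (∀ y ∈ lvSet A, a y ≤ m y) ∧ (∀ y ∈ lvSet A, maxOrd X y ≤ a y) ∧
      ∀ y ∉ lvSet A, maxOrd X y ≤ m y + ∑ z ∈ lvSet A, (m z - a z) := by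
  obtain rfl := eq_empty_of_candidates_eq_empty hdone
  obtain ⟨a, ha⟩ := hA.exists_leader_ord
  have ham : ∀ y ∈ lvSet A, a y ≤ m y := by
    intro y hy
    obtain ⟨c, hc, w, hw, rfl⟩ := mem_lvSet.mp hy
    rw [ha c hc w hw]
    exact hA.ord_le c hc w (mem_vars_of_leader hw)
  refine ⟨a, ham, fun y hy => maxOrd_le_iff.mpr fun x hx v hv hvy => ?_,
    fun y hy => maxOrd_le_iff.mpr fun x hx v hv hvy => ?_⟩
  · obtain ⟨c, hc, w, hw, rfl⟩ := mem_lvSet.mp hy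
    rw [ha c hc w hw]
    exact hI.ord_le_of_isResultPoly hrk hA hdone (hX x hx) hc hw hv hvy
  · subst hvy
    have hord := hI.ord_add_card_le_of_isResultPoly (hX x hx) hv hy
    have hB : B.card ≤ ∑ y ∈ lvSet A, (m y - a y) + (lvSet A).card := by
      refine (hI.card_le_sum hA ha).trans_eq ?_
      rw [Finset.card_eq_sum_ones, ← Finset.sum_add_distrib]
      exact Finset.sum_congr rfl fun y hy => Nat.sub_add_comm (ham y hy)
    have hcard := card_lvSet_le A
    lia

end LoopInv

end Result

/-! ## Bounds for orders -/

section Bounds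

variable {k : Type*} [Field k] {n : ℕ}

/-- The bound of the Proposition for a system with the set `Z` of leading variables, `X` being the
set of all its elements. The falling factorial is `(n - 1)(n - 2) ⋯ (n - |Z|)`. -/
def OrderBound (M : ℕ) (Z : Finset (Fin n)) (X : Finset (DPoly k n)) : Prop :=
  sumOrd X ≤ (n - 1).factorial * M ∧
    (Z.card < n → weightedOrd Z X ≤ (n - 1).descFactorial Z.card * M)

lemma descFactorial_sub_one_eq_prod_range (n l : ℕ) :
    (n - 1).descFactorial l = ∏ i ∈ Finset.range l, (n - (i + 1)) := by
  rw [Nat.descFactorial_eq_prod_range]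
  exact Finset.prod_congr rfl fun i _ => by lia

lemma sumOrd_le_weightedOrd {Z : Finset (Fin n)} (hZ : Z.card < n) (X : Finset (DPoly k n)) :
    sumOrd X ≤ weightedOrd Z X := by
  rw [sumOrd, ← Finset.sum_add_sum_compl Z, weightedOrd]
  gcongr
  exact Nat.le_mul_of_pos_left _ (Nat.sub_pos_of_lt hZ)

lemma weightedOrd_insert_le {Z : Finset (Fin n)} {y : Fin n} (hy : y ∉ Z) (hZ : Z.card + 1 < n)
    (X : Finset (DPoly k n)) :
    weightedOrd (insert y Z) X ≤ (n - 1 - Z.card) * weightedOrd Z X := by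
  have hcompl : ∑ z ∈ Zᶜ, maxOrd X z = maxOrd X y + ∑ z ∈ (insert y Z)ᶜ, maxOrd X z := by
    rw [Finset.compl_insert, Finset.add_sum_erase _ _ (Finset.mem_compl.mpr hy)]
  obtain ⟨p, hp⟩ : ∃ p, n = Z.card + p + 2 := Nat.exists_eq_add_of_le hZ |>.imp (by lia)
  rw [weightedOrd, weightedOrd, Finset.card_insert_of_notMem hy, Finset.sum_insert hy, hcompl,
    show n - (Z.card + 1) = p + 1 by lia, show n - 1 - Z.card = p + 1 by lia,
    show n - Z.card = p + 2 by lia]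
  nlinarith [Nat.zero_le (p * ∑ z ∈ (insert y Z)ᶜ, maxOrd X z), Nat.zero_le (∑ z ∈ Z, maxOrd X z),
    Nat.zero_le (p * ∑ z ∈ Z, maxOrd X z), Nat.zero_le (p * p * ∑ z ∈ Z, maxOrd X z)]

-- The growth of the orders of the variables outside `Z` is paid for by the decrease of the orders
-- of the variables in `Z`, which have the weight `n - |Z|`, the number of variables outside `Z`.
lemma weightedOrd_le_of_maxOrd_le {Z : Finset (Fin n)} {X X' : Finset (DPoly k n)}
    {a : Fin n → ℕ} (ha : ∀ y ∈ Z, a y ≤ maxOrd X y) (hin : ∀ y ∈ Z, maxOrd X' y ≤ a y)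
    (hout : ∀ y ∉ Z, maxOrd X' y ≤ maxOrd X y + ∑ z ∈ Z, (maxOrd X z - a z)) :
    weightedOrd Z X' ≤ weightedOrd Z X := by
  have hcompl : ∑ z ∈ Zᶜ, maxOrd X' z ≤
      ∑ z ∈ Zᶜ, maxOrd X z + (n - Z.card) * ∑ z ∈ Z, (maxOrd X z - a z) := by
    have hcard : n - Z.card = Zᶜ.card := by rw [Finset.card_compl, Fintype.card_fin]
    rw [hcard, ← smul_eq_mul, ← Finset.sum_const, ← Finset.sum_add_distrib]
    exact Finset.sum_le_sum fun z hz => hout z (Finset.mem_compl.mp hz)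
  have hsum : ∑ z ∈ Z, maxOrd X z = ∑ z ∈ Z, a z + ∑ z ∈ Z, (maxOrd X z - a z) := by
    rw [← Finset.sum_add_distrib]
    exact Finset.sum_congr rfl fun z hz => (Nat.add_sub_of_le (ha z hz)).symm
  calc weightedOrd Z X'
      ≤ (n - Z.card) * ∑ z ∈ Z, a z +
          (∑ z ∈ Zᶜ, maxOrd X z + (n - Z.card) * ∑ z ∈ Z, (maxOrd X z - a z)) :=
        add_le_add (Nat.mul_le_mul_left _ (Finset.sum_le_sum hin)) hcompl
    _ = weightedOrd Z X := by rw [weightedOrd, hsum]; ring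

namespace OrderBound

variable {M : ℕ} {Z : Finset (Fin n)} {X : Finset (DPoly k n)}

lemma of_weightedOrd_le
    (hweighted : Z.card < n → weightedOrd Z X ≤ (n - 1).descFactorial Z.card * M)
    (hsum : Z.card = n → sumOrd X ≤ (n - 1).factorial * M) : OrderBound M Z X := by
  refine ⟨?_, hweighted⟩
  have hle : Z.card ≤ n := (Finset.card_le_univ Z).trans_eq (Fintype.card_fin n)
  rcases hle.lt_or_eq with hlt | heq
  · have hl : Z.card ≤ n - 1 := Nat.le_sub_one_of_lt hlt
    calc sumOrd X ≤ weightedOrd Z X := sumOrd_le_weightedOrd hlt X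
      _ ≤ (n - 1).descFactorial Z.card * M := hweighted hlt
      _ ≤ (n - 1).factorial * M := by
        gcongr
        rw [← Nat.factorial_mul_descFactorial hl]
        exact Nat.le_mul_of_pos_left _ (Nat.factorial_pos _)
  · exact hsum heq

lemma weightedOrd_insert_le (h : OrderBound M Z X) (y : Fin n) (hlt : (insert y Z).card < n) :
    weightedOrd (insert y Z) X ≤ (n - 1).descFactorial (insert y Z).card * M := by
  by_cases hy : y ∈ Z
  · rw [Finset.insert_eq_of_mem hy] at hlt ⊢
    exact h.2 hlt
  · rw [Finset.card_insert_of_notMem hy] at hlt ⊢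
    calc weightedOrd (insert y Z) X
        ≤ (n - 1 - Z.card) * weightedOrd Z X := RG.weightedOrd_insert_le hy hlt X
      _ ≤ (n - 1 - Z.card) * ((n - 1).descFactorial Z.card * M) :=
        Nat.mul_le_mul_left _ (h.2 (Nat.lt_of_succ_lt hlt))
      _ = (n - 1).descFactorial (Z.card + 1) * M := by rw [Nat.descFactorial_succ, mul_assoc]

lemma of_maxOrd_le (h : OrderBound M Z X) {X' : Finset (DPoly k n)} {y : Fin n} {a : Fin n → ℕ}
    (ha : ∀ z ∈ insert y Z, a z ≤ maxOrd X z) (hin : ∀ z ∈ insert y Z, maxOrd X' z ≤ a z)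
    (hout : ∀ x ∉ insert y Z,
      maxOrd X' x ≤ maxOrd X x + ∑ z ∈ insert y Z, (maxOrd X z - a z)) :
    OrderBound M (insert y Z) X' := by
  refine of_weightedOrd_le (fun hlt => ?_) fun heq => ?_
  · exact (weightedOrd_le_of_maxOrd_le ha hin hout).trans (h.weightedOrd_insert_le y hlt)
  · have huniv : insert y Z = Finset.univ := by
      rw [← Finset.card_eq_iff_eq_univ, heq, Fintype.card_fin]
    refine (Finset.sum_le_sum fun z _ => ?_).trans h.1
    have hz : z ∈ insert y Z := huniv ▸ Finset.mem_univ z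
    exact (hin z hz).trans (ha z hz)

lemma mono (h : OrderBound M Z X) {X' : Finset (DPoly k n)}
    (hle : ∀ y, maxOrd X' y ≤ maxOrd X y) : OrderBound M Z X' := by
  refine ⟨(Finset.sum_le_sum fun y _ => hle y).trans h.1, fun hZ => le_trans ?_ (h.2 hZ)⟩
  rw [weightedOrd, weightedOrd]
  gcongr <;> exact hle _

end OrderBound

lemma orderBound_sumOrd_empty (hn : 0 < n) (X : Finset (DPoly k n)) :
    OrderBound (sumOrd X) ∅ X :=
  .of_weightedOrd_le (fun _ => by simp [weightedOrd, sumOrd])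
    fun h => absurd (Finset.card_empty.symm.trans h) hn.ne

end Bounds

section Constants

variable {k : Type*} [Field k] {n : ℕ}

lemma eq_top_of_mem_constants {Q : Ideal (DPoly k n)} {a : DPoly k n} (ha : a ∈ Q) (h0 : a ≠ 0)
    (hc : a ∈ constants k n) : Q = ⊤ := by
  obtain ⟨x, rfl⟩ := hc
  have hx : x ≠ 0 := fun h => h0 (by rw [h, map_zero])
  exact Ideal.eq_top_of_isUnit_mem Q ha ((isUnit_iff_ne_zero.mpr hx).map C)

lemma sysIdeal_insert_eq_top [Differential k] {F H : Set (DPoly k n)} {a : DPoly k n}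
    (h0 : a ≠ 0) (hc : a ∈ constants k n) : sysIdeal (insert a F) H = ⊤ :=
  eq_top_of_mem_constants (subset_sysIdeal _ _ (Set.mem_insert a F)) h0 hc

end Constants

/-! ## The triples -/

section Triples

variable {k : Type*} [Field k] {n : ℕ} [LinearOrder (DVar n)] {t t' : Triple k n}
  {f g c : DPoly k n}

lemma mem_newG : g ∈ newG t f ↔ g ≠ f ∧ (g ∈ t.F ∨ (g ∈ t.C ∧ lv g = lv f)) := by
  simp only [newG, conflict, Finset.mem_erase, Finset.mem_union, Finset.mem_filter]

lemma mem_newC : c ∈ newC t f ↔ c = f ∨ (c ∈ t.C ∧ lv c ≠ lv f) := by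
  simp only [newC, conflict, Finset.mem_insert, Finset.mem_sdiff, Finset.mem_filter]
  tauto

lemma self_mem_newC (t : Triple k n) (f : DPoly k n) : f ∈ newC t f :=
  mem_newC.mpr (Or.inl rfl)

lemma newG_union_newC (hf : f ∈ t.F) : newG t f ∪ newC t f = t.F ∪ t.C := by
  ext g
  rw [Finset.mem_union, Finset.mem_union, mem_newG, mem_newC]
  by_cases hgf : g = f
  · simp [hgf, hf]
  · tauto

lemma callOrd_eq (hf : f ∈ t.F) : callOrd t f = maxOrd (t.F ∪ t.C ∪ t.H) := by
  funext y
  rw [callOrd, newG_union_newC hf]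

lemma lvSet_newC {u : DVar n} (hu : leader f = u) :
    lvSet (newC t f) = insert u.var (lvSet t.C) := by
  ext y
  rw [Finset.mem_insert, mem_lvSet, mem_lvSet]
  constructor
  · rintro ⟨c, hc, w, hw, rfl⟩
    rcases mem_newC.mp hc with rfl | ⟨hc, -⟩
    · rw [WithBot.coe_injective (hw.symm.trans hu)]
      exact Or.inl rfl
    · exact Or.inr ⟨c, hc, w, hw, rfl⟩
  · rintro (rfl | ⟨c, hc, w, hw, rfl⟩)
    · exact ⟨f, self_mem_newC t f, u, hu, rfl⟩
    · by_cases hlv : lv c = lv f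
      · rw [lv_of_leader hw, lv_of_leader hu] at hlv
        exact ⟨f, self_mem_newC t f, u, hu, (WithBot.coe_injective hlv).symm⟩
      · exact ⟨c, mem_newC.mpr (Or.inr ⟨hc, hlv⟩), w, hw, rfl⟩

lemma rank_lt_of_reduced (hrk : IsRanking n) (hf : f ∉ constants k n) (hc : c ∉ constants k n)
    (hred : Reduced f c) (hlv : lv c = lv f) : rank f < rank c := by
  obtain ⟨u, hu⟩ := exists_leader_eq_coe hf
  obtain ⟨w, hw⟩ := exists_leader_eq_coe hc
  have hvar : u.var = w.var := by
    rw [lv_of_leader hw, lv_of_leader hu] at hlv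
    exact (WithBot.coe_injective hlv).symm
  have hord : u.ord ≤ w.ord :=
    not_lt.mp fun hlt => hred.1 w hw u (mem_vars_of_leader hu) ⟨hvar, hlt⟩
  rcases ((hrk.le_iff_ord_le hvar).mpr hord).lt_or_eq with hlt | rfl
  · exact rank_lt_of_leader_lt (by rw [hu, hw]; exact WithBot.coe_lt_coe.mpr hlt)
  · rw [rank_of_leader hu, rank_of_leader hw, WithBot.coe_lt_coe, Prod.Lex.toLex_lt_toLex]
    exact Or.inr ⟨rfl, hred.2 u hw⟩

lemma Reduced.of_degreeOf_le (hred : Reduced f c) (hdeg : ∀ v, degreeOf v g ≤ degreeOf v f) :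
    Reduced g c :=
  ⟨fun u hu v hv => hred.1 u hu v (vars_subset_of_degreeOf_le hdeg hv),
    fun u hu => (hdeg u).trans_lt (hred.2 u hu)⟩

lemma inisep_lowest_subset (B RH : Finset (DPoly k n)) : inisep (lowest B) ⊆ RH ∪ inisep B :=
  (inisep_mono (lowest_subset B)).trans Finset.subset_union_right

/-- The algebraic part of the invariant of RGBound: a property of every triple in `U`. -/
structure TripleInv (t : Triple k n) : Prop where
  nonempty : t.F.Nonempty
  notMem_constants_of_mem_F : ∀ f ∈ t.F, f ∉ constants k n
  notMem_constants_of_mem_C : ∀ c ∈ t.C, c ∉ constants k n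
  injOn_lv : Set.InjOn (lv : DPoly k n → WithBot (Fin n)) t.C
  reduced : ∀ f ∈ t.F, ∀ c ∈ t.C, Reduced f c
  inisep_subset : inisep t.C ⊆ t.H

lemma TripleInv.callSpec (ht : TripleInv t) (hf : f ∈ t.F) :
    CallSpec (newC t f) (callOrd t f) where
  nonconst c hc := by
    rcases mem_newC.mp hc with rfl | ⟨hc, -⟩
    · exact ht.notMem_constants_of_mem_F c hf
    · exact ht.notMem_constants_of_mem_C c hc
  lvInj c hc c' hc' hlv := by
    rcases mem_newC.mp hc with rfl | ⟨hc, hne⟩ <;>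
      rcases mem_newC.mp hc' with rfl | ⟨hc', hne'⟩
    · rfl
    · exact absurd hlv.symm hne'
    · exact absurd hlv hne
    · exact ht.injOn_lv hc hc' hlv
  ord_le c hc v hv :=
    ord_le_maxOrd (Finset.mem_union_left _ (Finset.mem_union_right _ hc)) hv

lemma TripleInv.of_mem_splits (ht : TripleInv t) (hf : f ∈ t.F) (h : t' ∈ splits t f) :
    TripleInv t' := by
  obtain ⟨s, hs, hsc, rfl⟩ := mem_splits h
  have hdeg : ∀ v, degreeOf v s ≤ degreeOf v f := by
    rcases hs with rfl | rfl
    · exact degreeOf_separant_le f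
    · exact degreeOf_initial_le f
  exact {
    nonempty := ⟨s, Finset.mem_insert_self s t.F⟩
    notMem_constants_of_mem_F :=
      (Finset.forall_mem_insert _ _ _).mpr ⟨hsc, ht.notMem_constants_of_mem_F⟩
    notMem_constants_of_mem_C := ht.notMem_constants_of_mem_C
    injOn_lv := ht.injOn_lv
    reduced := (Finset.forall_mem_insert _ _ _).mpr
      ⟨fun c hc => (ht.reduced f hf c hc).of_degreeOf_le hdeg, ht.reduced⟩
    inisep_subset := ht.inisep_subset }

lemma orderBound_of_mem_splits {M : ℕ} (hf : f ∈ t.F)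
    (hb : OrderBound M (lvSet t.C) (t.F ∪ t.C ∪ t.H)) (h : t' ∈ splits t f) :
    OrderBound M (lvSet t'.C) (t'.F ∪ t'.C ∪ t'.H) := by
  obtain ⟨s, hs, -, rfl⟩ := mem_splits h
  have hvars : s.vars ⊆ f.vars := by
    rcases hs with rfl | rfl
    · exact vars_separant_subset f
    · exact vars_initial_subset f
  refine hb.mono fun y => maxOrd_le_iff.mpr ?_
  rintro g hg v hv rfl
  rw [Finset.insert_union, Finset.insert_union] at hg
  rcases Finset.mem_insert.mp hg with rfl | hg
  · exact ord_le_maxOrd (Finset.mem_union_left _ (Finset.mem_union_left _ hf)) (hvars hv)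
  · exact ord_le_maxOrd hg hv

end Triples

section TripleIdeal

variable {k : Type*} [Field k] [Differential k] {n : ℕ}

/-- The ideal `{F ∪ C} : H^∞` of a triple. -/
def tripleIdeal (t : Triple k n) : Ideal (DPoly k n) :=
  sysIdeal ((t.F : Set (DPoly k n)) ∪ t.C) t.H

lemma tripleIdeal_insert (s : DPoly k n) (t : Triple k n) :
    tripleIdeal ⟨insert s t.F, t.C, t.H⟩ =
      sysIdeal (insert s ((t.F : Set (DPoly k n)) ∪ t.C)) t.H := by
  rw [tripleIdeal, Finset.coe_insert, Set.insert_union]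

variable [LinearOrder (DVar n)] {t : Triple k n} {f : DPoly k n}

/-- The ideal of a triple, saturated by the initial and the separant of `f`. -/
def callIdeal (t : Triple k n) (f : DPoly k n) : Ideal (DPoly k n) :=
  sysIdeal ((t.F : Set (DPoly k n)) ∪ t.C) (insert (initial f) (insert (separant f) t.H))

lemma tripleIdeal_eq_callIdeal_inf [CharZero k] (t : Triple k n) {u : DVar n}
    (hu : leader f = u) :
    tripleIdeal t = callIdeal t f ⊓ ⨅ t' ∈ splits t f, tripleIdeal t' := by
  rw [tripleIdeal, sysIdeal_eq_inf_insert_insert _ _ (separant f) (initial f), callIdeal]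
  congr 1
  rw [splits]
  split_ifs with hsep hini
  · have hini : initial f ∈ constants k n :=
      initial_eq_separant_of_separant_mem_constants hu hsep ▸ hsep
    simp [sysIdeal_insert_eq_top (separant_ne_zero hu) hsep,
      sysIdeal_insert_eq_top (initial_ne_zero hu) hini]
  · simp [tripleIdeal_insert, sysIdeal_insert_eq_top (initial_ne_zero hu) hini]
  · rw [Finset.iInf_insert, Finset.iInf_singleton, tripleIdeal_insert, tripleIdeal_insert]

lemma newG_union_newC_subset_callIdeal (hf : f ∈ t.F) :
    (newG t f : Set (DPoly k n)) ∪ newC t f ⊆ callIdeal t f := by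
  rw [← Finset.coe_union, newG_union_newC hf, Finset.coe_union]
  exact subset_sysIdeal _ _

lemma TripleInv.vanishesRegularly_newC (ht : TripleInv t) (hf : f ∈ t.F) {c : DPoly k n}
    (hc : c ∈ newC t f) : VanishesRegularly (callIdeal t f) c := by
  have hreg := subset_regularMod_sysIdeal ((t.F : Set (DPoly k n)) ∪ t.C)
    (insert (initial f) (insert (separant f) t.H))
  refine ⟨newG_union_newC_subset_callIdeal hf (Or.inr hc), ?_⟩
  rcases mem_newC.mp hc with rfl | ⟨hc, -⟩
  · exact ⟨hreg (Or.inl rfl), hreg (Or.inr (Or.inl rfl))⟩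
  · have hsub {h : DPoly k n} (hh : h ∈ inisep t.C) : h ∈ regularMod (callIdeal t f) :=
      hreg (Or.inr (Or.inr (ht.inisep_subset hh)))
    exact ⟨hsub (initial_mem_inisep hc), hsub (separant_mem_inisep hc)⟩

end TripleIdeal

section CallResult

variable {k : Type*} [Field k] [Differential k] {n : ℕ} [LinearOrder (DVar n)]
  {t : Triple k n} {f : DPoly k n} {B RF RH : Finset (DPoly k n)}

/-- The call of Differentiate&Autoreduce for `t` and `f` has returned `B`; the remainders of `G`
and of `H` are the elements of `RF` and `RH`. -/
structure CallResult (t : Triple k n) (f : DPoly k n) (B RF RH : Finset (DPoly k n)) : Prop where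
  loopInv : LoopInv (newC t f) (callOrd t f) ∅ B
  candidates_eq_empty : candidates (callOrd t f) ∅ B = ∅
  algRemSet_newG : AlgRemSet B (newG t f) RF
  algRemSet_H : AlgRemSet B t.H RH

/-- The triple `(F̄, B⁰, H̄)` that RGBound forms from `B` and the remainders. -/
def resultTriple (B RF RH : Finset (DPoly k n)) : Triple k n :=
  ⟨RF.erase 0, lowest B, RH ∪ inisep B⟩

namespace CallResult

lemma isResultPoly (hr : CallResult t f B RF RH) {x : DPoly k n}
    (hx : x ∈ RF.erase 0 ∪ lowest B ∪ (RH ∪ inisep B)) : IsResultPoly (callOrd t f) B x := by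
  obtain ⟨ρ, hρ, rfl⟩ := hr.algRemSet_newG
  obtain ⟨σ, hσ, rfl⟩ := hr.algRemSet_H
  simp only [Finset.mem_union] at hx
  rcases hx with (hx | hx) | hx | hx
  · obtain ⟨g, hg, rfl⟩ := Finset.mem_image.mp (Finset.mem_of_mem_erase hx)
    exact .ofRem g (fun v hv => ord_le_maxOrd
      (Finset.mem_union_left _ (Finset.mem_union_left _ hg)) hv) (hρ g hg)
  · exact .ofLowest hx
  · obtain ⟨g, hg, rfl⟩ := Finset.mem_image.mp hx
    exact .ofRem g (fun v hv => ord_le_maxOrd (Finset.mem_union_right _ hg) hv) (hσ g hg)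
  · exact .ofInisep hx

lemma vanishesRegularly (hr : CallResult t f B RF RH) (ht : TripleInv t) (hf : f ∈ t.F) :
    ∀ b ∈ B, VanishesRegularly (callIdeal t f) b :=
  hr.loopInv.forward _ (isDiffIdeal_sysIdeal _ _) fun _ => ht.vanishesRegularly_newC hf

lemma subset_callIdeal (hr : CallResult t f B RF RH) (ht : TripleInv t) (hf : f ∈ t.F) :
    (RF : Set (DPoly k n)) ⊆ callIdeal t f :=
  (hr.algRemSet_newG.subset_iff (hr.vanishesRegularly ht hf)).mp
    (Set.subset_union_left.trans (newG_union_newC_subset_callIdeal hf))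

lemma subset_regularMod_callIdeal (hr : CallResult t f B RF RH) (ht : TripleInv t)
    (hf : f ∈ t.F) : ((RH ∪ inisep B : Finset (DPoly k n)) : Set (DPoly k n)) ⊆
      regularMod (callIdeal t f) := by
  have hB := hr.vanishesRegularly ht hf
  rw [Finset.coe_union]
  refine Set.union_subset ((hr.algRemSet_H.subset_regularMod_iff hB).mp ?_)
    fun h hh => VanishesRegularly.mem_regularMod_of_mem_inisep hB hh
  exact ((Set.subset_insert _ _).trans (Set.subset_insert _ _)).trans
    (subset_regularMod_sysIdeal _ _)

lemma callIdeal_eq_top (hr : CallResult t f B RF RH) (ht : TripleInv t) (hf : f ∈ t.F)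
    (hbad : (∃ r ∈ RF.erase 0, r ∈ constants k n) ∨ (0 : DPoly k n) ∈ RH ∪ inisep B) :
    callIdeal t f = ⊤ := by
  rcases hbad with ⟨r, hr0, hrc⟩ | h0
  · obtain ⟨hr0, hrF⟩ := Finset.mem_erase.mp hr0
    exact eq_top_of_mem_constants (hr.subset_callIdeal ht hf hrF) hr0 hrc
  · rw [Ideal.eq_top_iff_one]
    exact mem_regularMod_iff.mp (hr.subset_regularMod_callIdeal ht hf h0) 1
      (by rw [zero_mul]; exact zero_mem _)

lemma tripleIdeal_resultTriple_le (hr : CallResult t f B RF RH) (ht : TripleInv t)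
    (hf : f ∈ t.F) : tripleIdeal (resultTriple B RF RH) ≤ callIdeal t f := by
  refine sysIdeal_le (Set.union_subset (fun g hg => ?_) fun b hb => ?_) (isDiffIdeal_sysIdeal _ _)
    (isRadical_sysIdeal _ _) (hr.subset_regularMod_callIdeal ht hf)
  · exact hr.subset_callIdeal ht hf (Finset.mem_of_mem_erase hg)
  · exact (hr.vanishesRegularly ht hf b (lowest_subset B hb)).1

lemma callIdeal_le_tripleIdeal (hr : CallResult t f B RF RH) (hf : f ∈ t.F) :
    callIdeal t f ≤ tripleIdeal (resultTriple B RF RH) := by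
  set Q := tripleIdeal (resultTriple B RF RH)
  have hQdiff : IsDiffIdeal Q := isDiffIdeal_sysIdeal _ _
  have hzero : ((RF.erase 0 : Finset (DPoly k n)) : Set (DPoly k n)) ∪ lowest B ⊆ Q :=
    subset_sysIdeal _ _
  have hregular : ((RH ∪ inisep B : Finset (DPoly k n)) : Set (DPoly k n)) ⊆ regularMod Q :=
    subset_regularMod_sysIdeal _ _
  obtain ⟨hBQ, hC⟩ := hr.loopInv.backward Q hQdiff (fun b hb => hzero (Or.inr hb))
    fun h hh => hregular (Finset.mem_union_right _ hh)
  rw [Finset.sdiff_empty] at hC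
  have hB : ∀ b ∈ B, VanishesRegularly Q b := fun b hb =>
    ⟨hBQ b hb, hregular (Finset.mem_union_right _ (initial_mem_inisep hb)),
      hregular (Finset.mem_union_right _ (separant_mem_inisep hb))⟩
  have hRF : (RF : Set (DPoly k n)) ⊆ Q := fun r hrF => by
    by_cases h0 : r = 0
    · exact h0 ▸ zero_mem Q
    · exact hzero (Or.inl (Finset.mem_erase.mpr ⟨h0, hrF⟩))
  have hRH : (RH : Set (DPoly k n)) ⊆ regularMod Q :=
    fun h hh => hregular (Finset.mem_union_left _ hh)
  have hfQ := hC f (self_mem_newC t f)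
  refine sysIdeal_le ?_ hQdiff (isRadical_sysIdeal _ _)
    (Set.insert_subset hfQ.2.1 (Set.insert_subset hfQ.2.2 ?_))
  · rw [← Finset.coe_union, ← newG_union_newC hf, Finset.coe_union]
    exact Set.union_subset ((hr.algRemSet_newG.subset_iff hB).mpr hRF) fun c hc => (hC c hc).1
  · exact (hr.algRemSet_H.subset_regularMod_iff hB).mpr hRH

lemma callIdeal_eq_tripleIdeal (hr : CallResult t f B RF RH) (ht : TripleInv t) (hf : f ∈ t.F) :
    callIdeal t f = tripleIdeal (resultTriple B RF RH) :=
  (hr.callIdeal_le_tripleIdeal hf).antisymm (hr.tripleIdeal_resultTriple_le ht hf)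

lemma tripleLT (hrk : IsRanking n) (hr : CallResult t f B RF RH) (ht : TripleInv t)
    (hf : f ∈ t.F) : TripleLT (resultTriple B RF RH) t := by
  have hfc := ht.notMem_constants_of_mem_F f hf
  have hrank {c : DPoly k n} (hc : c ∈ t.C) (hlv : lv c = lv f) : rank f < rank c :=
    rank_lt_of_reduced hrk hfc (ht.notMem_constants_of_mem_C c hc) (ht.reduced f hf c hc) hlv
  have hle {c : DPoly k n} (hc : c ∈ newC t f) {y : Fin n} (hy : lv c = y) :
      rankFamily (lowest B) y ≤ (rank c : WithTop (WithBot (DVar n ×ₗ ℕ))) :=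
    hr.loopInv.rankFamily_lowest_le hrk (ht.callSpec hf) (by rwa [Finset.sdiff_empty]) hy
  obtain ⟨u, hu⟩ := exists_leader_eq_coe hfc
  refine Prod.Lex.left _ _ (Pi.lt_def.mpr ⟨fun y => Finset.le_inf fun c hc => ?_, u.var, ?_⟩)
  · obtain ⟨hc, hy⟩ := Finset.mem_filter.mp hc
    by_cases hlv : lv c = lv f
    · exact (hle (self_mem_newC t f) (hlv ▸ hy)).trans (WithTop.coe_le_coe.mpr (hrank hc hlv).le)
    · exact hle (mem_newC.mpr (Or.inr ⟨hc, hlv⟩)) hy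
  · refine (hle (self_mem_newC t f) (lv_of_leader hu)).trans_lt ?_
    rw [rankFamily, minRank, Finset.lt_inf_iff (WithTop.coe_lt_top _)]
    intro c hc
    obtain ⟨hc, hy⟩ := Finset.mem_filter.mp hc
    exact WithTop.coe_lt_coe.mpr (hrank hc (hy.trans (lv_of_leader hu).symm))

variable [CharZero k]

lemma orderBound (hrk : IsRanking n) (hr : CallResult t f B RF RH) (ht : TripleInv t)
    (hf : f ∈ t.F) {M : ℕ} (hb : OrderBound M (lvSet t.C) (t.F ∪ t.C ∪ t.H)) :
    OrderBound M (lvSet (lowest B)) (RF.erase 0 ∪ lowest B ∪ (RH ∪ inisep B)) := by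
  obtain ⟨a, ha, hin, hout⟩ := hr.loopInv.maxOrd_le_of_isResultPoly hrk (ht.callSpec hf)
    hr.candidates_eq_empty fun _ => hr.isResultPoly
  obtain ⟨u, hu⟩ := exists_leader_eq_coe (ht.notMem_constants_of_mem_F f hf)
  rw [hr.loopInv.lvSet_lowest hrk (ht.callSpec hf)]
  rw [lvSet_newC hu] at ha hin hout ⊢
  rw [callOrd_eq hf] at ha hout
  exact hb.of_maxOrd_le ha hin hout

lemma partiallyReduced (hrk : IsRanking n) (hr : CallResult t f B RF RH) (ht : TripleInv t)
    (hf : f ∈ t.F) {x b : DPoly k n} (hx : x ∈ RF.erase 0 ∪ lowest B ∪ (RH ∪ inisep B))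
    (hb : b ∈ lowest B) : PartiallyReduced x b :=
  hr.loopInv.partiallyReduced_of_isResultPoly hrk (ht.callSpec hf) hr.candidates_eq_empty
    (hr.isResultPoly hx) hb

lemma isRegularSystem (hrk : IsRanking n) (hr : CallResult t f B RF RH) (ht : TripleInv t)
    (hf : f ∈ t.F) : IsRegularSystem (lowest B) (RH ∪ inisep B) := by
  refine ⟨⟨fun b hb => hr.loopInv.notMem_constants (lowest_subset B hb), fun x hx b hb hne => ?_⟩,
    fun x hx b hb => hr.partiallyReduced hrk ht hf (Finset.mem_union_right _ hx) hb,
    inisep_lowest_subset B RH⟩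
  exact ⟨hr.partiallyReduced hrk ht hf (Finset.mem_union_left _ (Finset.mem_union_right _ hx)) hb,
    hr.loopInv.algRed x (lowest_subset B hx) b (lowest_subset B hb) hne⟩

lemma tripleInv (hrk : IsRanking n) (hr : CallResult t f B RF RH) (ht : TripleInv t)
    (hf : f ∈ t.F) (hconst : ∀ r ∈ RF.erase 0, r ∉ constants k n) (hne : (RF.erase 0).Nonempty) :
    TripleInv (resultTriple B RF RH) where
  nonempty := hne
  notMem_constants_of_mem_F := hconst
  notMem_constants_of_mem_C b hb := hr.loopInv.notMem_constants (lowest_subset B hb)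
  injOn_lv := hr.loopInv.injOn_lv_lowest
  reduced x hx b hb := by
    refine ⟨hr.partiallyReduced hrk ht hf
      (Finset.mem_union_left _ (Finset.mem_union_left _ hx)) hb, ?_⟩
    obtain ⟨ρ, hρ, rfl⟩ := hr.algRemSet_newG
    obtain ⟨g, hg, rfl⟩ := Finset.mem_image.mp (Finset.mem_of_mem_erase hx)
    exact (hρ g hg).2 b (lowest_subset B hb)
  inisep_subset := inisep_lowest_subset B RH

end CallResult

end CallResult

/-! ## The runs of RGBound -/

section Measure

variable {k : Type*} [Field k] {n : ℕ} [LinearOrder (DVar n)]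

/-- The measure that decreases along the runs of RGBound: the multiset of the triples that are
still to be treated, and then the number of rounds left to the call in progress, which adds at most
one element to `B` for every derivative within the bounds `callOrd t f`. -/
def configMeasure : Config k n → Multiset (Triple k n) × WithTop ℕ
  | .main U _ => (U.val, ⊤)
  | .auto U _ t f _ B => (t ::ₘ U.val, ((∑ y, (callOrd t f y + 1) - B.card : ℕ) : WithTop ℕ))

/-- The order in which `configMeasure` decreases; the multisets of triples are compared in the
multiset extension of `TripleLT`. -/
def MeasureLT : Multiset (Triple k n) × WithTop ℕ → Multiset (Triple k n) × WithTop ℕ → Prop :=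
  Prod.Lex (Relation.CutExpand TripleLT) (· < ·)

lemma wellFounded_measureLT (hrk : IsRanking n) :
    WellFounded (MeasureLT : Multiset (Triple k n) × WithTop ℕ → _ → Prop) :=
  WellFounded.prod_lex (wellFounded_tripleLT hrk).cutExpand wellFounded_lt

end Measure

section Specifications

variable {k : Type*} [Field k] {n : ℕ} [LinearOrder (DVar n)]

/-- The invariant of the triples in `U`: their algebraic properties and the bound for their
orders. -/
def TripleSpec (M : ℕ) (t : Triple k n) : Prop :=
  TripleInv t ∧ OrderBound M (lvSet t.C) (t.F ∪ t.C ∪ t.H)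

/-- The invariant of the systems in `T`. -/
def SysSpec (M : ℕ) (s : Sys k n) : Prop :=
  IsRegularSystem s.A s.H ∧ sumOrd (s.A ∪ s.H) ≤ (n - 1).factorial * M

lemma tripleSpec_start {F H : Finset (DPoly k n)} (hF : F.Nonempty)
    (hconst : ∀ f ∈ F, f ∉ constants k n) : TripleSpec (sumOrd (F ∪ H)) ⟨F, ∅, H⟩ := by
  obtain ⟨f, hf⟩ := hF
  obtain ⟨u, -⟩ := exists_leader_eq_coe (hconst f hf)
  refine ⟨⟨⟨f, hf⟩, hconst, by simp, by simp, by simp, by simp [inisep]⟩, ?_⟩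
  have hlvSet : lvSet (∅ : Finset (DPoly k n)) = ∅ := by simp [lvSet]
  simpa only [hlvSet, Finset.union_empty] using orderBound_sumOrd_empty (Fin.pos u.var) (F ∪ H)

end Specifications

section TotalIdeal

variable {k : Type*} [Field k] [Differential k] {n : ℕ}

/-- The intersection of the ideals of the triples in `U` and of the systems in `T`. -/
def totalIdeal (U : Finset (Triple k n)) (T : Finset (Sys k n)) : Ideal (DPoly k n) :=
  (⨅ t ∈ U, tripleIdeal t) ⊓
    ⨅ s ∈ T, saturation (diffIdeal (s.A : Set (DPoly k n))) (s.H : Set (DPoly k n))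

lemma totalIdeal_union (U S : Finset (Triple k n)) (T : Finset (Sys k n)) :
    totalIdeal (U ∪ S) T = totalIdeal U T ⊓ ⨅ t ∈ S, tripleIdeal t := by
  rw [totalIdeal, totalIdeal, Finset.iInf_union, inf_right_comm]

lemma totalIdeal_insert (U : Finset (Triple k n)) (t : Triple k n) (T : Finset (Sys k n)) :
    totalIdeal (insert t U) T = totalIdeal U T ⊓ tripleIdeal t := by
  rw [totalIdeal, totalIdeal, Finset.iInf_insert, inf_assoc, inf_comm]

lemma totalIdeal_insert_sys (U : Finset (Triple k n)) (s : Sys k n) (T : Finset (Sys k n)) :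
    totalIdeal U (insert s T) = totalIdeal U T ⊓
      saturation (diffIdeal (s.A : Set (DPoly k n))) (s.H : Set (DPoly k n)) := by
  rw [totalIdeal, totalIdeal, Finset.iInf_insert, inf_assoc,
    inf_comm (saturation (diffIdeal (s.A : Set (DPoly k n))) s.H)]

lemma totalIdeal_empty (T : Finset (Sys k n)) : totalIdeal ∅ T =
    ⨅ s ∈ T, saturation (diffIdeal (s.A : Set (DPoly k n))) (s.H : Set (DPoly k n)) := by
  simp [totalIdeal]

end TotalIdeal

section Configurations

variable {k : Type*} [Field k] [Differential k] {n : ℕ} [LinearOrder (DVar n)]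

/-- The invariant of RGBound for an input of order `M` and with the ideal `I`. During a call, the
triple `t` still counts as an element of `U`. -/
def ConfigInv (M : ℕ) (I : Ideal (DPoly k n)) : Config k n → Prop
  | .main U T => (∀ t ∈ U, TripleSpec M t) ∧ (∀ s ∈ T, SysSpec M s) ∧ I = totalIdeal U T
  | .auto U T t f D B => (∀ t' ∈ insert t U, TripleSpec M t') ∧ (∀ s ∈ T, SysSpec M s) ∧
      I = totalIdeal (insert t U) T ∧ IsLeastRank t.F f ∧
      LoopInv (newC t f) (callOrd t f) D B

lemma configInv_start {F H : Finset (DPoly k n)} (hF : F.Nonempty)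
    (hconst : ∀ f ∈ F, f ∉ constants k n) :
    ConfigInv (sumOrd (F ∪ H)) (saturation (radDiffIdeal (F : Set (DPoly k n)))
      (H : Set (DPoly k n))) (start F H) := by
  refine ⟨fun t ht => ?_, by simp, by simp [totalIdeal, tripleIdeal, sysIdeal]⟩
  obtain rfl := Finset.mem_singleton.mp ht
  exact tripleSpec_start hF hconst

lemma exists_step_auto (U : Finset (Triple k n)) (T : Finset (Sys k n)) (t : Triple k n)
    (f : DPoly k n) (D B : Finset (DPoly k n)) : ∃ c', Step (.auto U T t f D B) c' := by
  rcases (candidates (callOrd t f) D B).eq_empty_or_nonempty with hdone | hne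
  · obtain ⟨RF, hG⟩ := exists_algRemSet B (newG t f)
    obtain ⟨RH, hH⟩ := exists_algRemSet B t.H
    by_cases hbad : (∃ r ∈ RF.erase 0, r ∈ constants k n) ∨ (0 : DPoly k n) ∈ RH ∪ inisep B
    · exact ⟨_, .discard U T t f D B RF RH hdone hG hH hbad⟩
    · rw [not_or] at hbad
      rcases (RF.erase 0).eq_empty_or_nonempty with hempty | hne
      · exact ⟨_, .output U T t f D B RF RH hdone hG hH hbad.2 hempty⟩
      · exact ⟨_, .push U T t f D B RF RH hdone hG hH
          (fun r hr hc => hbad.1 ⟨r, hr, hc⟩) hbad.2 hne⟩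
  · obtain ⟨g, hg⟩ := exists_isLeastRank hne
    obtain ⟨r, hr⟩ := exists_algRem (divisors D B g) g
    by_cases hrank : rank r = rank g
    · exact ⟨_, .loop U T t f D B g r hg hr hrank⟩
    · exact ⟨_, .unit U T t f D B g r hg hr hrank⟩

namespace ConfigInv

variable {M : ℕ} {I : Ideal (DPoly k n)} {U : Finset (Triple k n)} {T : Finset (Sys k n)}
  {t : Triple k n} {f : DPoly k n} {D B RF RH : Finset (DPoly k n)} {c c' : Config k n}

theorem progress (h : ConfigInv M I c) :
    (∃ T : Finset (Sys k n), c = .main ∅ T) ∨ ∃ c', Step c c' := by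
  rcases c with ⟨U, T⟩ | ⟨U, T, t, f, D, B⟩
  · rcases U.eq_empty_or_nonempty with rfl | ⟨t, ht⟩
    · exact Or.inl ⟨T, rfl⟩
    · obtain ⟨f, hf⟩ := exists_isLeastRank (h.1 t ht).1.nonempty
      exact Or.inr ⟨_, .call U T t f ht hf⟩
  · exact Or.inr (exists_step_auto U T t f D B)

lemma call (h : ConfigInv M I (.main U T)) (ht : t ∈ U) (hf : IsLeastRank t.F f) :
    ConfigInv M I (.auto (U.erase t) T t f (newC t f) ∅) ∧
      MeasureLT (configMeasure (.auto (U.erase t) T t f (newC t f) ∅))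
        (configMeasure (.main U T)) := by
  obtain ⟨hU, hT, hI⟩ := h
  rw [← Finset.insert_erase ht] at hU hI
  refine ⟨⟨hU, hT, hI, hf, loopInv_start _ _⟩, ?_⟩
  rw [configMeasure, configMeasure, Finset.erase_val, Multiset.cons_erase ht]
  exact Prod.Lex.right _ (WithTop.coe_lt_top _)

lemma tripleInv (h : ConfigInv M I (.auto U T t f D B)) : TripleInv t :=
  (h.1 t (Finset.mem_insert_self t U)).1

lemma callResult (h : ConfigInv M I (.auto U T t f D B))
    (hdone : candidates (callOrd t f) D B = ∅) (hG : AlgRemSet B (newG t f) RF)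
    (hH : AlgRemSet B t.H RH) : CallResult t f B RF RH := by
  obtain rfl := eq_empty_of_candidates_eq_empty hdone
  exact ⟨h.2.2.2.2, hdone, hG, hH⟩

variable [CharZero k]

lemma loop (hrk : IsRanking n) (h : ConfigInv M I (.auto U T t f D B)) {g r : DPoly k n}
    (hg : IsLeastRank (candidates (callOrd t f) D B) g) (hrem : AlgRem (divisors D B g) g r)
    (hrank : rank r = rank g) :
    ConfigInv M I (.auto U T t f (D.erase g) (insert r B)) ∧
      MeasureLT (configMeasure (.auto U T t f (D.erase g) (insert r B)))
        (configMeasure (.auto U T t f D B)) := by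
  have ht := h.tripleInv
  obtain ⟨hU, hT, hI, hf, hloop⟩ := h
  have hcall := ht.callSpec hf.1
  have hloop' := hloop.insert_rem hrk hcall hg hrem hrank
  refine ⟨⟨hU, hT, hI, hf, hloop'⟩, Prod.Lex.right _ (Nat.cast_lt.mpr ?_)⟩
  have hrB : r ∉ B := hloop.rem_notMem hg.1 (leader_eq_of_rank_eq hrank)
  have hcard := hloop'.card_le_sum_succ hcall
  rw [Finset.card_insert_of_notMem hrB] at hcard ⊢
  lia

/-- All exits from a call: `S` is the set of the triples, besides those of `splits t f`, that take
the place of `t`. -/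
lemma exit (h : ConfigInv M I (.auto U T t f D B)) {S : Finset (Triple k n)}
    {T' : Finset (Sys k n)} (hS : ∀ t' ∈ S, TripleSpec M t' ∧ TripleLT t' t)
    (hT' : ∀ s ∈ T', SysSpec M s)
    (hideal : totalIdeal U T ⊓ callIdeal t f = totalIdeal (U ∪ S) T') :
    ConfigInv M I (.main (U ∪ S ∪ splits t f) T') ∧
      MeasureLT (configMeasure (.main (U ∪ S ∪ splits t f) T'))
        (configMeasure (.auto U T t f D B)) := by
  obtain ⟨hU, -, hI, hf, -⟩ := h
  obtain ⟨ht, hbound⟩ := hU t (Finset.mem_insert_self t U)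
  have hfc := ht.notMem_constants_of_mem_F f hf.1
  obtain ⟨u, hu⟩ := exists_leader_eq_coe hfc
  refine ⟨⟨fun t' ht' => ?_, hT', ?_⟩, Prod.Lex.left _ _ ?_⟩
  · rcases Finset.mem_union.mp ht' with ht' | ht'
    · rcases Finset.mem_union.mp ht' with ht' | ht'
      · exact hU t' (Finset.mem_insert_of_mem ht')
      · exact (hS t' ht').1
    · exact ⟨ht.of_mem_splits hf.1 ht', orderBound_of_mem_splits hf.1 hbound ht'⟩
  · rw [hI, totalIdeal_insert, tripleIdeal_eq_callIdeal_inf t hu, ← inf_assoc, hideal,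
      totalIdeal_union _ (splits t f)]
  · rw [Finset.union_assoc]
    refine cutExpand_union fun t' ht' => ?_
    rcases Finset.mem_union.mp ht' with ht' | ht'
    · exact (hS t' ht').2
    · exact tripleLT_of_mem_splits hf hfc ht'

lemma exit_of_callIdeal_eq_top (h : ConfigInv M I (.auto U T t f D B))
    (htop : callIdeal t f = ⊤) : ConfigInv M I (.main (U ∪ splits t f) T) ∧
      MeasureLT (configMeasure (.main (U ∪ splits t f) T))
        (configMeasure (.auto U T t f D B)) := by
  simpa only [Finset.union_empty] using
    h.exit (S := ∅) (by simp) h.2.1 (by rw [htop, inf_top_eq, Finset.union_empty])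

lemma output (hrk : IsRanking n) (h : ConfigInv M I (.auto U T t f D B))
    (hr : CallResult t f B RF RH) (hempty : RF.erase 0 = ∅) :
    ConfigInv M I (.main (U ∪ splits t f) (insert ⟨lowest B, RH ∪ inisep B⟩ T)) ∧
      MeasureLT (configMeasure (.main (U ∪ splits t f) (insert ⟨lowest B, RH ∪ inisep B⟩ T)))
        (configMeasure (.auto U T t f D B)) := by
  obtain ⟨ht, hbound⟩ := h.1 t (Finset.mem_insert_self t U)
  have hf := h.2.2.2.1.1
  have hreg := hr.isRegularSystem hrk ht hf
  have hsum := (hr.orderBound hrk ht hf hbound).1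
  rw [hempty, Finset.empty_union] at hsum
  have hideal : callIdeal t f =
      saturation (diffIdeal (lowest B : Set (DPoly k n))) (RH ∪ inisep B : Finset _) := by
    rw [hr.callIdeal_eq_tripleIdeal ht hf, tripleIdeal, resultTriple, hempty, Finset.coe_empty,
      Set.empty_union,
      sysIdeal_eq_saturation_diffIdeal hrk hreg.1.1 hr.loopInv.injOn_lv_lowest hreg.2.2]
  have hexit := h.exit (S := ∅) (T' := insert ⟨lowest B, RH ∪ inisep B⟩ T) (by simp)
    ((Finset.forall_mem_insert _ _ _).mpr ⟨⟨hreg, hsum⟩, h.2.1⟩)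
    (by rw [hideal, Finset.union_empty, totalIdeal_insert_sys])
  rwa [Finset.union_empty] at hexit

lemma push (hrk : IsRanking n) (h : ConfigInv M I (.auto U T t f D B))
    (hr : CallResult t f B RF RH) (hconst : ∀ r ∈ RF.erase 0, r ∉ constants k n)
    (hne : (RF.erase 0).Nonempty) :
    ConfigInv M I (.main (insert (resultTriple B RF RH) U ∪ splits t f) T) ∧
      MeasureLT (configMeasure (.main (insert (resultTriple B RF RH) U ∪ splits t f) T))
        (configMeasure (.auto U T t f D B)) := by
  obtain ⟨ht, hbound⟩ := h.1 t (Finset.mem_insert_self t U)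
  have hf := h.2.2.2.1.1
  have hspec : TripleSpec M (resultTriple B RF RH) :=
    ⟨hr.tripleInv hrk ht hf hconst hne, hr.orderBound hrk ht hf hbound⟩
  have hexit := h.exit (S := {resultTriple B RF RH})
    (fun t' ht' => Finset.mem_singleton.mp ht' ▸ ⟨hspec, hr.tripleLT hrk ht hf⟩) h.2.1
    (by rw [totalIdeal_union, Finset.iInf_singleton, hr.callIdeal_eq_tripleIdeal ht hf])
  rwa [Finset.union_comm U, ← Finset.insert_eq] at hexit

theorem step (hrk : IsRanking n) (h : ConfigInv M I c) (hs : Step c c') :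
    ConfigInv M I c' ∧ MeasureLT (configMeasure c') (configMeasure c) := by
  cases hs with
  | call U T t f ht hf => exact h.call ht hf
  | loop U T t f D B g r hg hrem hrank => exact h.loop hrk hg hrem hrank
  | unit U T t f D B g r hg hrem hrank =>
    have hf := h.2.2.2.1.1
    exact h.exit_of_callIdeal_eq_top <| h.2.2.2.2.eq_top_of_rank_ne hrk (h.tripleInv.callSpec hf)
      hg.1 hrem hrank (isDiffIdeal_sysIdeal _ _) fun _ => h.tripleInv.vanishesRegularly_newC hf
  | discard U T t f D B RF RH hdone hG hH hbad =>
    exact h.exit_of_callIdeal_eq_top <|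
      (h.callResult hdone hG hH).callIdeal_eq_top h.tripleInv h.2.2.2.1.1 hbad
  | output U T t f D B RF RH hdone hG hH _ hempty =>
    exact h.output hrk (h.callResult hdone hG hH) hempty
  | push U T t f D B RF RH hdone hG hH hconst _ hne =>
    exact h.push hrk (h.callResult hdone hG hH) hconst hne

theorem acc (hrk : IsRanking n) (h : ConfigInv M I c) :
    Acc (fun c' c : Config k n => Step c c') c := by
  have hwf := InvImage.wf (configMeasure (k := k) (n := n)) (wellFounded_measureLT hrk)
  induction c using hwf.induction with
  | _ c ih => exact ⟨c, fun c' hs => ih c' (h.step hrk hs).2 (h.step hrk hs).1⟩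

end ConfigInv

lemma Reachable.configInv [CharZero k] (hrk : IsRanking n) {F H : Finset (DPoly k n)}
    (hF : F.Nonempty) (hconst : ∀ f ∈ F, f ∉ constants k n) {c : Config k n}
    (h : Reachable F H c) :
    ConfigInv (sumOrd (F ∪ H)) (saturation (radDiffIdeal (F : Set (DPoly k n)))
      (H : Set (DPoly k n))) c := by
  induction h with
  | refl => exact configInv_start hF hconst
  | tail _ hs ih => exact (ih.step hrk hs).1

end Configurations

end RG

end

theorem mainTheorem1 {k : Type*} [Field k] [CharZero k] [Differential k] {n : ℕ}
    [LinearOrder (DVar n)] (hrk : IsRanking n)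
    (F₀ H₀ : Finset (DPoly k n)) (hF₀ : F₀.Nonempty) (hconst : ∀ f ∈ F₀, f ∉ constants k n) :
    -- termination: pseudo-reduction terminates, all runs are finite, and a run can only stop
    -- at the head of the main loop with `U = ∅`
    (∀ B : Finset (DPoly k n), WellFounded fun r f : DPoly k n => PseudoStep B f r) ∧
    Acc (fun c' c : Config k n => Step c c') (start F₀ H₀) ∧
    (∀ c : Config k n, Reachable F₀ H₀ c →
      (∃ T : Finset (Sys k n), c = .main ∅ T) ∨ ∃ c' : Config k n, Step c c') ∧
    -- the intermediate systems
    (∀ (U : Finset (Triple k n)) (T : Finset (Sys k n)), Reachable F₀ H₀ (.main U T) →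
      ∀ t ∈ U,
        sumOrd (t.F ∪ t.C ∪ t.H) ≤ (n - 1).factorial * sumOrd (F₀ ∪ H₀) ∧
        ((lvSet t.C).card < n →
          weightedOrd (lvSet t.C) (t.F ∪ t.C ∪ t.H) ≤
            (∏ i ∈ Finset.range (lvSet t.C).card, (n - (i + 1))) * sumOrd (F₀ ∪ H₀))) ∧
    -- the output
    (∀ T : Finset (Sys k n), Reachable F₀ H₀ (.main ∅ T) →
      (∀ s ∈ T, IsRegularSystem s.A s.H ∧
        sumOrd (s.A ∪ s.H) ≤ (n - 1).factorial * sumOrd (F₀ ∪ H₀)) ∧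
      saturation (radDiffIdeal (F₀ : Set (DPoly k n))) (H₀ : Set (DPoly k n)) =
        ⨅ s ∈ T, saturation (diffIdeal (s.A : Set (DPoly k n))) (s.H : Set (DPoly k n))) := by
  refine ⟨wellFounded_pseudoStep, (configInv_start hF₀ hconst).acc hrk,
    fun c hc => (hc.configInv hrk hF₀ hconst).progress, fun U T hUT t ht => ?_, fun T hT => ?_⟩
  · rw [← descFactorial_sub_one_eq_prod_range]
    exact ((hUT.configInv hrk hF₀ hconst).1 t ht).2
  · obtain ⟨-, hsys, hideal⟩ := hT.configInv hrk hF₀ hconst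
    exact ⟨hsys, hideal.trans (totalIdeal_empty T)⟩
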